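/- Let $\mathcal I$ be an ordinary category and let $\mathcal M$ be a simplicial Quillen presheaf on $\mathcal I$, i.e. a pseudofunctor $i\mapsto\mathcal M(i)$, $(\alpha:i\to i')\mapsto(\alpha_!\dashv\alpha^*)$, from $\mathcal I$ to simplicial model categories and simplicial Quillen adjunctions, such that every $\mathcal M(i)$ is combinatorial. For a small simplicial category $\mathcal J$ with a simplicial functor $\varphi:\mathcal J\to\mathcal I$ (where $\mathcal I$ is regarded as having discrete mapping spaces) and $\alpha:\varphi(j)\to\varphi(k)$ in $\mathcal I$, let $\mathrm{Map}^{\alpha}_{\mathcal J}(j,k)\subseteq\mathrm{Map}_{\mathcal J}(j,k)$ be the preimage of $\alpha$. Let $\mathrm{Sec}_{\mathcal J}(\mathcal M)$ be the category of simplicial sections of $\mathcal M$ along $\mathcal J$: an object $s$ consists of objects $s(j)\in\mathcal M(\varphi(j))$ for $j\in\mathcal J$ and maps of simplicial sets $\mathrm{Map}^{\alpha}_{\mathcal J}(j,k)\to\mathrm{Map}_{\mathcal M(\varphi(k))}(\alpha_!s(j),s(k))$ for all $j,k\in\mathcal J$ and $\alpha:\varphi(j)\to\varphi(k)$, compatible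 with identities and composition; a morphism $T:s\to t$ consists of maps $T(j):s(j)\to t(j)$ in $\mathcal M(\varphi(j))$, compatible with these maps. Equivalently, $\mathrm{Sec}_{\mathcal J}(\mathcal M)$ is the category of simplicial functors over $\mathcal I$ from $\mathcal J$ to the simplicial Grothendieck construction $\int\mathcal M$, whose mapping spaces are $\mathrm{Map}((i,X),(i',Y))=\coprod_{\alpha:i\to i'}\mathrm{Map}_{\mathcal M(i')}(\alpha_!X,Y)$. Let $\mathrm{Sec}^{\mathrm{proj}}_{\mathcal J}(\mathcal M)$ be this category with the projective model structure, in which the weak equivalences and the fibrations are defined levelwise and the cofibrations are the maps with the left lifting property against levelwise trivial fibrations. Let $\psi:\mathcal J\to\mathcal J'$ be a simplicial functor between small simplicial categories over $\mathcal I$ (so $\varphi=\varphi'\circ\psi$). Then the projective model structures on $\mathrm{Sec}_{\mathcal J}(\mathcal M)$ and $\mathrm{Sec}_{\mathcal J'}(\mathcal M)$ exist, the restriction functor $\psi^*:\mathrm{Sec}_{\mathcal J'}(\mathcal M)\to\mathrm{Sec}_{\mathcal J}(\mathcal M)$ has a left adjoint $\psi_!$, and $$\psi_!:\mathrm{Sec}^{\mathrm{proj}}_{\mathcal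 J}(\mathcal M)\rightleftarrows\mathrm{Sec}^{\mathrm{proj}}_{\mathcal J'}(\mathcal M):\psi^*$$ is a Quillen adjunction. If moreover $\psi$ is a Dwyer–Kan equivalence, i.e. all the maps $\mathrm{Map}_{\mathcal J}(j,k)\to\mathrm{Map}_{\mathcal J'}(\psi(j),\psi(k))$ are weak homotopy equivalences and every object of $\mathcal J'$ is isomorphic in the homotopy category of $\mathcal J'$ to an object $\psi(j)$, then $\psi_!\dashv\psi^*$ is a Quillen equivalence. -/

import Mathlib

open CategoryTheory MonoidalCategory Simplicial HomotopicalAlgebra SimplicialCategory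

universe v u u'

namespace SimplicialSections

noncomputable section

section SimplicialSets

/-- A map `f : X ⟶ Y` of simplicial sets is a weak homotopy equivalence if for every Kan complex
`Z`, restriction along `f` induces a bijection `π₀ (Map(Y, Z)) → π₀ (Map(X, Z))`. -/
def IsWeakHomotopyEquivalence {X Y : SSet.{v}} (f : X ⟶ Y) : Prop :=
  ∀ (Z : SSet.{v}) [SSet.KanComplex Z],
    Function.Bijective (SSet.mapπ₀ ((MonoidalClosed.pre f).app Z))

end SimplicialSets

section SimplicialFunctors

variable {C : Type u} [Category.{v} C] [SimplicialCategory C]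
  {D : Type u'} [Category.{v} D] [SimplicialCategory D]

/-- The ordinary functor underlying a simplicial functor between simplicial categories. -/
@[simps, reducible]
def underlying (F : EnrichedFunctor SSet.{v} C D) : C ⥤ D where
  obj X := F.obj X
  map {X Y} f := (eHomEquiv SSet.{v}).symm (eHomEquiv SSet.{v} f ≫ F.map X Y)
  map_id X := by
    rw [Equiv.symm_apply_eq, eHomEquiv_id, eHomEquiv_id, F.map_id]
  map_comp {X Y Z} f g := by
    rw [Equiv.symm_apply_eq, eHomEquiv_comp, eHomEquiv_comp, Equiv.apply_symm_apply,
      Equiv.apply_symm_apply, Category.assoc, Category.assoc, F.map_comp,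
      tensorHom_comp_tensorHom_assoc]

/-- A simplicial adjunction `F ⊣ G`: isomorphisms `Map(F X, Y) ≅ Map(X, G Y)` of simplicial sets
which are simplicially natural in `X` and `Y`. -/
structure SimplicialAdjunction (F : EnrichedFunctor SSet.{v} C D)
    (G : EnrichedFunctor SSet.{v} D C) where
  homIso (X : C) (Y : D) : sHom (F.obj X) Y ≅ sHom X (G.obj Y)
  naturality_left (X X' : C) (Y : D) :
    F.map X X' ▷ sHom (F.obj X') Y ≫ sHomComp (F.obj X) (F.obj X') Y ≫ (homIso X Y).hom =
      sHom X X' ◁ (homIso X' Y).hom ≫ sHomComp X X' (G.obj Y)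
  naturality_right (X : C) (Y Y' : D) :
    sHomComp (F.obj X) Y Y' ≫ (homIso X Y').hom =
      ((homIso X Y).hom ⊗ₘ G.map Y Y') ≫ sHomComp X (G.obj Y) (G.obj Y')

/-- Two morphisms of a simplicial category are weakly homotopic if they lie in the same connected
component of the mapping space. -/
def WeaklyHomotopic {X Y : C} (f g : X ⟶ Y) : Prop :=
  SSet.π₀.mk (homEquiv' X Y f) = SSet.π₀.mk (homEquiv' X Y g)

/-- A morphism of a simplicial category which becomes invertible in the homotopy category. -/
def IsHomotopyInvertible {X Y : C} (f : X ⟶ Y) : Prop :=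
  ∃ g : Y ⟶ X, WeaklyHomotopic (f ≫ g) (𝟙 X) ∧ WeaklyHomotopic (g ≫ f) (𝟙 Y)

/-- Dwyer--Kan equivalences of simplicial categories: simplicial functors inducing weak homotopy
equivalences on mapping spaces, and essentially surjective on homotopy categories. -/
structure IsDwyerKanEquivalence (F : EnrichedFunctor SSet.{v} C D) : Prop where
  map_weakEquivalence (X Y : C) : IsWeakHomotopyEquivalence (F.map X Y)
  exists_obj (Y : D) : ∃ (X : C) (f : F.obj X ⟶ Y), IsHomotopyInvertible f

end SimplicialFunctors

section ModelCategories

variable (C : Type u) [Category.{v} C]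

/-- A simplicial category which is tensored over simplicial sets: a bifunctor `K, X ↦ K ⊗ X`,
together with a universal map `K ⟶ Map(X, K ⊗ X)`; the last field says that
`Map(K ⊗ X, Y) ⟶ Map(X, Y) ^ K` is an isomorphism, in terms of maps from an arbitrary `L`. -/
structure SimplicialTensor [SimplicialCategory C] where
  tensor : SSet.{v} ⥤ C ⥤ C
  unit (K : SSet.{v}) (X : C) : K ⟶ sHom X ((tensor.obj K).obj X)
  unit_naturality_left {K L : SSet.{v}} (k : K ⟶ L) (X : C) :
    unit K X ≫ eHomWhiskerLeft SSet.{v} X ((tensor.map k).app X) = k ≫ unit L X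
  unit_naturality_right (K : SSet.{v}) {X Y : C} (f : X ⟶ Y) :
    unit K X ≫ eHomWhiskerLeft SSet.{v} X ((tensor.obj K).map f) =
      unit K Y ≫ eHomWhiskerRight SSet.{v} f ((tensor.obj K).obj Y)
  bijective (K : SSet.{v}) (X Y : C) (L : SSet.{v}) :
    Function.Bijective (fun g : L ⟶ sHom ((tensor.obj K).obj X) Y ↦
      (unit K X ⊗ₘ g) ≫ sHomComp X ((tensor.obj K).obj X) Y)

/-- A simplicial category is cotensored over simplicial sets if for all `K` and `Y` there are
an object `P = Y ^ K` and a map `K ⟶ Map(P, Y)` inducing isomorphisms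
`Map(X, P) ⟶ Map(X, Y) ^ K`. -/
def IsCotensored [SimplicialCategory C] : Prop :=
  ∀ (K : SSet.{v}) (Y : C), ∃ (P : C) (ε : K ⟶ sHom P Y), ∀ (X : C) (L : SSet.{v}),
    Function.Bijective (fun g : L ⟶ sHom X P ↦ (g ⊗ₘ ε) ≫ sHomComp X P Y)

/-- Simplicial model categories: a model structure on a simplicial category which is tensored and
cotensored over simplicial sets and satisfies the pushout-product axiom. -/
def IsSimplicialModelCategory [SimplicialCategory C] [ModelCategory C] : Prop :=
  IsCotensored C ∧ ∃ T : SimplicialTensor C,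
    ∀ {K L : SSet.{v}} (k : K ⟶ L) {A B : C} (i : A ⟶ B) (sq : T.tensor.PushoutObjObj k i),
      Mono k → Cofibration i → Cofibration sq.ι ∧
        (IsWeakHomotopyEquivalence k ∨ WeakEquivalence i → WeakEquivalence sq.ι)

/-- Combinatorial model categories: the underlying category is locally presentable, and the model
structure is generated by sets of cofibrations and of trivial cofibrations. -/
structure IsCombinatorial [ModelCategory C] : Prop where
  isLocallyPresentable : IsLocallyPresentable.{v} C
  exists_generatingCofibrations : ∃ W : MorphismProperty C,
    MorphismProperty.IsSmall.{v} W ∧ trivialFibrations C = W.rlp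
  exists_generatingTrivialCofibrations : ∃ W : MorphismProperty C,
    MorphismProperty.IsSmall.{v} W ∧ fibrations C = W.rlp

variable {C} {D : Type u'} [Category.{v} D] [ModelCategory C] [ModelCategory D]

/-- A functor between model categories that preserves cofibrations and trivial cofibrations. -/
structure PreservesCofibrations (L : C ⥤ D) : Prop where
  cofibration {X Y : C} (f : X ⟶ Y) : Cofibration f → Cofibration (L.map f)
  trivialCofibration {X Y : C} (f : X ⟶ Y) :
    Cofibration f → WeakEquivalence f → Cofibration (L.map f) ∧ WeakEquivalence (L.map f)

/-- An adjunction between model categories is a Quillen adjunction if its left adjoint preserves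
cofibrations and trivial cofibrations. -/
def IsQuillenAdjunction {L : C ⥤ D} {R : D ⥤ C} (_adj : L ⊣ R) : Prop :=
  PreservesCofibrations L

/-- A Quillen adjunction `L ⊣ R` is a Quillen equivalence if for all cofibrant `X` and fibrant
`Y`, a map `L X ⟶ Y` is a weak equivalence iff the adjoint map `X ⟶ R Y` is one. -/
structure IsQuillenEquivalence {L : C ⥤ D} {R : D ⥤ C} (adj : L ⊣ R) : Prop where
  isQuillenAdjunction : IsQuillenAdjunction adj
  weakEquivalence_iff (X : C) (Y : D) (f : L.obj X ⟶ Y) : IsCofibrant X → IsFibrant Y →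
    (WeakEquivalence f ↔ WeakEquivalence (adj.homEquiv X Y f))

end ModelCategories

section QuillenPresheaves

/-- A simplicial Quillen presheaf on an ordinary category `I`: a pseudofunctor from `I` to simplicial
model categories and simplicial Quillen adjunctions `α_! ⊣ α^*`. The structure isomorphisms of
the pseudofunctor are simplicially natural isomorphisms between the left adjoints. -/
structure SimplicialQuillenPresheaf (I : Type u') [Category.{v} I] where
  fiber : I → Type u
  [category (i : I) : Category.{v} (fiber i)]
  [simplicialCategory (i : I) : SimplicialCategory (fiber i)]
  [modelCategory (i : I) : ModelCategory (fiber i)]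
  isSimplicialModelCategory (i : I) : IsSimplicialModelCategory (fiber i)
  push {i j : I} (α : i ⟶ j) : EnrichedFunctor SSet.{v} (fiber i) (fiber j)
  pull {i j : I} (α : i ⟶ j) : EnrichedFunctor SSet.{v} (fiber j) (fiber i)
  adj {i j : I} (α : i ⟶ j) : SimplicialAdjunction (push α) (pull α)
  push_preservesCofibrations {i j : I} (α : i ⟶ j) : PreservesCofibrations (underlying (push α))
  pushId (i : I) (X : fiber i) : (push (𝟙 i)).obj X ≅ X
  pushComp {i j k : I} (α : i ⟶ j) (β : j ⟶ k) (X : fiber i) :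
    (push (α ≫ β)).obj X ≅ (push β).obj ((push α).obj X)
  pushId_naturality (i : I) (X Y : fiber i) :
    (push (𝟙 i)).map X Y ≫ eHomWhiskerLeft SSet.{v} _ (pushId i Y).hom =
      eHomWhiskerRight SSet.{v} (pushId i X).hom Y
  pushComp_naturality {i j k : I} (α : i ⟶ j) (β : j ⟶ k) (X Y : fiber i) :
    (push (α ≫ β)).map X Y ≫ eHomWhiskerLeft SSet.{v} _ (pushComp α β Y).hom =
      (push α).map X Y ≫ (push β).map _ _ ≫ eHomWhiskerRight SSet.{v} (pushComp α β X).hom _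
  pushComp_id_left {i j : I} (α : i ⟶ j) (X : fiber i) :
    (pushComp (𝟙 i) α X).hom ≫ (underlying (push α)).map (pushId i X).hom =
      eqToHom (by rw [Category.id_comp])
  pushComp_id_right {i j : I} (α : i ⟶ j) (X : fiber i) :
    (pushComp α (𝟙 j) X).hom ≫ (pushId j ((push α).obj X)).hom =
      eqToHom (by rw [Category.comp_id])
  pushComp_assoc {i j k l : I} (α : i ⟶ j) (β : j ⟶ k) (γ : k ⟶ l) (X : fiber i) :
    (pushComp (α ≫ β) γ X).hom ≫ (underlying (push γ)).map (pushComp α β X).hom =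
      eqToHom (by rw [Category.assoc]) ≫ (pushComp α (β ≫ γ) X).hom ≫
        (pushComp β γ ((push α).obj X)).hom

attribute [instance] SimplicialQuillenPresheaf.category
  SimplicialQuillenPresheaf.simplicialCategory SimplicialQuillenPresheaf.modelCategory

end QuillenPresheaves

section Over

variable {J : Type u} [Category.{v} J] [SimplicialCategory J] {I : Type u'} [Category.{v} I]

variable (J I) in
/-- A simplicial functor from a simplicial category `J` to an ordinary category `I`, the latter being
regarded as a simplicial category with discrete mapping spaces. -/
structure FunctorToOrdinary where
  obj : J → I
  map {j k : J} {n : SimplexCategoryᵒᵖ} : (sHom j k).obj n → (obj j ⟶ obj k)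
  map_simplicial {j k : J} {n m : SimplexCategoryᵒᵖ} (θ : n ⟶ m) (x : (sHom j k).obj n) :
    map ((sHom j k).map θ x) = map x
  map_id (j : J) (n : SimplexCategoryᵒᵖ) :
    map ((eId SSet.{v} j).app n PUnit.unit) = 𝟙 (obj j)
  map_comp {j k l : J} {n : SimplexCategoryᵒᵖ} (x : (sHom j k).obj n) (y : (sHom k l).obj n) :
    map ((sHomComp j k l).app n ⟨x, y⟩) = map x ≫ map y

namespace FunctorToOrdinary

variable (φ : FunctorToOrdinary J I)

/-- The preimage `Map^α(j, k) ⊆ Map(j, k)` of `α : φ(j) ⟶ φ(k)`. -/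
@[simps]
def mapOver {j k : J} (α : φ.obj j ⟶ φ.obj k) : (sHom j k).Subcomplex where
  obj _ := {x | φ.map x = α}
  map θ x hx := (φ.map_simplicial θ x).trans hx

/-- The identity of `j`, as a vertex of `Map^𝟙(j, j)`. -/
def idOver (j : J) : 𝟙_ SSet.{v} ⟶ (φ.mapOver (𝟙 (φ.obj j)) : SSet.{v}) :=
  SSet.Subcomplex.lift (eId SSet.{v} j) (by
    rintro n _ ⟨⟨⟩, rfl⟩
    exact φ.map_id j n)

/-- The composition `Map^α(j, k) × Map^β(k, l) ⟶ Map^{β ∘ α}(j, l)`. -/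
def compOver {j k l : J} (α : φ.obj j ⟶ φ.obj k) (β : φ.obj k ⟶ φ.obj l) :
    (φ.mapOver α : SSet.{v}) ⊗ (φ.mapOver β : SSet.{v}) ⟶ (φ.mapOver (α ≫ β) : SSet.{v}) :=
  SSet.Subcomplex.lift (((φ.mapOver α).ι ⊗ₘ (φ.mapOver β).ι) ≫ sHomComp j k l) (by
    rintro n _ ⟨⟨⟨x, rfl⟩, ⟨y, rfl⟩⟩, rfl⟩
    exact φ.map_comp x y)

variable {K : Type u} [Category.{v} K] [SimplicialCategory K]

/-- The composite of a simplicial functor `ψ : K ⟶ J` with `φ : J ⟶ I`. -/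
@[simps, reducible]
def precomp (ψ : EnrichedFunctor SSet.{v} K J) : FunctorToOrdinary K I where
  obj j := φ.obj (ψ.obj j)
  map {j k n} x := φ.map ((ψ.map j k).app n x)
  map_simplicial θ x := by
    rw [NatTrans.naturality_apply, φ.map_simplicial]
  map_id j n := by
    rw [← φ.map_id, ← ψ.map_id]
    rfl
  map_comp {j k l n} x y := by
    rw [← φ.map_comp]
    congr 1
    exact ConcreteCategory.congr_hom (NatTrans.congr_app (ψ.map_comp j k l) n) ⟨x, y⟩

/-- The map `Map^α(j, k) ⟶ Map^α(ψ j, ψ k)` induced by `ψ`. -/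
def precompOver (ψ : EnrichedFunctor SSet.{v} K J) {j k : K}
    (α : φ.obj (ψ.obj j) ⟶ φ.obj (ψ.obj k)) :
    ((φ.precomp ψ).mapOver (j := j) (k := k) α : SSet.{v}) ⟶ (φ.mapOver α : SSet.{v}) :=
  SSet.Subcomplex.lift (((φ.precomp ψ).mapOver (j := j) (k := k) α).ι ≫ ψ.map j k) (by
    rintro n _ ⟨⟨x, hx⟩, rfl⟩
    exact hx)

lemma idOver_precompOver (ψ : EnrichedFunctor SSet.{v} K J) (j : K) :
    (φ.precomp ψ).idOver j ≫ φ.precompOver ψ (𝟙 (φ.obj (ψ.obj j))) = φ.idOver (ψ.obj j) := by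
  rw [← cancel_mono (SSet.Subcomplex.ι _)]
  exact ψ.map_id j

lemma compOver_precompOver (ψ : EnrichedFunctor SSet.{v} K J) {j k l : K}
    (α : φ.obj (ψ.obj j) ⟶ φ.obj (ψ.obj k)) (β : φ.obj (ψ.obj k) ⟶ φ.obj (ψ.obj l)) :
    (φ.precomp ψ).compOver (j := j) (k := k) (l := l) α β ≫ φ.precompOver ψ (α ≫ β) =
      (φ.precompOver ψ α ⊗ₘ φ.precompOver ψ β) ≫ φ.compOver α β := by
  rw [← cancel_mono (SSet.Subcomplex.ι _)]
  ext n ⟨⟨x, hx⟩, ⟨y, hy⟩⟩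
  exact ConcreteCategory.congr_hom (NatTrans.congr_app (ψ.map_comp j k l) n) ⟨x, y⟩

end FunctorToOrdinary

end Over

section Sections

variable {I : Type u'} [Category.{v} I] (M : SimplicialQuillenPresheaf.{v, u} I)
  {J : Type v} [Category.{v} J] [SimplicialCategory J]

/-- A simplicial section of `M` along `φ : J ⟶ I`, i.e. a simplicial functor over `I` from `J` to
the simplicial category `∫ M` with objects the pairs `(i, X)`, `X ∈ M(i)`, and mapping spaces
`Map((i, X), (i', Y)) = ∐_{α : i ⟶ i'} Map(α_! X, Y)`. Such a functor consists of
objects `s(j) ∈ M(φ(j))` and, for every `α : φ(j) ⟶ φ(k)`, of a map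
`Map^α(j, k) ⟶ Map(α_! s(j), s(k))`, compatibly with units and composition. -/
structure SimplicialSection (φ : FunctorToOrdinary J I) where
  obj (j : J) : M.fiber (φ.obj j)
  map {j k : J} (α : φ.obj j ⟶ φ.obj k) :
    (φ.mapOver α : SSet.{v}) ⟶ sHom ((M.push α).obj (obj j)) (obj k)
  map_id (j : J) :
    φ.idOver j ≫ map (𝟙 (φ.obj j)) = eHomEquiv SSet.{v} (M.pushId (φ.obj j) (obj j)).hom
  map_comp {j k l : J} (α : φ.obj j ⟶ φ.obj k) (β : φ.obj k ⟶ φ.obj l) :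
    φ.compOver α β ≫ map (α ≫ β) =
      (map α ⊗ₘ map β) ≫ (M.push β).map _ _ ▷ _ ≫ sHomComp _ _ _ ≫
        eHomWhiskerRight SSet.{v} (M.pushComp α β (obj j)).hom (obj l)

namespace SimplicialSection

variable {M} {φ : FunctorToOrdinary J I}

/-- Morphisms of sections are the simplicial natural transformations over `I`. -/
@[ext]
structure Hom (s t : SimplicialSection M φ) where
  app (j : J) : s.obj j ⟶ t.obj j
  naturality {j k : J} (α : φ.obj j ⟶ φ.obj k) :
    s.map α ≫ eHomWhiskerLeft SSet.{v} _ (app k) =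
      t.map α ≫ eHomWhiskerRight SSet.{v} ((underlying (M.push α)).map (app j)) _

/-- The category `Sec_J(M)` of simplicial sections. -/
instance : Category.{v} (SimplicialSection M φ) where
  Hom := Hom
  id s :=
    { app j := 𝟙 (s.obj j)
      naturality α := by
        rw [eHomWhiskerLeft_id, CategoryTheory.Functor.map_id, eHomWhiskerRight_id] }
  comp T T' :=
    { app j := T.app j ≫ T'.app j
      naturality α := by
        rw [eHomWhiskerLeft_comp, ← Category.assoc, T.naturality α, Category.assoc,
          ← eHom_whisker_exchange, ← Category.assoc, T'.naturality α, Category.assoc,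
          CategoryTheory.Functor.map_comp, eHomWhiskerRight_comp] }
  id_comp _ := Hom.ext (funext fun _ ↦ Category.id_comp _)
  comp_id _ := Hom.ext (funext fun _ ↦ Category.comp_id _)
  assoc _ _ _ := Hom.ext (funext fun _ ↦ Category.assoc _ _ _)

/-- A map of sections which is levelwise a fibration. -/
def IsLevelwiseFibration {s t : SimplicialSection M φ} (T : s ⟶ t) : Prop :=
  ∀ j : J, Fibration (Hom.app T j)

/-- A map of sections which is levelwise a weak equivalence. -/
def IsLevelwiseWeakEquivalence {s t : SimplicialSection M φ} (T : s ⟶ t) : Prop :=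
  ∀ j : J, WeakEquivalence (Hom.app T j)

/-- The projective model structure on `Sec_J(M)`: weak equivalences and fibrations are levelwise,
and cofibrations are the maps with the left lifting property against the levelwise trivial
fibrations. -/
structure IsProjective (P : ModelCategory (SimplicialSection M φ)) : Prop where
  weakEquivalence_iff {s t : SimplicialSection M φ} (T : s ⟶ t) :
    WeakEquivalence T ↔ IsLevelwiseWeakEquivalence T
  fibration_iff {s t : SimplicialSection M φ} (T : s ⟶ t) :
    Fibration T ↔ IsLevelwiseFibration T
  cofibration_iff {s t : SimplicialSection M φ} (T : s ⟶ t) :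
    Cofibration T ↔ ∀ {s' t' : SimplicialSection M φ} (T' : s' ⟶ t'),
      IsLevelwiseFibration T' → IsLevelwiseWeakEquivalence T' → HasLiftingProperty T T'

variable (M) {J' : Type v} [Category.{v} J'] [SimplicialCategory J']
  (φ' : FunctorToOrdinary J' I) (ψ : EnrichedFunctor SSet.{v} J J')

variable {M φ'} in
/-- The restriction `ψ^* s` of a section `s` along `J'` to a section along `J`, where `J` lies over
`I` through `ψ : J ⟶ J'`. -/
@[simps, reducible]
def restrict (s : SimplicialSection M φ') : SimplicialSection M (φ'.precomp ψ) where
  obj j := s.obj (ψ.obj j)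
  map α := φ'.precompOver ψ α ≫ s.map α
  map_id j := by
    rw [← Category.assoc, φ'.idOver_precompOver, s.map_id]
  map_comp α β := by
    rw [← Category.assoc, φ'.compOver_precompOver, Category.assoc, s.map_comp,
      ← tensorHom_comp_tensorHom, Category.assoc]

variable {M φ'} in
/-- The restriction of a map of sections. -/
@[simps, reducible]
def Hom.restrict {s t : SimplicialSection M φ'} (T : Hom s t) :
    Hom (s.restrict ψ) (t.restrict ψ) where
  app j := T.app (ψ.obj j)
  naturality {j k} α := by
    have h := congrArg (φ'.precompOver ψ (j := j) (k := k) α ≫ ·) (T.naturality α)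
    exact (Category.assoc _ _ _).trans (h.trans (Category.assoc _ _ _).symm)

/-- The restriction functor `ψ^* : Sec_{J'}(M) ⥤ Sec_J(M)`. -/
def restriction : SimplicialSection M φ' ⥤ SimplicialSection M (φ'.precomp ψ) where
  obj s := s.restrict ψ
  map T := Hom.restrict ψ T

end SimplicialSection

end Sections

end

end SimplicialSections

/-! Everything rests on the fact that evaluation of sections at an object has adjoints on both
sides. The left adjoint sends `X` to the free section `k ↦ ∐_α Map^α(j, k) ⊗ α_! X` (`FreeData`),
the right adjoint sends `E` to the cofree section `j ↦ ∏_α (α^* E) ^ Map^α(j, k)` (`CofreeData`),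
and limits and colimits of sections are levelwise.

Model structure. The free sections on generating (trivial) cofibrations give both factorizations by
the small object argument (`hasFactorization_levelwise`). Acyclicity is not checked on pushouts of
free maps but dually: by the pushout-product axiom the cofree functors send fibrations to levelwise
fibrations (`hasLiftingProperty_cofree_map_app`), so a map lifting against all levelwise fibrations
is levelwise a trivial cofibration (`levelwise_trivialCofibrations_of_llp`). The left adjoint `ψ_!`
comes from the adjoint triangle theorem, because forgetting the action of the mapping spaces is
monadic; since `ψ^*` visibly preserves levelwise fibrations and weak equivalences, the adjunction is
Quillen.

Quillen equivalence. As `ψ^*` preserves all weak equivalences, two facts suffice: `ψ^*` reflects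
weak equivalences, and the unit `η : X ⟶ ψ^* ψ_! X` is one for cofibrant `X`.

For the first, a morphism that is invertible in the homotopy category acts by weak equivalences on a
levelwise cofibrant section, by a two-out-of-six argument (`weakEquivalence_act`). Hence being a
weak equivalence at `ψ(j)` spreads to every object that is homotopy equivalent to `ψ(j)`.

For the second, maps from `(ψ_! X)(ψ k)` to `E` are maps from `X` to the restricted cofree section,
maps `X(k) ⟶ E` are maps from `X` to the cofree section over `J`, and precomposition with `η` is
composition with a comparison map. At level `j` the latter is restriction along the maps `Map^α(j,
k) ⟶ Map^α(ψ j, ψ k)`. These are weak homotopy equivalences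
(`IsWeakHomotopyEquivalence.of_isClopen`) but need not be monomorphisms, so they are replaced by the
inclusions into their mapping cylinders. For a fibration `E ⟶ D` the resulting corner map is a
levelwise trivial fibration, and maps from the cofibrant `X` lift along it
(`pathSection.exists_lift`). Read through the adjunctions, this says that the inclusion of `X(k)` at
the free end of the mapping cylinder of `η` at `k` lifts against every fibration. It is thus a
trivial cofibration, and `η` is a weak equivalence (`weakEquivalence_unit_app`). -/

namespace SimplicialSections

noncomputable section

/-! ### Calculus of simplices in simplicial categories -/

section Elements

variable {C : Type u} [Category.{v} C] [SimplicialCategory C]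
  {D : Type u'} [Category.{v} D] [SimplicialCategory D]

/-- Composition of `n`-simplices of the mapping spaces of a simplicial category. -/
def scomp {X Y Z : C} {n : SimplexCategoryᵒᵖ} (x : (sHom X Y).obj n) (y : (sHom Y Z).obj n) :
    (sHom X Z).obj n :=
  (sHomComp X Y Z).app n ⟨x, y⟩

infixr:80 "⊚" => scomp

/-- The totally degenerate `n`-simplex of a mapping space given by a morphism. -/
def deg (n : SimplexCategoryᵒᵖ) {X Y : C} (f : X ⟶ Y) : (sHom X Y).obj n :=
  (eHomEquiv SSet.{v} f).app n PUnit.unit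

@[simp]
lemma scomp_assoc {X Y Z W : C} {n : SimplexCategoryᵒᵖ} (x : (sHom X Y).obj n)
    (y : (sHom Y Z).obj n) (z : (sHom Z W).obj n) : (x ⊚ y) ⊚ z = x ⊚ y ⊚ z :=
  (ConcreteCategory.congr_hom (NatTrans.congr_app (e_assoc SSet.{v} X Y Z W) n) ⟨x, y, z⟩)

lemma eId_app (X : C) (n : SimplexCategoryᵒᵖ) (t : (𝟙_ SSet.{v}).obj n) :
    (eId SSet.{v} X).app n t = deg n (𝟙 X) := by
  rw [deg, eHomEquiv_id]
  rfl

@[simp]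
lemma deg_id_scomp {X Y : C} {n : SimplexCategoryᵒᵖ} (x : (sHom X Y).obj n) :
    deg n (𝟙 X) ⊚ x = x := by
  rw [← eId_app X n PUnit.unit]
  exact ConcreteCategory.congr_hom (NatTrans.congr_app (e_id_comp SSet.{v} X Y) n) x

@[simp]
lemma scomp_deg_id {X Y : C} {n : SimplexCategoryᵒᵖ} (x : (sHom X Y).obj n) :
    x ⊚ deg n (𝟙 Y) = x := by
  rw [← eId_app Y n PUnit.unit]
  exact ConcreteCategory.congr_hom (NatTrans.congr_app (e_comp_id SSet.{v} X Y) n) x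

lemma deg_comp (n : SimplexCategoryᵒᵖ) {X Y Z : C} (f : X ⟶ Y) (g : Y ⟶ Z) :
    deg n (f ≫ g) = deg n f ⊚ deg n g := by
  rw [deg, eHomEquiv_comp]
  rfl

lemma deg_scomp_deg_scomp {n : SimplexCategoryᵒᵖ} {X Y Z W : C} (f : X ⟶ Y) (g : Y ⟶ Z)
    (x : (sHom Z W).obj n) :
    deg n f ⊚ deg n g ⊚ x = deg n (f ≫ g) ⊚ x := by
  rw [deg_comp, scomp_assoc]

lemma eHomEquiv_app {X Y : C} (f : X ⟶ Y) {n : SimplexCategoryᵒᵖ} (t : (𝟙_ SSet.{v}).obj n) :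
    (eHomEquiv SSet.{v} f).app n t = deg n f := rfl

lemma map_deg {X Y : C} {n m : SimplexCategoryᵒᵖ} (θ : n ⟶ m) (f : X ⟶ Y) :
    (sHom X Y).map θ (deg n f) = deg m f :=
  (NatTrans.naturality_apply (eHomEquiv SSet.{v} f) θ PUnit.unit).symm

lemma deg_zero_injective {X Y : C} {f g : X ⟶ Y}
    (h : deg (Opposite.op (SimplexCategory.mk 0)) f = deg (Opposite.op (SimplexCategory.mk 0)) g) :
    f = g :=
  (homEquiv' X Y).injective h

lemma deg_zero_eq_homEquiv' {X Y : C} (f : X ⟶ Y) :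
    deg (Opposite.op (SimplexCategory.mk 0)) f = homEquiv' X Y f := rfl

variable (F : EnrichedFunctor SSet.{v} C D)

lemma enrichedFunctor_map_scomp {X Y Z : C} {n : SimplexCategoryᵒᵖ} (x : (sHom X Y).obj n)
    (y : (sHom Y Z).obj n) :
    (F.map X Z).app n (x ⊚ y) = (F.map X Y).app n x ⊚ (F.map Y Z).app n y :=
  ConcreteCategory.congr_hom (NatTrans.congr_app (F.map_comp X Y Z) n) ⟨x, y⟩

lemma enrichedFunctor_map_deg {X Y : C} {n : SimplexCategoryᵒᵖ} (f : X ⟶ Y) :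
    (F.map X Y).app n (deg n f) = deg n ((underlying F).map f) := by
  dsimp [deg]
  rw [Equiv.apply_symm_apply]
  rfl

variable {F} {G : EnrichedFunctor SSet.{v} D C} (adj : SimplicialAdjunction F G)

lemma SimplicialAdjunction.homIso_map_scomp {X X' : C} {Y : D} {n : SimplexCategoryᵒᵖ}
    (x : (sHom X X').obj n) (y : (sHom (F.obj X') Y).obj n) :
    (adj.homIso X Y).hom.app n ((F.map X X').app n x ⊚ y) =
      x ⊚ (adj.homIso X' Y).hom.app n y :=
  ConcreteCategory.congr_hom (NatTrans.congr_app (adj.naturality_left X X' Y) n) ⟨x, y⟩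

lemma SimplicialAdjunction.homIso_scomp {X : C} {Y Y' : D} {n : SimplexCategoryᵒᵖ}
    (x : (sHom (F.obj X) Y).obj n) (y : (sHom Y Y').obj n) :
    (adj.homIso X Y').hom.app n (x ⊚ y) =
      (adj.homIso X Y).hom.app n x ⊚ (G.map Y Y').app n y :=
  ConcreteCategory.congr_hom (NatTrans.congr_app (adj.naturality_right _ _ _) n) ⟨x, y⟩

/-- The bijection on morphisms given by a simplicial adjunction. -/
def SimplicialAdjunction.homEquiv (X : C) (Y : D) : (F.obj X ⟶ Y) ≃ (X ⟶ G.obj Y) :=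
  (homEquiv' _ _).trans (((adj.homIso X Y).app _).toEquiv.trans (homEquiv' _ _).symm)

lemma SimplicialAdjunction.deg_homEquiv {X : C} {Y : D} (f : F.obj X ⟶ Y)
    (n : SimplexCategoryᵒᵖ) :
    deg n (adj.homEquiv X Y f) = (adj.homIso X Y).hom.app n (deg n f) := by
  have h : deg (Opposite.op (SimplexCategory.mk 0)) (adj.homEquiv X Y f) =
      (adj.homIso X Y).hom.app _ (deg _ f) :=
    (homEquiv' _ _).apply_symm_apply _
  -- The simplices `deg n f` are the degeneracies of the vertex `f`, so it suffices to compare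
  -- vertices.
  rw [← map_deg (SimplexCategory.const n.unop (SimplexCategory.mk 0) 0).op, h,
    ← NatTrans.naturality_apply, map_deg]

/-- The ordinary adjunction underlying a simplicial adjunction. -/
def SimplicialAdjunction.toAdjunction : underlying F ⊣ underlying G :=
  Adjunction.mkOfHomEquiv
    { homEquiv X Y := adj.homEquiv X Y
      homEquiv_naturality_left_symm {X X' Y} f g := by
        rw [Equiv.symm_apply_eq]
        apply deg_zero_injective
        rw [adj.deg_homEquiv, deg_comp, deg_comp, ← enrichedFunctor_map_deg,
          adj.homIso_map_scomp, ← adj.deg_homEquiv, Equiv.apply_symm_apply]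
      homEquiv_naturality_right {X Y Y'} f g := by
        apply deg_zero_injective
        rw [adj.deg_homEquiv, deg_comp, deg_comp, ← enrichedFunctor_map_deg,
          adj.homIso_scomp, ← adj.deg_homEquiv] }

end Elements

/-! ### Coproducts of tensors and products of cotensors -/

section TensorsAndCotensors

variable {C : Type u} [Category.{v} C] [SimplicialCategory C]
  {D : Type u'} [Category.{v} D] [SimplicialCategory D]

/-- Morphisms `K ⊗ X ⟶ Y` identify to maps `K ⟶ Map(X, Y)`. -/
def SimplicialTensor.homEquiv (T : SimplicialTensor C) (K : SSet.{v}) (X Y : C) :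
    ((T.tensor.obj K).obj X ⟶ Y) ≃ (K ⟶ sHom X Y) :=
  Equiv.ofBijective (fun f ↦ T.unit K X ≫ eHomWhiskerLeft SSet.{v} X f) (by
    have h := ((T.bijective K X Y (𝟙_ SSet.{v})).comp (eHomEquiv SSet.{v}).bijective)
    have h' : Function.Bijective (fun f : K ⊗ 𝟙_ SSet.{v} ⟶ sHom X Y ↦ (ρ_ K).inv ≫ f) :=
      (Iso.homFromEquiv (ρ_ K)).bijective
    exact h'.comp h)

lemma SimplicialTensor.homEquiv_apply (T : SimplicialTensor C) {K : SSet.{v}} {X Y : C}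
    (f : (T.tensor.obj K).obj X ⟶ Y) :
    T.homEquiv K X Y f = T.unit K X ≫ eHomWhiskerLeft SSet.{v} X f := rfl

lemma SimplicialTensor.homEquiv_comp (T : SimplicialTensor C) {K : SSet.{v}} {X Y Y' : C}
    (f : (T.tensor.obj K).obj X ⟶ Y) (g : Y ⟶ Y') :
    T.homEquiv K X Y' (f ≫ g) = T.homEquiv K X Y f ≫ eHomWhiskerLeft SSet.{v} X g := by
  simp [homEquiv_apply]

lemma SimplicialTensor.homEquiv_map_app_comp (T : SimplicialTensor C) {K L : SSet.{v}} {X Y : C}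
    (k : K ⟶ L) (f : (T.tensor.obj L).obj X ⟶ Y) :
    T.homEquiv K X Y ((T.tensor.map k).app X ≫ f) = k ≫ T.homEquiv L X Y f := by
  rw [homEquiv_comp, homEquiv_apply, homEquiv_apply, T.unit_naturality_left, Category.assoc]

lemma SimplicialTensor.homEquiv_map_comp (T : SimplicialTensor C) {K : SSet.{v}} {X X' Y : C}
    (x : X ⟶ X') (f : (T.tensor.obj K).obj X' ⟶ Y) :
    T.homEquiv K X Y ((T.tensor.obj K).map x ≫ f) =
      T.homEquiv K X' Y f ≫ eHomWhiskerRight SSet.{v} x Y := by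
  rw [homEquiv_comp, homEquiv_apply, homEquiv_apply, T.unit_naturality_right, Category.assoc,
    Category.assoc, eHom_whisker_exchange]

/-- Maps `K ⟶ Map(X, Y)` identify to morphisms to a cotensor. -/
lemma IsCotensored.exists_cotensor (hC : IsCotensored C) (K : SSet.{v}) (Y : C) :
    ∃ (P : C) (ε : K ⟶ sHom P Y),
      (∀ (X : C) (L : SSet.{v}),
        Function.Bijective (fun g : L ⟶ sHom X P ↦ (g ⊗ₘ ε) ≫ sHomComp X P Y)) ∧
      ∀ (X : C), Function.Bijective (fun g : X ⟶ P ↦ ε ≫ eHomWhiskerRight SSet.{v} g Y) := by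
  obtain ⟨P, ε, h⟩ := hC K Y
  refine ⟨P, ε, h, fun X ↦ ?_⟩
  have h₁ := (h X (𝟙_ SSet.{v})).comp (eHomEquiv SSet.{v}).bijective
  have h₂ : Function.Bijective (fun f : 𝟙_ SSet.{v} ⊗ K ⟶ sHom X Y ↦ (λ_ K).inv ≫ f) :=
    (Iso.homFromEquiv (λ_ K)).bijective
  exact h₂.comp h₁

section

variable {𝒦 : Type*} [Category 𝒦] {F : 𝒦 ⥤ C}

/-- Tensors upgrade ordinary limits to simplicial ones: maps `L ⟶ Map(Z, c)` are morphisms `L ⊗ Z ⟶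
c`, to which the ordinary universal property applies. -/
lemma SimplicialTensor.toHom_ext (T : SimplicialTensor C) {c : Limits.Cone F}
    (hc : Limits.IsLimit c) {L : SSet.{v}} {Z : C} {g g' : L ⟶ sHom Z c.pt}
    (h : ∀ i, g ≫ eHomWhiskerLeft SSet.{v} Z (c.π.app i) =
      g' ≫ eHomWhiskerLeft SSet.{v} Z (c.π.app i)) : g = g' := by
  obtain ⟨f, rfl⟩ := (T.homEquiv _ _ _).surjective g
  obtain ⟨f', rfl⟩ := (T.homEquiv _ _ _).surjective g'
  congr 1
  refine hc.hom_ext fun i ↦ (T.homEquiv _ _ _).injective ?_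
  rw [T.homEquiv_comp, T.homEquiv_comp, h]

lemma SimplicialTensor.exists_lift (T : SimplicialTensor C) {c : Limits.Cone F}
    (hc : Limits.IsLimit c) {L : SSet.{v}} {Z : C} (g : ∀ i, L ⟶ sHom Z (F.obj i))
    (hg : ∀ {i i' : 𝒦} (a : i ⟶ i'), g i ≫ eHomWhiskerLeft SSet.{v} Z (F.map a) = g i') :
    ∃ g' : L ⟶ sHom Z c.pt, ∀ i, g' ≫ eHomWhiskerLeft SSet.{v} Z (c.π.app i) = g i := by
  let s : Limits.Cone F :=
    { pt := (T.tensor.obj L).obj Z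
      π :=
        { app i := (T.homEquiv _ _ _).symm (g i)
          naturality i i' a := by
            dsimp
            rw [Category.id_comp, Equiv.symm_apply_eq, T.homEquiv_comp, Equiv.apply_symm_apply,
              hg] } }
  refine ⟨T.homEquiv _ _ _ (hc.lift s), fun i ↦ ?_⟩
  rw [← T.homEquiv_comp, hc.fac]
  exact Equiv.apply_symm_apply _ _

/-- Dually, cotensors upgrade ordinary colimits to simplicial ones, as maps `L ⟶ Map(c, Y)` are
morphisms `c ⟶ Y ^ L`. -/
lemma IsCotensored.fromHom_ext (hC : IsCotensored C) {c : Limits.Cocone F}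
    (hc : Limits.IsColimit c) {L : SSet.{v}} {Y : C} {g g' : L ⟶ sHom c.pt Y}
    (h : ∀ i, g ≫ eHomWhiskerRight SSet.{v} (c.ι.app i) Y =
      g' ≫ eHomWhiskerRight SSet.{v} (c.ι.app i) Y) : g = g' := by
  obtain ⟨P, ε, -, hε⟩ := hC.exists_cotensor L Y
  obtain ⟨f, rfl⟩ := (hε _).2 g
  obtain ⟨f', rfl⟩ := (hε _).2 g'
  dsimp
  congr 2
  refine hc.hom_ext fun i ↦ (hε _).1 ?_
  simpa using h i

lemma IsCotensored.exists_desc (hC : IsCotensored C) {c : Limits.Cocone F}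
    (hc : Limits.IsColimit c) {L : SSet.{v}} {Y : C} (g : ∀ i, L ⟶ sHom (F.obj i) Y)
    (hg : ∀ {i i' : 𝒦} (a : i ⟶ i'), g i' ≫ eHomWhiskerRight SSet.{v} (F.map a) Y = g i) :
    ∃ g' : L ⟶ sHom c.pt Y, ∀ i, g' ≫ eHomWhiskerRight SSet.{v} (c.ι.app i) Y = g i := by
  obtain ⟨P, ε, -, hε⟩ := hC.exists_cotensor L Y
  choose f hf using fun i ↦ (hε (F.obj i)).2 (g i)
  dsimp at hf
  let s : Limits.Cocone F :=
    { pt := P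
      ι :=
        { app i := f i
          naturality i i' a := by
            refine (hε _).1 ?_
            dsimp
            rw [Category.comp_id, eHomWhiskerRight_comp, ← Category.assoc, hf, hg, hf] } }
  refine ⟨ε ≫ eHomWhiskerRight SSet.{v} (hc.desc s) Y, fun i ↦ ?_⟩
  rw [Category.assoc, ← eHomWhiskerRight_comp, hc.fac]
  exact hf i

end

/-- The object `P` with the maps `K i ⟶ Map(A i, P)` is a simplicial coproduct of the tensors
`K i ⊗ A i`. -/
def IsCopower {ι : Type*} (K : ι → SSet.{v}) (A : ι → C) (P : C)
    (u : ∀ i, K i ⟶ sHom (A i) P) : Prop :=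
  ∀ (Y : C) (L : SSet.{v}), Function.Bijective
    (fun (g : L ⟶ sHom P Y) (i : ι) ↦ (u i ⊗ₘ g) ≫ sHomComp (A i) P Y)

/-- The object is the ordinary coproduct of the `K i ⊗ A i`; it has the simplicial universal
property because `C` is cotensored. -/
lemma exists_isCopower (T : SimplicialTensor C) (hC : IsCotensored C) {ι : Type*}
    [Limits.HasCoproductsOfShape ι C] (K : ι → SSet.{v}) (A : ι → C) :
    ∃ (P : C) (u : ∀ i, K i ⟶ sHom (A i) P), IsCopower K A P u := by
  let B (i : ι) : C := (T.tensor.obj (K i)).obj (A i)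
  let c := Limits.colimit.cocone (Discrete.functor B)
  let hc := Limits.colimit.isColimit (Discrete.functor B)
  let u (i : ι) : K i ⟶ sHom (A i) c.pt :=
    T.unit (K i) (A i) ≫ eHomWhiskerLeft SSet.{v} (A i) (c.ι.app ⟨i⟩)
  have key (i : ι) {Y : C} {L : SSet.{v}} (g : L ⟶ sHom c.pt Y) :
      (u i ⊗ₘ g) ≫ sHomComp (A i) c.pt Y =
        (T.unit (K i) (A i) ⊗ₘ (g ≫ eHomWhiskerRight SSet.{v} (c.ι.app ⟨i⟩) Y)) ≫
          sHomComp (A i) (B i) Y := by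
    ext n ⟨x, l⟩
    exact scomp_assoc _ _ _
  refine ⟨c.pt, u, fun Y L ↦ ⟨fun g g' h ↦ ?_, fun h ↦ ?_⟩⟩
  · refine hC.fromHom_ext hc fun ⟨i⟩ ↦ (T.bijective (K i) (A i) Y L).1 ?_
    exact (key i g).symm.trans ((congrFun h i).trans (key i g'))
  · choose g hg using fun i ↦ (T.bijective (K i) (A i) Y L).2 (h i)
    obtain ⟨g', hg'⟩ := hC.exists_desc hc (fun i ↦ g i.as) (by
      rintro ⟨i⟩ ⟨i'⟩ ⟨⟨rfl : i = i'⟩⟩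
      change g i ≫ eHomWhiskerRight SSet.{v} (𝟙 (B i)) Y = g i
      rw [eHomWhiskerRight_id]
      exact Category.comp_id _)
    refine ⟨g', funext fun i ↦ ?_⟩
    dsimp only
    rw [key, hg' ⟨i⟩]
    exact hg i

/-- A simplicial left adjoint preserves simplicial coproducts of tensors. -/
lemma IsCopower.map {ι : Type*} {K : ι → SSet.{v}} {A : ι → C} {P : C}
    {u : ∀ i, K i ⟶ sHom (A i) P} (h : IsCopower K A P u)
    {F : EnrichedFunctor SSet.{v} C D} {G : EnrichedFunctor SSet.{v} D C}
    (adj : SimplicialAdjunction F G) :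
    IsCopower K (fun i ↦ F.obj (A i)) (F.obj P) (fun i ↦ u i ≫ F.map (A i) P) := by
  intro Y L
  have key (i : ι) (g : L ⟶ sHom (F.obj P) Y) :
      (((u i ≫ F.map (A i) P) ⊗ₘ g) ≫ sHomComp _ _ Y) ≫ (adj.homIso (A i) Y).hom =
        (u i ⊗ₘ (g ≫ (adj.homIso P Y).hom)) ≫ sHomComp (A i) P (G.obj Y) := by
    ext n ⟨x, l⟩
    exact adj.homIso_map_scomp _ _
  constructor
  · intro g g' hg
    rw [← cancel_mono (adj.homIso P Y).hom]
    refine (h _ _).1 (funext fun i ↦ ?_)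
    exact (key i g).symm.trans ((congrArg (· ≫ (adj.homIso (A i) Y).hom)
      (congrFun hg i)).trans (key i g'))
  · intro k
    obtain ⟨g, hg⟩ := (h (G.obj Y) L).2 (fun i ↦ k i ≫ (adj.homIso (A i) Y).hom)
    refine ⟨g ≫ (adj.homIso P Y).inv, funext fun i ↦ ?_⟩
    rw [← cancel_mono (adj.homIso (A i) Y).hom]
    dsimp only
    rw [key, Category.assoc, Iso.inv_hom_id, Category.comp_id]
    exact congrFun hg i

lemma IsCopower.ext {ι : Type*} {K : ι → SSet.{v}} {A : ι → C} {P : C}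
    {u : ∀ i, K i ⟶ sHom (A i) P} (h : IsCopower K A P u) {Y : C} {L : SSet.{v}}
    {g g' : L ⟶ sHom P Y}
    (hg : ∀ (i : ι) (n : SimplexCategoryᵒᵖ) (x : (K i).obj n) (l : L.obj n),
      (u i).app n x ⊚ g.app n l = (u i).app n x ⊚ g'.app n l) : g = g' := by
  refine (h Y L).1 (funext fun i ↦ ?_)
  ext n ⟨x, l⟩
  exact hg i n x l

lemma IsCopower.exists_desc {ι : Type*} {K : ι → SSet.{v}} {A : ι → C} {P : C}
    {u : ∀ i, K i ⟶ sHom (A i) P} (h : IsCopower K A P u) {Y : C} {L : SSet.{v}}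
    (k : ∀ i, K i ⊗ L ⟶ sHom (A i) Y) :
    ∃ g : L ⟶ sHom P Y, ∀ (i : ι) (n : SimplexCategoryᵒᵖ) (x : (K i).obj n) (l : L.obj n),
      (u i).app n x ⊚ g.app n l = (k i).app n ⟨x, l⟩ := by
  obtain ⟨g, hg⟩ := (h Y L).2 k
  exact ⟨g, fun i n x l ↦
    ConcreteCategory.congr_hom (NatTrans.congr_app (congrFun hg i) n) ⟨x, l⟩⟩

/-- The object `Q` with the maps `K i ⟶ Map(F i Q, E)` is a simplicial product of the cotensors of
the images of `E` by the right adjoints of the functors `F i`. -/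
def IsPower {ι : Type*} (K : ι → SSet.{v}) (F : ι → EnrichedFunctor SSet.{v} C D) (E : D) (Q : C)
    (w : ∀ i, K i ⟶ sHom ((F i).obj Q) E) : Prop :=
  ∀ (X : C) (L : SSet.{v}), Function.Bijective
    (fun (g : L ⟶ sHom X Q) (i : ι) ↦
      ((g ≫ (F i).map X Q) ⊗ₘ w i) ≫ sHomComp ((F i).obj X) ((F i).obj Q) E)

/-- The object is the product of the cotensors `(G i E) ^ (K i)`. Stating its universal property
through the left adjoints `F i` avoids any coherence data for the right adjoints. -/
lemma exists_isPower (T : SimplicialTensor C) (hC : IsCotensored C) {ι : Type*}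
    [Limits.HasProductsOfShape ι C] (K : ι → SSet.{v})
    {F : ι → EnrichedFunctor SSet.{v} C D} {G : ι → EnrichedFunctor SSet.{v} D C}
    (adj : ∀ i, SimplicialAdjunction (F i) (G i)) (E : D) :
    ∃ (Q : C) (w : ∀ i, K i ⟶ sHom ((F i).obj Q) E), IsPower K F E Q w := by
  choose R ε hε using fun i ↦ hC (K i) ((G i).obj E)
  let c := Limits.limit.cone (Discrete.functor R)
  let hc := Limits.limit.isLimit (Discrete.functor R)
  let w (i : ι) : K i ⟶ sHom ((F i).obj c.pt) E :=
    ε i ≫ eHomWhiskerRight SSet.{v} (c.π.app ⟨i⟩) _ ≫ ((adj i).homIso c.pt E).inv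
  have key (i : ι) {X : C} {L : SSet.{v}} (g : L ⟶ sHom X c.pt) :
      (((g ≫ (F i).map X c.pt) ⊗ₘ w i) ≫ sHomComp _ _ E) ≫ ((adj i).homIso X E).hom =
        ((g ≫ eHomWhiskerLeft SSet.{v} X (c.π.app ⟨i⟩)) ⊗ₘ ε i) ≫ sHomComp _ _ _ := by
    ext n ⟨l, x⟩
    refine ((adj i).homIso_map_scomp _ _).trans ?_
    have : ((adj i).homIso c.pt E).hom.app n ((w i).app n x) =
        deg n (c.π.app ⟨i⟩) ⊚ (ε i).app n x :=
      ConcreteCategory.congr_hom (((adj i).homIso c.pt E).app n).inv_hom_id _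
    exact (congrArg (g.app n l ⊚ ·) this).trans (scomp_assoc _ _ _).symm
  refine ⟨c.pt, w, fun X L ↦ ⟨fun g g' h ↦ ?_, fun k ↦ ?_⟩⟩
  · refine T.toHom_ext hc fun ⟨i⟩ ↦ (hε i X L).1 ?_
    exact (key i g).symm.trans ((congrArg (· ≫ ((adj i).homIso X E).hom)
      (congrFun h i)).trans (key i g'))
  · choose g hg using fun i ↦ (hε i X L).2 (k i ≫ ((adj i).homIso X E).hom)
    obtain ⟨g', hg'⟩ := T.exists_lift hc (fun i ↦ g i.as) (by
      rintro ⟨i⟩ ⟨i'⟩ ⟨⟨rfl : i = i'⟩⟩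
      change g i ≫ eHomWhiskerLeft SSet.{v} X (𝟙 (R i)) = g i
      rw [eHomWhiskerLeft_id]
      exact Category.comp_id _)
    refine ⟨g', funext fun i ↦ ?_⟩
    rw [← cancel_mono ((adj i).homIso X E).hom]
    dsimp only
    rw [key, hg' ⟨i⟩]
    exact hg i

lemma IsPower.ext {ι : Type*} {K : ι → SSet.{v}} {F : ι → EnrichedFunctor SSet.{v} C D} {E : D}
    {Q : C} {w : ∀ i, K i ⟶ sHom ((F i).obj Q) E} (h : IsPower K F E Q w) {X : C} {L : SSet.{v}}
    {g g' : L ⟶ sHom X Q}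
    (hg : ∀ (i : ι) (n : SimplexCategoryᵒᵖ) (l : L.obj n) (x : (K i).obj n),
      ((F i).map X Q).app n (g.app n l) ⊚ (w i).app n x =
        ((F i).map X Q).app n (g'.app n l) ⊚ (w i).app n x) : g = g' := by
  refine (h X L).1 (funext fun i ↦ ?_)
  ext n ⟨l, x⟩
  exact hg i n l x

lemma IsPower.exists_lift {ι : Type*} {K : ι → SSet.{v}} {F : ι → EnrichedFunctor SSet.{v} C D}
    {E : D} {Q : C} {w : ∀ i, K i ⟶ sHom ((F i).obj Q) E} (h : IsPower K F E Q w) {X : C}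
    {L : SSet.{v}} (k : ∀ i, L ⊗ K i ⟶ sHom ((F i).obj X) E) :
    ∃ g : L ⟶ sHom X Q, ∀ (i : ι) (n : SimplexCategoryᵒᵖ) (l : L.obj n) (x : (K i).obj n),
      ((F i).map X Q).app n (g.app n l) ⊚ (w i).app n x = (k i).app n ⟨l, x⟩ := by
  obtain ⟨g, hg⟩ := (h X L).2 k
  exact ⟨g, fun i n l x ↦
    ConcreteCategory.congr_hom (NatTrans.congr_app (congrFun hg i) n) ⟨l, x⟩⟩

lemma IsPower.hom_ext {ι : Type*} {K : ι → SSet.{v}} {F : ι → EnrichedFunctor SSet.{v} C D}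
    {E : D} {Q : C} {w : ∀ i, K i ⟶ sHom ((F i).obj Q) E} (h : IsPower K F E Q w) {X : C}
    {f f' : X ⟶ Q}
    (hf : ∀ (i : ι), w i ≫ eHomWhiskerRight SSet.{v} ((underlying (F i)).map f) E =
      w i ≫ eHomWhiskerRight SSet.{v} ((underlying (F i)).map f') E) : f = f' := by
  refine (eHomEquiv SSet.{v}).injective (h.ext fun i n l x ↦ ?_)
  rw [eHomEquiv_app, eHomEquiv_app, enrichedFunctor_map_deg, enrichedFunctor_map_deg]
  exact ConcreteCategory.congr_hom (NatTrans.congr_app (hf i) n) x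

lemma IsPower.exists_hom {ι : Type*} {K : ι → SSet.{v}} {F : ι → EnrichedFunctor SSet.{v} C D}
    {E : D} {Q : C} {w : ∀ i, K i ⟶ sHom ((F i).obj Q) E} (h : IsPower K F E Q w) {X : C}
    (k : ∀ i, K i ⟶ sHom ((F i).obj X) E) :
    ∃ f : X ⟶ Q, ∀ i,
      w i ≫ eHomWhiskerRight SSet.{v} ((underlying (F i)).map f) E = k i := by
  obtain ⟨g, hg⟩ := h.exists_lift (L := 𝟙_ SSet.{v}) (fun i ↦ (λ_ (K i)).hom ≫ k i)
  obtain ⟨f, rfl⟩ := (eHomEquiv SSet.{v}).surjective g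
  refine ⟨f, fun i ↦ ?_⟩
  ext n x
  refine Eq.trans ?_ (hg i n PUnit.unit x)
  rw [eHomEquiv_app, enrichedFunctor_map_deg]
  rfl

lemma IsCopower.hom_ext {ι : Type*} {K : ι → SSet.{v}} {A : ι → C} {P : C}
    {u : ∀ i, K i ⟶ sHom (A i) P} (h : IsCopower K A P u) {Y : C} {f f' : P ⟶ Y}
    (hf : ∀ i, u i ≫ eHomWhiskerLeft SSet.{v} (A i) f =
      u i ≫ eHomWhiskerLeft SSet.{v} (A i) f') : f = f' := by
  refine (eHomEquiv SSet.{v}).injective (h.ext fun i n x l ↦ ?_)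
  exact ConcreteCategory.congr_hom (NatTrans.congr_app (hf i) n) x

lemma IsCopower.exists_hom {ι : Type*} {K : ι → SSet.{v}} {A : ι → C} {P : C}
    {u : ∀ i, K i ⟶ sHom (A i) P} (h : IsCopower K A P u) {Y : C}
    (k : ∀ i, K i ⟶ sHom (A i) Y) :
    ∃ f : P ⟶ Y, ∀ i, u i ≫ eHomWhiskerLeft SSet.{v} (A i) f = k i := by
  obtain ⟨g, hg⟩ := h.exists_desc (L := 𝟙_ SSet.{v}) (fun i ↦ (ρ_ (K i)).hom ≫ k i)
  obtain ⟨f, rfl⟩ := (eHomEquiv SSet.{v}).surjective g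
  refine ⟨f, fun i ↦ ?_⟩
  ext n x
  exact hg i n x PUnit.unit

end TensorsAndCotensors

/-! ### Naturality of the pseudofunctor isomorphisms on simplices -/

section PseudofunctorElements

variable {I : Type u'} [Category.{v} I] (M : SimplicialQuillenPresheaf.{v, u} I)

namespace SimplicialQuillenPresheaf

lemma map_scomp_deg_pushId (i : I) {X Y : M.fiber i} {n : SimplexCategoryᵒᵖ}
    (x : (sHom X Y).obj n) :
    ((M.push (𝟙 i)).map X Y).app n x ⊚ deg n (M.pushId i Y).hom =
      deg n (M.pushId i X).hom ⊚ x :=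
  ConcreteCategory.congr_hom (NatTrans.congr_app (M.pushId_naturality i X Y) n) x

lemma map_scomp_deg_pushComp {i j k : I} (α : i ⟶ j) (β : j ⟶ k) {X Y : M.fiber i}
    {n : SimplexCategoryᵒᵖ} (x : (sHom X Y).obj n) :
    ((M.push (α ≫ β)).map X Y).app n x ⊚ deg n (M.pushComp α β Y).hom =
      deg n (M.pushComp α β X).hom ⊚
        ((M.push β).map _ _).app n (((M.push α).map X Y).app n x) :=
  ConcreteCategory.congr_hom (NatTrans.congr_app (M.pushComp_naturality α β X Y) n) x

lemma map_scomp_deg_pushComp_scomp {i j k : I} (α : i ⟶ j) (β : j ⟶ k) {X Y : M.fiber i}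
    {n : SimplexCategoryᵒᵖ} (x : (sHom X Y).obj n) {Z : M.fiber k} (z : (sHom _ Z).obj n) :
    ((M.push (α ≫ β)).map X Y).app n x ⊚ deg n (M.pushComp α β Y).hom ⊚ z =
      deg n (M.pushComp α β X).hom ⊚
        ((M.push β).map _ _).app n (((M.push α).map X Y).app n x) ⊚ z := by
  rw [← scomp_assoc, map_scomp_deg_pushComp, scomp_assoc]

lemma map_map_scomp_deg_pushComp_inv_scomp {i j k : I} (α : i ⟶ j) (β : j ⟶ k) {X Y : M.fiber i}
    {n : SimplexCategoryᵒᵖ} (x : (sHom X Y).obj n) {Z : M.fiber k} (z : (sHom _ Z).obj n) :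
    ((M.push β).map _ _).app n (((M.push α).map X Y).app n x) ⊚
      deg n (M.pushComp α β Y).inv ⊚ z =
    deg n (M.pushComp α β X).inv ⊚ ((M.push (α ≫ β)).map X Y).app n x ⊚ z := by
  have h := congrArg (deg n (M.pushComp α β X).inv ⊚ ·)
    (M.map_scomp_deg_pushComp_scomp α β x (deg n (M.pushComp α β Y).inv ⊚ z))
  dsimp only at h
  rw [deg_scomp_deg_scomp, Iso.hom_inv_id, deg_id_scomp, deg_scomp_deg_scomp, Iso.inv_hom_id,
    deg_id_scomp] at h
  exact h.symm

lemma pushId_hom_naturality (i : I) {X Y : M.fiber i} (f : X ⟶ Y) :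
    (underlying (M.push (𝟙 i))).map f ≫ (M.pushId i Y).hom = (M.pushId i X).hom ≫ f := by
  apply deg_zero_injective
  rw [deg_comp, deg_comp, ← enrichedFunctor_map_deg, map_scomp_deg_pushId]

lemma pushComp_hom_naturality {i j k : I} (α : i ⟶ j) (β : j ⟶ k) {X Y : M.fiber i} (f : X ⟶ Y) :
    (underlying (M.push (α ≫ β))).map f ≫ (M.pushComp α β Y).hom =
      (M.pushComp α β X).hom ≫ (underlying (M.push β)).map ((underlying (M.push α)).map f) := by
  apply deg_zero_injective
  rw [deg_comp, deg_comp, ← enrichedFunctor_map_deg, map_scomp_deg_pushComp,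
    ← enrichedFunctor_map_deg, ← enrichedFunctor_map_deg]

end SimplicialQuillenPresheaf

end PseudofunctorElements

/-! ### Sections on simplices -/

section SectionElements

variable {I : Type u'} [Category.{v} I] {M : SimplicialQuillenPresheaf.{v, u} I}
  {J : Type v} [Category.{v} J] [SimplicialCategory J] {φ : FunctorToOrdinary J I}

/-- The identity of `j`, as an `n`-simplex of `Map^𝟙(j, j)`. -/
def FunctorToOrdinary.one (φ : FunctorToOrdinary J I) (j : J) (n : SimplexCategoryᵒᵖ) :
    (φ.mapOver (𝟙 (φ.obj j)) : SSet.{v}).obj n :=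
  (φ.idOver j).app n PUnit.unit

/-- Composition of `n`-simplices of the simplicial sets `Map^α(j, k)`. -/
def FunctorToOrdinary.mul (φ : FunctorToOrdinary J I) {j k l : J} {α : φ.obj j ⟶ φ.obj k}
    {β : φ.obj k ⟶ φ.obj l} {n : SimplexCategoryᵒᵖ}
    (x : (φ.mapOver α : SSet.{v}).obj n) (y : (φ.mapOver β : SSet.{v}).obj n) :
    (φ.mapOver (α ≫ β) : SSet.{v}).obj n :=
  (φ.compOver α β).app n ⟨x, y⟩

/-- The two sides live in the subcomplexes over `α ≫ 𝟙` and over `α`, so unitality and associativity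
are stated for the underlying simplices. -/
lemma FunctorToOrdinary.mul_one_coe {j k : J} {α : φ.obj j ⟶ φ.obj k} {n : SimplexCategoryᵒᵖ}
    (x : (φ.mapOver α : SSet.{v}).obj n) : (φ.mul x (φ.one k n)).1 = x.1 := by
  refine Eq.trans ?_ (scomp_deg_id x.1)
  rw [← eId_app k n PUnit.unit]
  rfl

lemma FunctorToOrdinary.one_mul_coe {j k : J} {α : φ.obj j ⟶ φ.obj k} {n : SimplexCategoryᵒᵖ}
    (x : (φ.mapOver α : SSet.{v}).obj n) : (φ.mul (φ.one j n) x).1 = x.1 := by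
  refine Eq.trans ?_ (deg_id_scomp x.1)
  rw [← eId_app j n PUnit.unit]
  rfl

lemma FunctorToOrdinary.mul_assoc_coe {j k l m : J} {α : φ.obj j ⟶ φ.obj k}
    {β : φ.obj k ⟶ φ.obj l} {γ : φ.obj l ⟶ φ.obj m} {n : SimplexCategoryᵒᵖ}
    (x : (φ.mapOver α : SSet.{v}).obj n) (y : (φ.mapOver β : SSet.{v}).obj n)
    (z : (φ.mapOver γ : SSet.{v}).obj n) :
    (φ.mul (φ.mul x y) z).1 = (φ.mul x (φ.mul y z)).1 :=
  scomp_assoc x.1 y.1 z.1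

namespace SimplicialSection

lemma map_one (s : SimplicialSection M φ) (j : J) (n : SimplexCategoryᵒᵖ) :
    (s.map (𝟙 (φ.obj j))).app n (φ.one j n) = deg n (M.pushId (φ.obj j) (s.obj j)).hom :=
  ConcreteCategory.congr_hom (NatTrans.congr_app (s.map_id j) n) PUnit.unit

lemma map_mul (s : SimplicialSection M φ) {j k l : J} {α : φ.obj j ⟶ φ.obj k}
    {β : φ.obj k ⟶ φ.obj l} {n : SimplexCategoryᵒᵖ}
    (x : (φ.mapOver α : SSet.{v}).obj n) (y : (φ.mapOver β : SSet.{v}).obj n) :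
    (s.map (α ≫ β)).app n (φ.mul x y) = deg n (M.pushComp α β (s.obj j)).hom ⊚
      ((M.push β).map _ _).app n ((s.map α).app n x) ⊚ (s.map β).app n y :=
  ConcreteCategory.congr_hom (NatTrans.congr_app (s.map_comp α β) n) ⟨x, y⟩

lemma naturality_app {s t : SimplicialSection M φ} (T : s ⟶ t) {j k : J}
    (α : φ.obj j ⟶ φ.obj k) {n : SimplexCategoryᵒᵖ} (x : (φ.mapOver α : SSet.{v}).obj n) :
    (s.map α).app n x ⊚ deg n (Hom.app T k) =
      deg n ((underlying (M.push α)).map (Hom.app T j)) ⊚ (t.map α).app n x :=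
  ConcreteCategory.congr_hom (NatTrans.congr_app (Hom.naturality T α) n) x

@[ext]
lemma hom_ext {s t : SimplicialSection M φ} {T T' : s ⟶ t}
    (h : ∀ j, Hom.app T j = Hom.app T' j) : T = T' :=
  Hom.ext (funext h)

variable (M φ) in
/-- Evaluation of sections at an object. -/
def ev (j : J) : SimplicialSection M φ ⥤ M.fiber (φ.obj j) where
  obj s := s.obj j
  map T := Hom.app T j

end SimplicialSection

end SectionElements

/-! ### Free sections: the left adjoint of evaluation -/

section FreeSections

variable {I : Type u'} [Category.{v} I] {M : SimplicialQuillenPresheaf.{v, u} I}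
  {J : Type v} [Category.{v} J] [SimplicialCategory J] {φ : FunctorToOrdinary J I}

lemma SimplicialQuillenPresheaf.pushComp_inv_comp_eqToHom_right
    (M : SimplicialQuillenPresheaf.{v, u} I) {i j : I} (α : i ⟶ j) (X : M.fiber i)
    (h : (M.push (α ≫ 𝟙 j)).obj X = (M.push α).obj X) :
    (M.pushComp α (𝟙 j) X).inv ≫ eqToHom h = (M.pushId j ((M.push α).obj X)).hom := by
  rw [Iso.inv_comp_eq, M.pushComp_id_right]

lemma SimplicialQuillenPresheaf.pushComp_inv_comp_eqToHom_left
    (M : SimplicialQuillenPresheaf.{v, u} I) {i j : I} (α : i ⟶ j) (X : M.fiber i)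
    (h : (M.push (𝟙 i ≫ α)).obj X = (M.push α).obj X) :
    (M.pushComp (𝟙 i) α X).inv ≫ eqToHom h =
      (underlying (M.push α)).map (M.pushId i X).hom := by
  rw [Iso.inv_comp_eq, M.pushComp_id_left]

lemma SimplicialQuillenPresheaf.pushComp_assoc_inv
    (M : SimplicialQuillenPresheaf.{v, u} I) {i j k l : I} (α : i ⟶ j) (β : j ⟶ k) (γ : k ⟶ l)
    (X : M.fiber i)
    (h : (M.push ((α ≫ β) ≫ γ)).obj X = (M.push (α ≫ β ≫ γ)).obj X) :
    (M.pushComp β γ ((M.push α).obj X)).hom ≫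
      (underlying (M.push γ)).map (M.pushComp α β X).inv ≫ (M.pushComp (α ≫ β) γ X).inv ≫
        eqToHom h = (M.pushComp α (β ≫ γ) X).inv := by
  rw [← cancel_mono (M.pushComp α (β ≫ γ) X).hom, Iso.inv_hom_id,
    ← cancel_mono (M.pushComp β γ ((M.push α).obj X)).hom, Category.id_comp, Category.assoc,
    Category.assoc, Category.assoc, Category.assoc,
    ← M.pushComp_assoc α β γ X, Iso.inv_hom_id_assoc, ← Functor.map_comp, Iso.inv_hom_id,
    CategoryTheory.Functor.map_id, Category.comp_id]

lemma SimplicialQuillenPresheaf.pushComp_assoc_inv'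
    (M : SimplicialQuillenPresheaf.{v, u} I) {i j k l : I} (α : i ⟶ j) (β : j ⟶ k) (γ : k ⟶ l)
    (X : M.fiber i)
    (h : (M.push (α ≫ β ≫ γ)).obj X = (M.push ((α ≫ β) ≫ γ)).obj X) :
    (underlying (M.push γ)).map (M.pushComp α β X).hom ≫
      (M.pushComp β γ ((M.push α).obj X)).inv ≫ (M.pushComp α (β ≫ γ) X).inv ≫
        eqToHom h = (M.pushComp (α ≫ β) γ X).inv := by
  rw [← cancel_mono (eqToHom h.symm), ← M.pushComp_assoc_inv α β γ X h.symm, Category.assoc,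
    Category.assoc, Category.assoc, Category.assoc, Iso.inv_hom_id_assoc,
    Category.assoc, ← Functor.map_comp_assoc, Iso.hom_inv_id, CategoryTheory.Functor.map_id, Category.id_comp, Category.assoc,
    eqToHom_trans, eqToHom_refl, Category.comp_id]

variable (M φ) in
/-- Data defining the free section on an object `X` of `M(φ(j))`. -/
structure FreeData (j : J) (X : M.fiber (φ.obj j)) where
  obj (k : J) : M.fiber (φ.obj k)
  gen {k : J} (α : φ.obj j ⟶ φ.obj k) :
    (φ.mapOver α : SSet.{v}) ⟶ sHom ((M.push α).obj X) (obj k)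
  isCopower (k : J) : IsCopower (fun α : φ.obj j ⟶ φ.obj k ↦ (φ.mapOver α : SSet.{v}))
    (fun α ↦ (M.push α).obj X) (obj k) (fun α ↦ gen α)

namespace FreeData

variable {j : J} {X : M.fiber (φ.obj j)} (d : FreeData M φ j X)

/-- Used with the unit and associativity laws of `I`, whose transport shows up as an `eqToHom` and
cancels against the coherence axioms of `M`. -/
lemma gen_eq {k : J} {α α' : φ.obj j ⟶ φ.obj k} {n : SimplexCategoryᵒᵖ}
    (x : (φ.mapOver α : SSet.{v}).obj n) (x' : (φ.mapOver α' : SSet.{v}).obj n)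
    (h : x.1 = x'.1) (hα : α = α') :
    (d.gen α).app n x = deg n (eqToHom (by rw [hα])) ⊚ (d.gen α').app n x' := by
  subst hα
  obtain rfl : x = x' := Subtype.ext h
  simp

/-- The simplicial left adjoint `β_!` preserves coproducts of tensors, so the action can be
prescribed on generators: `y` sends the generator `x` to the generator `xy`. -/
lemma exists_act {k l : J} (β : φ.obj k ⟶ φ.obj l) :
    ∃ a : (φ.mapOver β : SSet.{v}) ⟶ sHom ((M.push β).obj (d.obj k)) (d.obj l),
      ∀ (α : φ.obj j ⟶ φ.obj k) (n : SimplexCategoryᵒᵖ) (x : (φ.mapOver α : SSet.{v}).obj n)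
        (y : (φ.mapOver β : SSet.{v}).obj n),
        ((M.push β).map _ _).app n ((d.gen α).app n x) ⊚ a.app n y =
          deg n (M.pushComp α β X).inv ⊚ (d.gen (α ≫ β)).app n (φ.mul x y) :=
  ((d.isCopower k).map (M.adj β)).exists_desc (fun α ↦ φ.compOver α β ≫ d.gen (α ≫ β) ≫
    eHomWhiskerRight SSet.{v} (M.pushComp α β X).inv (d.obj l))

/-- The structure maps of a free section. -/
def act {k l : J} (β : φ.obj k ⟶ φ.obj l) :
    (φ.mapOver β : SSet.{v}) ⟶ sHom ((M.push β).obj (d.obj k)) (d.obj l) :=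
  (d.exists_act β).choose

lemma map_gen_scomp_act {k l : J} {α : φ.obj j ⟶ φ.obj k} {β : φ.obj k ⟶ φ.obj l}
    {n : SimplexCategoryᵒᵖ} (x : (φ.mapOver α : SSet.{v}).obj n)
    (y : (φ.mapOver β : SSet.{v}).obj n) :
    ((M.push β).map _ _).app n ((d.gen α).app n x) ⊚ (d.act β).app n y =
      deg n (M.pushComp α β X).inv ⊚ (d.gen (α ≫ β)).app n (φ.mul x y) :=
  (d.exists_act β).choose_spec α n x y

lemma act_ext {k l : J} {β : φ.obj k ⟶ φ.obj l} {L : SSet.{v}} {Y : M.fiber (φ.obj l)}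
    {g g' : L ⟶ sHom ((M.push β).obj (d.obj k)) Y}
    (h : ∀ (α : φ.obj j ⟶ φ.obj k) (n : SimplexCategoryᵒᵖ) (x : (φ.mapOver α : SSet.{v}).obj n)
      (t : L.obj n), ((M.push β).map _ _).app n ((d.gen α).app n x) ⊚ g.app n t =
        ((M.push β).map _ _).app n ((d.gen α).app n x) ⊚ g'.app n t) : g = g' :=
  ((d.isCopower k).map (M.adj β)).ext h

/-- The free section on `X`. -/
@[reducible]
def toSection : SimplicialSection M φ where
  obj := d.obj
  map := d.act
  map_id k := d.act_ext fun α n x t ↦ by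
    refine (d.map_gen_scomp_act x (φ.one k n)).trans ?_
    rw [d.gen_eq _ x (φ.mul_one_coe x) (Category.comp_id α), deg_scomp_deg_scomp,
      M.pushComp_inv_comp_eqToHom_right]
    exact (M.map_scomp_deg_pushId _ _).symm
  map_comp {k l m} β γ := d.act_ext fun α n x t ↦ by
    obtain ⟨y, z⟩ := t
    refine (d.map_gen_scomp_act x (φ.mul y z)).trans ?_
    symm
    change ((M.push (β ≫ γ)).map _ _).app n ((d.gen α).app n x) ⊚
      deg n (M.pushComp β γ (d.obj k)).hom ⊚ ((M.push γ).map _ _).app n ((d.act β).app n y) ⊚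
        (d.act γ).app n z = _
    rw [M.map_scomp_deg_pushComp_scomp, ← scomp_assoc (((M.push γ).map _ _).app n _),
      ← enrichedFunctor_map_scomp, d.map_gen_scomp_act, enrichedFunctor_map_scomp,
      scomp_assoc, d.map_gen_scomp_act, enrichedFunctor_map_deg,
      d.gen_eq _ _ (φ.mul_assoc_coe x y z) (Category.assoc α β γ), deg_scomp_deg_scomp,
      deg_scomp_deg_scomp, deg_scomp_deg_scomp, Category.assoc, Category.assoc,
      M.pushComp_assoc_inv]

/-- The unit `X ⟶ (free section on X)(j)`. -/
def unit : X ⟶ d.obj j :=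
  (eHomEquiv SSet.{v}).symm (φ.idOver j ≫ d.gen (𝟙 (φ.obj j)) ≫
    eHomWhiskerRight SSet.{v} (M.pushId (φ.obj j) X).inv _)

lemma deg_unit (n : SimplexCategoryᵒᵖ) :
    deg n d.unit = deg n (M.pushId (φ.obj j) X).inv ⊚
      (d.gen (𝟙 (φ.obj j))).app n (φ.one j n) := by
  dsimp [deg, unit]
  rw [Equiv.apply_symm_apply]
  rfl

lemma gen_one (n : SimplexCategoryᵒᵖ) :
    (d.gen (𝟙 (φ.obj j))).app n (φ.one j n) =
      deg n (M.pushId (φ.obj j) X).hom ⊚ deg n d.unit := by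
  rw [deg_unit, deg_scomp_deg_scomp, Iso.hom_inv_id, deg_id_scomp]

/-- Since `x = 1 · x`, every generator arises by acting on the unit; this is what makes the section
free. -/
lemma gen_eq_act {k : J} {α : φ.obj j ⟶ φ.obj k} {n : SimplexCategoryᵒᵖ}
    (x : (φ.mapOver α : SSet.{v}).obj n) :
    (d.gen α).app n x = deg n (eqToHom (by rw [Category.id_comp]) ≫
      (M.pushComp (𝟙 (φ.obj j)) α X).hom ≫
        (underlying (M.push α)).map ((M.pushId (φ.obj j) X).hom ≫ d.unit)) ⊚
      (d.act α).app n x := by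
  rw [d.gen_eq x (φ.mul (φ.one j n) x) (φ.one_mul_coe x).symm (Category.id_comp α).symm]
  have h := d.map_gen_scomp_act (φ.one j n) x
  rw [gen_one, ← deg_comp, enrichedFunctor_map_deg] at h
  have h' := congrArg (deg n (M.pushComp (𝟙 (φ.obj j)) α X).hom ⊚ ·) h
  dsimp only at h'
  rw [deg_scomp_deg_scomp, deg_scomp_deg_scomp, Iso.hom_inv_id, deg_id_scomp] at h'
  rw [← h', deg_scomp_deg_scomp]

lemma toSection_hom_ext {s : SimplicialSection M φ} {T T' : d.toSection ⟶ s}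
    (h : d.unit ≫ SimplicialSection.Hom.app T j = d.unit ≫ SimplicialSection.Hom.app T' j) :
    T = T' := by
  have key (T : d.toSection ⟶ s) {k : J} {α : φ.obj j ⟶ φ.obj k} {n : SimplexCategoryᵒᵖ}
      (x : (φ.mapOver α : SSet.{v}).obj n) :
      (d.gen α).app n x ⊚ deg n (SimplicialSection.Hom.app T k) =
        deg n (eqToHom (by rw [Category.id_comp]) ≫ (M.pushComp (𝟙 (φ.obj j)) α X).hom ≫
          (underlying (M.push α)).map ((M.pushId (φ.obj j) X).hom ≫ d.unit ≫
            SimplicialSection.Hom.app T j)) ⊚ (s.map α).app n x := by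
    rw [gen_eq_act, scomp_assoc, SimplicialSection.naturality_app T α x, deg_scomp_deg_scomp,
      Category.assoc, Category.assoc, ← Functor.map_comp, Category.assoc]
  ext k
  refine (d.isCopower k).hom_ext fun α ↦ ?_
  ext n x
  refine (key T x).trans (Eq.trans ?_ (key T' x).symm)
  rw [h]

lemma exists_desc {s : SimplicialSection M φ} (f : X ⟶ s.obj j) :
    ∃ T : d.toSection ⟶ s, d.unit ≫ SimplicialSection.Hom.app T j = f := by
  choose T hT using fun k ↦ (d.isCopower k).exists_hom
    (fun α ↦ s.map α ≫ eHomWhiskerRight SSet.{v} ((underlying (M.push α)).map f) _)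
  have hT' {k : J} {α : φ.obj j ⟶ φ.obj k} {n : SimplexCategoryᵒᵖ}
      (x : (φ.mapOver α : SSet.{v}).obj n) :
      (d.gen α).app n x ⊚ deg n (T k) =
        deg n ((underlying (M.push α)).map f) ⊚ (s.map α).app n x :=
    ConcreteCategory.congr_hom (NatTrans.congr_app (hT k α) n) x
  refine ⟨.mk T fun {k l} β ↦ d.act_ext fun α n x y ↦ ?_, ?_⟩
  · change ((M.push β).map _ _).app n ((d.gen α).app n x) ⊚ (d.act β).app n y ⊚ deg n (T l) =
      ((M.push β).map _ _).app n ((d.gen α).app n x) ⊚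
        deg n ((underlying (M.push β)).map (T k)) ⊚ (s.map β).app n y
    rw [← scomp_assoc, d.map_gen_scomp_act, scomp_assoc, hT', s.map_mul, deg_scomp_deg_scomp,
      deg_scomp_deg_scomp, Category.assoc, M.pushComp_hom_naturality, Iso.inv_hom_id_assoc,
      ← enrichedFunctor_map_deg, ← enrichedFunctor_map_deg, ← scomp_assoc,
      ← enrichedFunctor_map_scomp, ← enrichedFunctor_map_deg, ← scomp_assoc,
      ← enrichedFunctor_map_scomp, hT', enrichedFunctor_map_deg]
  · apply deg_zero_injective
    change deg _ (d.unit ≫ T j) = _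
    rw [deg_comp, deg_unit, scomp_assoc, hT', s.map_one, ← deg_comp, ← deg_comp,
      M.pushId_hom_naturality, Iso.inv_hom_id_assoc]

end FreeData

/-- Evaluation of sections has a left adjoint. -/
lemma isRightAdjoint_ev [∀ i, Limits.HasCoproducts.{v} (M.fiber i)] (j : J) :
    (SimplicialSection.ev M φ j).IsRightAdjoint := by
  have (X : M.fiber (φ.obj j)) : Nonempty (FreeData M φ j X) := by
    choose T hT using fun i ↦ (M.isSimplicialModelCategory i).2
    choose P u h using fun k ↦ exists_isCopower (T (φ.obj k))
      (M.isSimplicialModelCategory _).1 (fun α : φ.obj j ⟶ φ.obj k ↦ (φ.mapOver α : SSet.{v}))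
      (fun α ↦ (M.push α).obj X)
    exact ⟨P, fun {k} α ↦ u k α, h⟩
  let d (X) : FreeData M φ j X := Classical.choice (this X)
  exact (Adjunction.adjunctionOfEquivLeft (G := SimplicialSection.ev M φ j)
    (F_obj := fun X ↦ (d X).toSection) (fun X s ↦ Equiv.ofBijective
      (fun T : (d X).toSection ⟶ s ↦ (d X).unit ≫ SimplicialSection.Hom.app T j)
      ⟨fun _ _ h ↦ (d X).toSection_hom_ext h, fun f ↦ (d X).exists_desc f⟩)
    (fun X s t T T' ↦ (Category.assoc _ _ _).symm)).isRightAdjoint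

end FreeSections

/-! ### Cofree sections: the right adjoint of evaluation -/

section CofreeSections

variable {I : Type u'} [Category.{v} I] {M : SimplicialQuillenPresheaf.{v, u} I}
  {J : Type v} [Category.{v} J] [SimplicialCategory J] {φ : FunctorToOrdinary J I}

variable (M φ) in
/-- Data defining the cofree section on an object `E` of `M(φ(k))`. -/
structure CofreeData (k : J) (E : M.fiber (φ.obj k)) where
  obj (j : J) : M.fiber (φ.obj j)
  cogen {j : J} (α : φ.obj j ⟶ φ.obj k) :
    (φ.mapOver α : SSet.{v}) ⟶ sHom ((M.push α).obj (obj j)) E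
  isPower (j : J) : IsPower (fun α : φ.obj j ⟶ φ.obj k ↦ (φ.mapOver α : SSet.{v}))
    (fun α ↦ M.push α) E (obj j) (fun α ↦ cogen α)

namespace CofreeData

variable {k : J} {E : M.fiber (φ.obj k)} (d : CofreeData M φ k E)

lemma cogen_eq {j : J} {α α' : φ.obj j ⟶ φ.obj k} {n : SimplexCategoryᵒᵖ}
    (x : (φ.mapOver α : SSet.{v}).obj n) (x' : (φ.mapOver α' : SSet.{v}).obj n)
    (h : x.1 = x'.1) (hα : α = α') :
    (d.cogen α).app n x = deg n (eqToHom (by rw [hα])) ⊚ (d.cogen α').app n x' := by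
  subst hα
  obtain rfl : x = x' := Subtype.ext h
  simp

/-- A map into the cofree section at `l` is a family indexed by simplices `x` from `l` to `k`; the
action of `y` is precomposition, `x ↦ yx`. -/
lemma exists_act {j l : J} (β : φ.obj j ⟶ φ.obj l) :
    ∃ a : (φ.mapOver β : SSet.{v}) ⟶ sHom ((M.push β).obj (d.obj j)) (d.obj l),
      ∀ (α : φ.obj l ⟶ φ.obj k) (n : SimplexCategoryᵒᵖ) (y : (φ.mapOver β : SSet.{v}).obj n)
        (x : (φ.mapOver α : SSet.{v}).obj n),
        ((M.push α).map _ _).app n (a.app n y) ⊚ (d.cogen α).app n x =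
          deg n (M.pushComp β α (d.obj j)).inv ⊚ (d.cogen (β ≫ α)).app n (φ.mul y x) :=
  (d.isPower l).exists_lift (fun α ↦ φ.compOver β α ≫ d.cogen (β ≫ α) ≫
    eHomWhiskerRight SSet.{v} (M.pushComp β α (d.obj j)).inv E)

/-- The structure maps of a cofree section. -/
def act {j l : J} (β : φ.obj j ⟶ φ.obj l) :
    (φ.mapOver β : SSet.{v}) ⟶ sHom ((M.push β).obj (d.obj j)) (d.obj l) :=
  (d.exists_act β).choose

lemma map_act_scomp_cogen {j l : J} {β : φ.obj j ⟶ φ.obj l} {α : φ.obj l ⟶ φ.obj k}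
    {n : SimplexCategoryᵒᵖ} (y : (φ.mapOver β : SSet.{v}).obj n)
    (x : (φ.mapOver α : SSet.{v}).obj n) :
    ((M.push α).map _ _).app n ((d.act β).app n y) ⊚ (d.cogen α).app n x =
      deg n (M.pushComp β α (d.obj j)).inv ⊚ (d.cogen (β ≫ α)).app n (φ.mul y x) :=
  (d.exists_act β).choose_spec α n y x

/-- The cofree section on `E`. -/
@[reducible]
def toSection : SimplicialSection M φ where
  obj := d.obj
  map := d.act
  map_id j := (d.isPower j).ext fun α n t x ↦ by
    refine (d.map_act_scomp_cogen (φ.one j n) x).trans ?_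
    rw [d.cogen_eq _ x (φ.one_mul_coe x) (Category.id_comp α), deg_scomp_deg_scomp,
      M.pushComp_inv_comp_eqToHom_left, eHomEquiv_app, enrichedFunctor_map_deg]
  map_comp {j l m} β γ := (d.isPower m).ext fun α n t x ↦ by
    obtain ⟨y, z⟩ := t
    refine (d.map_act_scomp_cogen (φ.mul y z) x).trans ?_
    symm
    change ((M.push α).map _ _).app n (deg n (M.pushComp β γ (d.obj j)).hom ⊚
      ((M.push γ).map _ _).app n ((d.act β).app n y) ⊚ (d.act γ).app n z) ⊚
        (d.cogen α).app n x = _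
    rw [enrichedFunctor_map_scomp, enrichedFunctor_map_scomp, scomp_assoc, scomp_assoc,
      d.map_act_scomp_cogen, M.map_map_scomp_deg_pushComp_inv_scomp, d.map_act_scomp_cogen,
      enrichedFunctor_map_deg,
      d.cogen_eq _ _ (φ.mul_assoc_coe y z x).symm (Category.assoc β γ α).symm,
      deg_scomp_deg_scomp, deg_scomp_deg_scomp, deg_scomp_deg_scomp]
    refine congrArg (· ⊚ _) (congrArg (deg n) ?_)
    refine Eq.trans ?_ (M.pushComp_assoc_inv' β γ α (d.obj j) (by rw [Category.assoc]))
    rw [Category.assoc (_ ≫ _) _ (eqToHom _), Category.assoc ((underlying _).map _)]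

/-- The counit `(cofree section on E)(k) ⟶ E`. -/
def counit : d.obj k ⟶ E :=
  (eHomEquiv SSet.{v}).symm (φ.idOver k ≫ d.cogen (𝟙 (φ.obj k)) ≫
    eHomWhiskerRight SSet.{v} (M.pushId (φ.obj k) (d.obj k)).inv _)

lemma deg_counit (n : SimplexCategoryᵒᵖ) :
    deg n d.counit = deg n (M.pushId (φ.obj k) (d.obj k)).inv ⊚
      (d.cogen (𝟙 (φ.obj k))).app n (φ.one k n) := by
  dsimp [deg, counit]
  rw [Equiv.apply_symm_apply]
  rfl

lemma cogen_one (n : SimplexCategoryᵒᵖ) :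
    (d.cogen (𝟙 (φ.obj k))).app n (φ.one k n) =
      deg n ((M.pushId (φ.obj k) (d.obj k)).hom ≫ d.counit) := by
  rw [deg_comp, deg_counit, deg_scomp_deg_scomp, Iso.hom_inv_id, deg_id_scomp]

/-- From `x = x · 1`: the universal family is recovered from the action and the counit. -/
lemma cogen_eq_act {j : J} {α : φ.obj j ⟶ φ.obj k} {n : SimplexCategoryᵒᵖ}
    (x : (φ.mapOver α : SSet.{v}).obj n) :
    (d.cogen α).app n x = (d.act α).app n x ⊚ deg n d.counit := by
  have h := d.map_act_scomp_cogen x (φ.one k n)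
  rw [d.cogen_eq _ x (φ.mul_one_coe x) (Category.comp_id α), deg_scomp_deg_scomp,
    M.pushComp_inv_comp_eqToHom_right, cogen_one, deg_comp, ← scomp_assoc,
    M.map_scomp_deg_pushId, scomp_assoc] at h
  have h' := congrArg (deg n (M.pushId (φ.obj k) _).inv ⊚ ·) h
  dsimp only at h'
  rw [deg_scomp_deg_scomp, Iso.inv_hom_id, deg_id_scomp, deg_scomp_deg_scomp, Iso.inv_hom_id,
    deg_id_scomp] at h'
  exact h'.symm

lemma deg_map_scomp_cogen {s : SimplicialSection M φ} (T : s ⟶ d.toSection) {j : J}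
    {α : φ.obj j ⟶ φ.obj k} {n : SimplexCategoryᵒᵖ} (x : (φ.mapOver α : SSet.{v}).obj n) :
    deg n ((underlying (M.push α)).map (SimplicialSection.Hom.app T j)) ⊚ (d.cogen α).app n x =
      (s.map α).app n x ⊚ deg n (SimplicialSection.Hom.app T k ≫ d.counit) := by
  rw [cogen_eq_act, ← scomp_assoc, ← SimplicialSection.naturality_app T α x, scomp_assoc,
    deg_comp]

lemma cogen_comp_whiskerRight {s : SimplicialSection M φ} (T : s ⟶ d.toSection) {j : J}
    (α : φ.obj j ⟶ φ.obj k) :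
    d.cogen α ≫ eHomWhiskerRight SSet.{v}
      ((underlying (M.push α)).map (SimplicialSection.Hom.app T j)) E =
    s.map α ≫ eHomWhiskerLeft SSet.{v} _ (SimplicialSection.Hom.app T k ≫ d.counit) := by
  ext n x
  exact d.deg_map_scomp_cogen T x

lemma toSection_hom_ext {s : SimplicialSection M φ} {T T' : s ⟶ d.toSection}
    (h : SimplicialSection.Hom.app T k ≫ d.counit = SimplicialSection.Hom.app T' k ≫ d.counit) :
    T = T' := by
  ext j
  refine (d.isPower j).hom_ext fun α ↦ ?_
  refine (d.cogen_comp_whiskerRight T α).trans (Eq.trans ?_ (d.cogen_comp_whiskerRight T' α).symm)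
  rw [h]

lemma exists_lift {s : SimplicialSection M φ} (f : s.obj k ⟶ E) :
    ∃ T : s ⟶ d.toSection, SimplicialSection.Hom.app T k ≫ d.counit = f := by
  choose T hT using fun j ↦ (d.isPower j).exists_hom
    (fun α ↦ s.map α ≫ eHomWhiskerLeft SSet.{v} _ f)
  have hT' {j : J} {α : φ.obj j ⟶ φ.obj k} {n : SimplexCategoryᵒᵖ}
      (x : (φ.mapOver α : SSet.{v}).obj n) :
      deg n ((underlying (M.push α)).map (T j)) ⊚ (d.cogen α).app n x =
        (s.map α).app n x ⊚ deg n f :=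
    ConcreteCategory.congr_hom (NatTrans.congr_app (hT j α) n) x
  refine ⟨.mk T fun {j l} β ↦ (d.isPower l).ext fun α n y x ↦ ?_, ?_⟩
  · change ((M.push α).map _ _).app n ((s.map β).app n y ⊚ deg n (T l)) ⊚ (d.cogen α).app n x =
      ((M.push α).map _ _).app n (deg n ((underlying (M.push β)).map (T j)) ⊚
        (d.act β).app n y) ⊚ (d.cogen α).app n x
    rw [enrichedFunctor_map_scomp, enrichedFunctor_map_scomp, scomp_assoc, scomp_assoc,
      enrichedFunctor_map_deg, hT', d.map_act_scomp_cogen, ← enrichedFunctor_map_deg,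
      M.map_map_scomp_deg_pushComp_inv_scomp, enrichedFunctor_map_deg, hT', s.map_mul,
      scomp_assoc, deg_scomp_deg_scomp, Iso.inv_hom_id, deg_id_scomp, scomp_assoc]
  · apply deg_zero_injective
    change deg _ (T k ≫ d.counit) = _
    have h := hT' (φ.one k (Opposite.op (SimplexCategory.mk 0)))
    rw [s.map_one, cogen_one, ← deg_comp, ← deg_comp, ← Category.assoc,
      M.pushId_hom_naturality, Category.assoc] at h
    exact congrArg _ ((cancel_epi _).1 (deg_zero_injective h))

end CofreeData

variable (M φ) in
-- The value at `j` is the product over `α` of the cotensors of `α^* E` by `Map^α(j, k)`.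
lemma nonempty_cofreeData [∀ i, Limits.HasProducts.{v} (M.fiber i)] (k : J)
    (E : M.fiber (φ.obj k)) : Nonempty (CofreeData M φ k E) := by
  choose T hT using fun i ↦ (M.isSimplicialModelCategory i).2
  choose P u h using fun j ↦ exists_isPower (T (φ.obj j)) (M.isSimplicialModelCategory _).1
    (fun α : φ.obj j ⟶ φ.obj k ↦ (φ.mapOver α : SSet.{v})) (fun α ↦ M.adj α) E
  exact ⟨P, fun {j} α ↦ u j α, h⟩

variable [∀ i, Limits.HasProducts.{v} (M.fiber i)]

variable (M φ) in
/-- A choice of data defining cofree sections. -/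
def cofreeData (k : J) (E : M.fiber (φ.obj k)) : CofreeData M φ k E :=
  Classical.choice (nonempty_cofreeData M φ k E)

/-- The bijection between morphisms to a cofree section and morphisms to the given object. -/
def CofreeData.homEquiv {k : J} {E : M.fiber (φ.obj k)} (d : CofreeData M φ k E)
    (s : SimplicialSection M φ) : (s ⟶ d.toSection) ≃ ((SimplicialSection.ev M φ k).obj s ⟶ E) :=
  Equiv.ofBijective (fun T : s ⟶ d.toSection ↦ SimplicialSection.Hom.app T k ≫ d.counit)
    ⟨fun _ _ h ↦ d.toSection_hom_ext h, fun f ↦ d.exists_lift f⟩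

variable (M φ) in
/-- The cofree section functor. -/
def cofree (k : J) : M.fiber (φ.obj k) ⥤ SimplicialSection M φ :=
  Adjunction.rightAdjointOfEquiv (F := SimplicialSection.ev M φ k)
    (G_obj := fun E ↦ (cofreeData M φ k E).toSection)
    (fun s E ↦ ((cofreeData M φ k E).homEquiv s).symm) (fun s s' E T f ↦ by
      refine (Equiv.symm_apply_eq _).2 ?_
      refine Eq.trans ?_ (Category.assoc _ _ _).symm
      exact congrArg _ (Equiv.apply_symm_apply ((cofreeData M φ k E).homEquiv _) _).symm)

variable (M φ) in
/-- Evaluation of sections is left adjoint to the cofree section functor. -/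
def evAdjCofree (k : J) : SimplicialSection.ev M φ k ⊣ cofree M φ k :=
  Adjunction.adjunctionOfEquivRight _ _

instance (k : J) : (SimplicialSection.ev M φ k).IsLeftAdjoint := (evAdjCofree M φ k).isLeftAdjoint

lemma evAdjCofree_counit_app (k : J) (E : M.fiber (φ.obj k)) :
    (evAdjCofree M φ k).counit.app E = (cofreeData M φ k E).counit := by
  refine (Adjunction.adjunctionOfEquivRight_counit_app _ _ _).trans ?_
  exact Category.id_comp _

lemma app_counit_of_cofree_hom (k : J) {E : M.fiber (φ.obj k)} {s : SimplicialSection M φ}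
    (T : s ⟶ (cofree M φ k).obj E) :
    SimplicialSection.Hom.app T k ≫ (cofreeData M φ k E).counit =
      ((evAdjCofree M φ k).homEquiv s E).symm T := by
  rw [Adjunction.homEquiv_counit, evAdjCofree_counit_app]
  rfl

end CofreeSections

/-! ### Levelwise limits and colimits of sections -/

section LimitsOfSections

open Limits

variable {I : Type u'} [Category.{v} I] {M : SimplicialQuillenPresheaf.{v, u} I}
  {J : Type v} [Category.{v} J] [SimplicialCategory J] {φ : FunctorToOrdinary J I}

/-- Limits of sections are computed levelwise. -/
lemma hasLimit_sections {𝒦 : Type*} [Category 𝒦] (D : 𝒦 ⥤ SimplicialSection M φ)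
    [∀ j, HasLimit (D ⋙ SimplicialSection.ev M φ j)] : HasLimit D := by
  choose T hT using fun i ↦ (M.isSimplicialModelCategory i).2
  let c (j : J) := limit.cone (D ⋙ SimplicialSection.ev M φ j)
  let hc (j : J) : IsLimit (c j) := limit.isLimit (D ⋙ SimplicialSection.ev M φ j)
  let π (j : J) (i : 𝒦) : (c j).pt ⟶ (D.obj i).obj j := (c j).π.app i
  have hπ (j : J) {i i' : 𝒦} (a : i ⟶ i') :
      π j i ≫ SimplicialSection.Hom.app (D.map a) j = π j i' := (c j).w a
  -- The action on the levelwise limit is induced componentwise, since mapping spaces take limits in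
  -- the target to limits.
  have H {j k : J} (α : φ.obj j ⟶ φ.obj k) := (T (φ.obj k)).exists_lift (hc k)
    (L := (φ.mapOver α : SSet.{v})) (Z := (M.push α).obj (c j).pt)
    (fun i ↦ (D.obj i).map α ≫ eHomWhiskerRight SSet.{v} ((underlying (M.push α)).map (π j i)) _)
    (fun {i i'} a ↦ by
      ext n x
      change (deg n ((underlying (M.push α)).map (π j i)) ⊚ ((D.obj i).map α).app n x) ⊚
        deg n (SimplicialSection.Hom.app (D.map a) k) =
        deg n ((underlying (M.push α)).map (π j i')) ⊚ ((D.obj i').map α).app n x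
      rw [scomp_assoc, SimplicialSection.naturality_app (D.map a) α x, deg_scomp_deg_scomp,
        ← Functor.map_comp, hπ])
  choose act hact using @H
  have hact' {j k : J} {α : φ.obj j ⟶ φ.obj k} (i : 𝒦) {n : SimplexCategoryᵒᵖ}
      (x : (φ.mapOver α : SSet.{v}).obj n) :
      (act α).app n x ⊚ deg n (π k i) =
        deg n ((underlying (M.push α)).map (π j i)) ⊚ ((D.obj i).map α).app n x :=
    ConcreteCategory.congr_hom (NatTrans.congr_app (hact α i) n) x
  let S : SimplicialSection M φ :=
    { obj j := (c j).pt
      map := act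
      map_id j := (T (φ.obj j)).toHom_ext (hc j) fun i ↦ by
        ext n t
        change (act _).app n (φ.one j n) ⊚ deg n (π j i) =
          deg n (M.pushId (φ.obj j) (c j).pt).hom ⊚ deg n (π j i)
        rw [hact', SimplicialSection.map_one, ← deg_comp, M.pushId_hom_naturality, deg_comp]
      map_comp {j k l} α β := (T (φ.obj l)).toHom_ext (hc l) fun i ↦ by
        ext n ⟨x, y⟩
        change (act _).app n (φ.mul x y) ⊚ deg n (π l i) =
          (deg n (M.pushComp α β (c j).pt).hom ⊚ ((M.push β).map _ _).app n ((act α).app n x) ⊚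
            (act β).app n y) ⊚ deg n (π l i)
        rw [hact', SimplicialSection.map_mul, scomp_assoc, scomp_assoc, hact',
          deg_scomp_deg_scomp, M.pushComp_hom_naturality, ← enrichedFunctor_map_deg,
          ← scomp_assoc (((M.push β).map _ _).app n ((act α).app n x)),
          ← enrichedFunctor_map_scomp, hact', deg_comp, enrichedFunctor_map_scomp,
          enrichedFunctor_map_deg, scomp_assoc, scomp_assoc] }
  let s : Cone D :=
    { pt := S
      π :=
        { app i := SimplicialSection.Hom.mk (s := S) (t := D.obj i) (fun j ↦ π j i)
            (fun α ↦ hact α i)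
          naturality i i' a := SimplicialSection.hom_ext fun j ↦
            (Category.id_comp _).trans (hπ j a).symm } }
  let F (t : Cone D) (j : J) : t.pt.obj j ⟶ (c j).pt :=
    (hc j).lift ((SimplicialSection.ev M φ j).mapCone t)
  have hF (t : Cone D) (j : J) (i : 𝒦) : F t j ≫ π j i = SimplicialSection.Hom.app (t.π.app i) j :=
    (hc j).fac _ _
  exact ⟨⟨s,
    { lift t := SimplicialSection.Hom.mk (s := t.pt) (t := S) (F t) fun {j k} α ↦
        (T (φ.obj k)).toHom_ext (hc k) fun i ↦ by
          ext n x
          change ((t.pt.map α).app n x ⊚ deg n (F t k)) ⊚ deg n (π k i) =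
            (deg n ((underlying (M.push α)).map (F t j)) ⊚ (act α).app n x) ⊚ deg n (π k i)
          rw [scomp_assoc, scomp_assoc, hact', ← deg_comp, hF, deg_scomp_deg_scomp,
            ← Functor.map_comp, hF, SimplicialSection.naturality_app]
      fac t i := SimplicialSection.hom_ext fun j ↦ hF t j i
      uniq t m hm := SimplicialSection.hom_ext fun j ↦ (hc j).hom_ext fun i ↦
        (congrArg (SimplicialSection.Hom.app · j) (hm i)).trans (hF t j i).symm }⟩⟩

/-- Colimits of sections are computed levelwise. -/
lemma hasColimit_sections {𝒦 : Type*} [Category 𝒦] (D : 𝒦 ⥤ SimplicialSection M φ)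
    [∀ j, HasColimit (D ⋙ SimplicialSection.ev M φ j)] : HasColimit D := by
  have hM (i : I) := (M.isSimplicialModelCategory i).1
  let c (j : J) := colimit.cocone (D ⋙ SimplicialSection.ev M φ j)
  let hc (j : J) : IsColimit (c j) := colimit.isColimit (D ⋙ SimplicialSection.ev M φ j)
  -- The left adjoint `α_!` preserves the levelwise colimits, so maps out of `α_!` of a colimit are
  -- again defined componentwise.
  let hc' {j k : J} (α : φ.obj j ⟶ φ.obj k) :
      IsColimit ((underlying (M.push α)).mapCocone (c j)) :=
    haveI := (M.adj α).toAdjunction.leftAdjoint_preservesColimits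
    isColimitOfPreserves _ (hc j)
  let ι (j : J) (i : 𝒦) : (D.obj i).obj j ⟶ (c j).pt := (c j).ι.app i
  have hι (j : J) {i i' : 𝒦} (a : i ⟶ i') :
      SimplicialSection.Hom.app (D.map a) j ≫ ι j i' = ι j i := (c j).w a
  have H {j k : J} (α : φ.obj j ⟶ φ.obj k) := (hM (φ.obj k)).exists_desc (hc' α)
    (L := (φ.mapOver α : SSet.{v})) (Y := (c k).pt)
    (fun i ↦ (D.obj i).map α ≫ eHomWhiskerLeft SSet.{v} _ (ι k i))
    (fun {i i'} a ↦ by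
      ext n x
      change deg n ((underlying (M.push α)).map (SimplicialSection.Hom.app (D.map a) j)) ⊚
        ((D.obj i').map α).app n x ⊚ deg n (ι k i') = ((D.obj i).map α).app n x ⊚ deg n (ι k i)
      rw [← scomp_assoc, ← SimplicialSection.naturality_app (D.map a) α x, scomp_assoc,
        ← deg_comp, hι])
  choose act hact using @H
  have hact' {j k : J} {α : φ.obj j ⟶ φ.obj k} (i : 𝒦) {n : SimplexCategoryᵒᵖ}
      (x : (φ.mapOver α : SSet.{v}).obj n) :
      deg n ((underlying (M.push α)).map (ι j i)) ⊚ (act α).app n x =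
        ((D.obj i).map α).app n x ⊚ deg n (ι k i) :=
    ConcreteCategory.congr_hom (NatTrans.congr_app (hact α i) n) x
  let S : SimplicialSection M φ :=
    { obj j := (c j).pt
      map := act
      map_id j := (hM (φ.obj j)).fromHom_ext (hc' (𝟙 (φ.obj j))) fun i ↦ by
        ext n t
        change deg n ((underlying (M.push _)).map (ι j i)) ⊚ (act _).app n (φ.one j n) =
          deg n ((underlying (M.push _)).map (ι j i)) ⊚ deg n (M.pushId (φ.obj j) (c j).pt).hom
        rw [hact', SimplicialSection.map_one, ← deg_comp, ← deg_comp, M.pushId_hom_naturality]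
      map_comp {j k l} α β := (hM (φ.obj l)).fromHom_ext (hc' (α ≫ β)) fun i ↦ by
        ext n ⟨x, y⟩
        change deg n ((underlying (M.push _)).map (ι j i)) ⊚ (act _).app n (φ.mul x y) =
          deg n ((underlying (M.push _)).map (ι j i)) ⊚
            deg n (M.pushComp α β (c j).pt).hom ⊚ ((M.push β).map _ _).app n ((act α).app n x) ⊚
              (act β).app n y
        rw [hact', SimplicialSection.map_mul, scomp_assoc, scomp_assoc, ← hact',
          deg_scomp_deg_scomp, M.pushComp_hom_naturality, ← enrichedFunctor_map_deg,
          ← scomp_assoc (((M.push β).map _ _).app n _), ← enrichedFunctor_map_scomp, ← hact',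
          deg_comp, enrichedFunctor_map_scomp, enrichedFunctor_map_deg, scomp_assoc,
          scomp_assoc] }
  let s : Cocone D :=
    { pt := S
      ι :=
        { app i := SimplicialSection.Hom.mk (s := D.obj i) (t := S) (fun j ↦ ι j i)
            (fun α ↦ (hact α i).symm)
          naturality i i' a := SimplicialSection.hom_ext fun j ↦
            (hι j a).trans (Category.comp_id _).symm } }
  let F (t : Cocone D) (j : J) : (c j).pt ⟶ t.pt.obj j :=
    (hc j).desc ((SimplicialSection.ev M φ j).mapCocone t)
  have hF (t : Cocone D) (j : J) (i : 𝒦) :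
      ι j i ≫ F t j = SimplicialSection.Hom.app (t.ι.app i) j :=
    (hc j).fac _ _
  exact ⟨⟨s,
    { desc t := SimplicialSection.Hom.mk (s := S) (t := t.pt) (F t) fun {j k} α ↦
        (hM (φ.obj k)).fromHom_ext (hc' α) fun i ↦ by
          ext n x
          change deg n ((underlying (M.push α)).map (ι j i)) ⊚ (act α).app n x ⊚ deg n (F t k) =
            deg n ((underlying (M.push α)).map (ι j i)) ⊚
              deg n ((underlying (M.push α)).map (F t j)) ⊚ (t.pt.map α).app n x
          rw [← scomp_assoc, hact', scomp_assoc, ← deg_comp, hF, deg_scomp_deg_scomp,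
            ← Functor.map_comp, hF, SimplicialSection.naturality_app]
          rfl
      fac t i := SimplicialSection.hom_ext fun j ↦ hF t j i
      uniq t m hm := SimplicialSection.hom_ext fun j ↦ (hc j).hom_ext fun i ↦
        (congrArg (SimplicialSection.Hom.app · j) (hm i)).trans (hF t j i).symm }⟩⟩

instance (𝒦 : Type*) [Category 𝒦] [∀ i, HasLimitsOfShape 𝒦 (M.fiber i)] :
    HasLimitsOfShape 𝒦 (SimplicialSection M φ) :=
  ⟨fun D ↦ hasLimit_sections D⟩

instance (𝒦 : Type*) [Category 𝒦] [∀ i, HasColimitsOfShape 𝒦 (M.fiber i)] :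
    HasColimitsOfShape 𝒦 (SimplicialSection M φ) :=
  ⟨fun D ↦ hasColimit_sections D⟩

instance : HasFiniteLimits (SimplicialSection M φ) := ⟨fun _ _ _ ↦ inferInstance⟩

instance : HasFiniteColimits (SimplicialSection M φ) := ⟨fun _ _ _ ↦ inferInstance⟩

end LimitsOfSections

/-! ### Completeness of locally presentable categories -/

section LocallyPresentable

open Limits

variable (C : Type u) [Category.{v} C]

lemma hasColimits_of_isLocallyPresentable (hC : IsLocallyPresentable.{v} C) :
    HasColimitsOfSize.{v, v} C := by
  obtain ⟨κ, _, h⟩ := hC.exists_cardinal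
  infer_instance

/-- A small model of the `κ`-presentable objects is dense, so `C` is a reflective subcategory of a
category of presheaves and inherits its limits. -/
lemma hasLimits_of_isLocallyPresentable (hC : IsLocallyPresentable.{v} C) :
    HasLimitsOfSize.{v, v} C := by
  obtain ⟨κ, _, h⟩ := hC.exists_cardinal
  let P := isCardinalPresentable C κ
  let F : SmallModel.{v} P.FullSubcategory ⥤ C := (equivSmallModel _).inverse ⋙ P.ι
  have : F.IsDense := by dsimp only [F]; infer_instance
  have : HasColimitsOfSize.{v, v} C := inferInstance
  have adj := Presheaf.uliftYonedaAdjunction.{v} _ (uliftYoneda.{v}.leftKanExtensionUnit F)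
  have : (Presheaf.restrictedULiftYoneda.{v} F).IsRightAdjoint := adj.isRightAdjoint
  have : Reflective (Presheaf.restrictedULiftYoneda.{v} F) := { L := _, adj := adj }
  exact ⟨fun _ _ ↦ hasLimitsOfShape_of_reflective (Presheaf.restrictedULiftYoneda.{v} F)⟩
end LocallyPresentable

/-! ### The pushout-product axiom in terms of mapping spaces -/

section SimplicialModelCategories

open Limits

variable {C : Type u} [Category.{v} C] [SimplicialCategory C] [ModelCategory C]

/-- The map `Map(B, E) ⟶ Map(A, E) ×_{Map(A, D)} Map(B, D)` has the right lifting property with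
respect to a monomorphism of simplicial sets. -/
lemma IsSimplicialModelCategory.exists_sHom_lift (hC : IsSimplicialModelCategory C)
    {K Z : SSet.{v}} (k : K ⟶ Z) [Mono k] {A B E D : C} (i : A ⟶ B) [Cofibration i]
    (p : E ⟶ D) [Fibration p]
    (h : IsWeakHomotopyEquivalence k ∨ WeakEquivalence i ∨ WeakEquivalence p)
    (a : K ⟶ sHom B E) (b : Z ⟶ sHom A E) (c : Z ⟶ sHom B D)
    (hab : a ≫ eHomWhiskerRight SSet.{v} i E = k ≫ b)
    (hac : a ≫ eHomWhiskerLeft SSet.{v} B p = k ≫ c)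
    (hbc : b ≫ eHomWhiskerLeft SSet.{v} A p = c ≫ eHomWhiskerRight SSet.{v} i D) :
    ∃ z : Z ⟶ sHom B E, k ≫ z = a ∧ z ≫ eHomWhiskerRight SSet.{v} i E = b ∧
      z ≫ eHomWhiskerLeft SSet.{v} B p = c := by
  obtain ⟨-, T, hT⟩ := hC
  let sq : T.tensor.PushoutObjObj k i := .ofHasPushout _ _ _
  obtain ⟨h₁, h₂⟩ := hT k i sq inferInstance inferInstance
  -- By the tensor adjunction, the problem is a lifting of the pushout-product of `k` and `i`
  -- against `p`, and one of the two is a weak equivalence.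
  have : HasLiftingProperty sq.ι p := by
    by_cases hp : WeakEquivalence p
    · infer_instance
    · have := h₂ (by tauto)
      infer_instance
  obtain ⟨a, rfl⟩ := (T.homEquiv _ _ _).surjective a
  obtain ⟨b, rfl⟩ := (T.homEquiv _ _ _).surjective b
  obtain ⟨c, rfl⟩ := (T.homEquiv _ _ _).surjective c
  rw [← T.homEquiv_map_comp, ← T.homEquiv_map_app_comp, EmbeddingLike.apply_eq_iff_eq] at hab
  rw [← T.homEquiv_comp, ← T.homEquiv_map_app_comp, EmbeddingLike.apply_eq_iff_eq] at hac
  rw [← T.homEquiv_map_comp, ← T.homEquiv_comp, EmbeddingLike.apply_eq_iff_eq] at hbc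
  have w : CommSq (sq.isPushout.desc b a hab.symm) sq.ι p c :=
    ⟨sq.isPushout.hom_ext (by simp [hbc]) (by simp [hac])⟩
  refine ⟨T.homEquiv _ _ _ w.lift, ?_, ?_, ?_⟩
  · rw [← T.homEquiv_map_app_comp, ← sq.inr_ι, Category.assoc, w.fac_left, sq.isPushout.inr_desc]
  · rw [← T.homEquiv_map_comp, ← sq.inl_ι, Category.assoc, w.fac_left, sq.isPushout.inl_desc]
  · rw [← T.homEquiv_comp, w.fac_right]

end SimplicialModelCategories

/-! ### The small object argument for presentable sources -/

section SmallObjectArgument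

open Limits MorphismProperty

lemma hasSmallObjectArgument_ofHoms {S : Type u} [Category.{v} S] [HasColimitsOfSize.{v, v} S]
    {ι : Type v} {A B : ι → S} (f : ∀ a, A a ⟶ B a) (hA : ∀ a, IsPresentable.{v} (A a)) :
    HasSmallObjectArgument.{v} (ofHoms f) := by
  choose κ₀ hκ₀ h using fun a ↦ (hA a).exists_cardinal
  -- As `ι` is small, a single regular cardinal exceeds the presentability ranks of all sources.
  obtain ⟨κ, hκ, hlt⟩ := HasCardinalLT.exists_regular_cardinal_forall.{v}
    (fun a ↦ (κ₀ a).ord.ToType)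
  have : Fact κ.IsRegular := ⟨hκ⟩
  have : Nonempty κ.ord.ToType := by simpa using hκ.ne_zero
  have := WellFoundedLT.toOrderBot κ.ord.ToType
  refine ⟨κ, inferInstance, inferInstance, { preservesColimit := ?_ }⟩
  rintro _ _ X Y _ ⟨a⟩ g hg
  have hle : κ₀ a ≤ κ := by
    have := hlt a
    rw [hasCardinalLT_iff_cardinal_mk_lt, Cardinal.mk_ord_toType] at this
    exact this.le
  have := h a
  have : IsCardinalPresentable (A a) κ := isCardinalPresentable_of_le _ hle
  have := preservesColimitsOfShape_of_isCardinalPresentable (A a) κ κ.ord.ToType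
  infer_instance

end SmallObjectArgument

/-! ### Factorizations generated by free sections -/

section LevelwiseFactorizations

open Limits MorphismProperty

variable {I : Type u'} [Category.{v} I] {M : SimplicialQuillenPresheaf.{v, u} I}
  {J : Type v} [Category.{v} J] [SimplicialCategory J] {φ : FunctorToOrdinary J I}

variable (M φ) in
/-- The morphisms of sections which belong levelwise to given classes of morphisms. -/
def levelwise (P : ∀ j, MorphismProperty (M.fiber (φ.obj j))) :
    MorphismProperty (SimplicialSection M φ) :=
  fun _ _ T ↦ ∀ j, P j (SimplicialSection.Hom.app T j)

instance (P : ∀ j, MorphismProperty (M.fiber (φ.obj j))) [∀ j, (P j).IsStableUnderRetracts] :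
    (levelwise M φ P).IsStableUnderRetracts where
  of_retract h hg j := of_retract (h.map (SimplicialSection.ev M φ j)) (hg j)

instance (P : ∀ j, MorphismProperty (M.fiber (φ.obj j))) [∀ j, (P j).HasTwoOutOfThreeProperty] :
    (levelwise M φ P).HasTwoOutOfThreeProperty where
  comp_mem _ _ h h' j := (P j).comp_mem _ _ (h j) (h' j)
  of_postcomp f g h h' j :=
    (P j).of_postcomp (SimplicialSection.Hom.app f j) (SimplicialSection.Hom.app g j) (h j) (h' j)
  of_precomp f g h h' j :=
    (P j).of_precomp (SimplicialSection.Hom.app f j) (SimplicialSection.Hom.app g j) (h j) (h' j)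

/-- By adjunction, lifting levelwise against `W` is lifting against the free sections on `W`. Their
sources are presentable because evaluation preserves colimits, so the small object argument applies.
-/
lemma hasFactorization_levelwise (hM : ∀ i, IsLocallyPresentable.{v} (M.fiber i))
    (W : ∀ j, MorphismProperty (M.fiber (φ.obj j))) (hW : ∀ j, IsSmall.{v} (W j)) :
    HasFactorization (levelwise M φ (fun j ↦ (W j).rlp)).llp
      (levelwise M φ (fun j ↦ (W j).rlp)) := by
  have (i : I) : HasLimitsOfSize.{v, v} (M.fiber i) := hasLimits_of_isLocallyPresentable _ (hM i)
  have (i : I) : HasColimitsOfSize.{v, v} (M.fiber i) :=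
    hasColimits_of_isLocallyPresentable _ (hM i)
  have : HasColimitsOfSize.{v, v} (SimplicialSection M φ) := ⟨fun _ ↦ inferInstance⟩
  choose ι A B f hf using fun j ↦ (isSmall_iff_eq_ofHoms.{v} _).1 (hW j)
  have (j : J) := isRightAdjoint_ev (M := M) (φ := φ) j
  let adj (j : J) := Adjunction.ofIsRightAdjoint (SimplicialSection.ev M φ j)
  let W' := ofHoms (fun a : Σ j, ι j ↦ (SimplicialSection.ev M φ a.1).leftAdjoint.map (f a.1 a.2))
  have : HasSmallObjectArgument.{v} W' := hasSmallObjectArgument_ofHoms _ fun a ↦ by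
    have : IsPresentable.{v} (A a.1 a.2) := inferInstance
    obtain ⟨κ, _, _⟩ := this.exists_cardinal
    have : (SimplicialSection.ev M φ a.1).IsCardinalAccessible κ :=
      ⟨fun _ _ _ ↦ inferInstance⟩
    have := (adj a.1).isCardinalPresentable_leftAdjoint_obj κ (A a.1 a.2)
    exact isPresentable_of_isCardinalPresentable _ κ
  have h : levelwise M φ (fun j ↦ (W j).rlp) = W'.rlp := by
    ext s t T
    constructor
    · rintro hT _ _ _ ⟨⟨j, a⟩⟩
      refine ((adj j).hasLiftingProperty_iff _ _).2 (hT j _ ?_)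
      rw [hf]
      exact ⟨a⟩
    · intro hT j X Y g hg
      rw [hf] at hg
      obtain ⟨a⟩ := hg
      exact ((adj j).hasLiftingProperty_iff _ _).1 (hT _ ⟨(⟨j, a⟩ : Σ j, ι j)⟩)
  rw [h]
  infer_instance

end LevelwiseFactorizations

/-! ### Lifting properties of products of cotensors -/

section Powers

open Limits

variable {C : Type u} [Category.{v} C] [SimplicialCategory C]
  {D : Type u'} [Category.{v} D] [SimplicialCategory D]

/-- `Q` represents the families of maps `K i ⟶ Map(F i X, E)`. -/
def RepresentsFamilies {ι : Type*} (K : ι → SSet.{v}) (F : ι → EnrichedFunctor SSet.{v} C D)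
    (E : D) (Q : C) (w : ∀ i, K i ⟶ sHom ((F i).obj Q) E) : Prop :=
  ∀ X : C, Function.Bijective (fun (f : X ⟶ Q) i ↦
    w i ≫ eHomWhiskerRight SSet.{v} ((underlying (F i)).map f) E)

lemma IsPower.representsFamilies {ι : Type*} {K : ι → SSet.{v}}
    {F : ι → EnrichedFunctor SSet.{v} C D} {E : D} {Q : C} {w : ∀ i, K i ⟶ sHom ((F i).obj Q) E}
    (h : IsPower K F E Q w) : RepresentsFamilies K F E Q w :=
  fun _ ↦ ⟨fun _ _ h' ↦ h.hom_ext (congrFun h'), fun k ↦ (h.exists_hom k).imp fun _ ↦ funext⟩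

section

variable {ι : Type*} {K : ι → SSet.{v}} {F : ι → EnrichedFunctor SSet.{v} C D} {E : D} {Q : C}
  {w : ∀ i, K i ⟶ sHom ((F i).obj Q) E} {X : C}

lemma RepresentsFamilies.hom_ext (hw : RepresentsFamilies K F E Q w) {f f' : X ⟶ Q}
    (h : ∀ i, w i ≫ eHomWhiskerRight SSet.{v} ((underlying (F i)).map f) E =
      w i ≫ eHomWhiskerRight SSet.{v} ((underlying (F i)).map f') E) : f = f' :=
  (hw X).1 (funext h)

lemma RepresentsFamilies.exists_hom (hw : RepresentsFamilies K F E Q w)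
    (k : ∀ i, K i ⟶ sHom ((F i).obj X) E) :
    ∃ f : X ⟶ Q, ∀ i, w i ≫ eHomWhiskerRight SSet.{v} ((underlying (F i)).map f) E = k i :=
  ((hw X).2 k).imp fun _ ↦ congrFun

end

variable [ModelCategory C] [ModelCategory D]

/-- The lifting property of the corner map between objects representing families, for a family of
monomorphisms of simplicial sets and a fibration. -/
lemma RepresentsFamilies.exists_lift {ι : Type*} {K Z : ι → SSet.{v}}
    {F : ι → EnrichedFunctor SSet.{v} C D} {E E' : D} {Q Q' R R' : C}
    {w : ∀ i, K i ⟶ sHom ((F i).obj Q) E} {w' : ∀ i, K i ⟶ sHom ((F i).obj Q') E'}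
    {u : ∀ i, Z i ⟶ sHom ((F i).obj R) E} {u' : ∀ i, Z i ⟶ sHom ((F i).obj R') E'}
    (hw : RepresentsFamilies K F E Q w)
    (hu : RepresentsFamilies Z F E R u) (hu' : RepresentsFamilies Z F E' R' u')
    (hD : IsSimplicialModelCategory D) (hF : ∀ i, PreservesCofibrations (underlying (F i)))
    (k : ∀ i, K i ⟶ Z i) [∀ i, Mono (k i)] (p : E ⟶ E') [Fibration p]
    {A B : C} (f : A ⟶ B) [Cofibration f]
    (h : (∀ i, IsWeakHomotopyEquivalence (k i)) ∨ WeakEquivalence f ∨ WeakEquivalence p)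
    (m : R ⟶ Q) (m' : R' ⟶ Q') (q : Q ⟶ Q') (r : R ⟶ R')
    (hm : ∀ i, w i ≫ eHomWhiskerRight SSet.{v} ((underlying (F i)).map m) E = k i ≫ u i)
    (hm' : ∀ i, w' i ≫ eHomWhiskerRight SSet.{v} ((underlying (F i)).map m') E' = k i ≫ u' i)
    (hq : ∀ i, w' i ≫ eHomWhiskerRight SSet.{v} ((underlying (F i)).map q) E' =
      w i ≫ eHomWhiskerLeft SSet.{v} _ p)
    (hr : ∀ i, u' i ≫ eHomWhiskerRight SSet.{v} ((underlying (F i)).map r) E' =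
      u i ≫ eHomWhiskerLeft SSet.{v} _ p)
    (a : A ⟶ R) (b : B ⟶ R') (c : B ⟶ Q) (hab : a ≫ r = f ≫ b) (hac : a ≫ m = f ≫ c)
    (hbc : b ≫ m' = c ≫ q) :
    ∃ l : B ⟶ R, f ≫ l = a ∧ l ≫ r = b ∧ l ≫ m = c := by
  -- By representability the lifting problem splits into one problem in `D` for each `i`, with `f`
  -- replaced by its image under the left Quillen functor `F i`.
  have hi (i : ι) : ∃ z : Z i ⟶ sHom ((F i).obj B) E,
      k i ≫ z = w i ≫ eHomWhiskerRight SSet.{v} ((underlying (F i)).map c) E ∧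
      z ≫ eHomWhiskerRight SSet.{v} ((underlying (F i)).map f) E =
        u i ≫ eHomWhiskerRight SSet.{v} ((underlying (F i)).map a) E ∧
      z ≫ eHomWhiskerLeft SSet.{v} _ p =
        u' i ≫ eHomWhiskerRight SSet.{v} ((underlying (F i)).map b) E' := by
    have hf : Cofibration ((underlying (F i)).map f) := (hF i).cofibration f inferInstance
    refine hD.exists_sHom_lift (k i) ((underlying (F i)).map f) p ?_ _ _ _ ?_ ?_ ?_
    · rcases h with h | h | h
      · exact Or.inl (h i)
      · exact Or.inr (Or.inl ((hF i).trivialCofibration f inferInstance h).2)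
      · exact Or.inr (Or.inr h)
    · rw [Category.assoc, ← eHomWhiskerRight_comp, ← Functor.map_comp, ← hac, ← Category.assoc,
        ← hm, Category.assoc, ← eHomWhiskerRight_comp, ← Functor.map_comp]
    · rw [Category.assoc, ← eHom_whisker_exchange, ← Category.assoc, ← hq, Category.assoc,
        ← eHomWhiskerRight_comp, ← Functor.map_comp, ← hbc, ← Category.assoc, ← hm',
        Category.assoc, ← eHomWhiskerRight_comp, ← Functor.map_comp]
    · rw [Category.assoc, ← eHom_whisker_exchange, ← Category.assoc, ← hr, Category.assoc,
        Category.assoc, ← eHomWhiskerRight_comp, ← Functor.map_comp, hab,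
        ← eHomWhiskerRight_comp, ← Functor.map_comp]
  choose z hz₁ hz₂ hz₃ using hi
  obtain ⟨l, hl⟩ := hu.exists_hom z
  refine ⟨l, hu.hom_ext fun i ↦ ?_, hu'.hom_ext fun i ↦ ?_, hw.hom_ext fun i ↦ ?_⟩
  · rw [Functor.map_comp, eHomWhiskerRight_comp, ← Category.assoc, hl, hz₂]
  · rw [Functor.map_comp, eHomWhiskerRight_comp, ← Category.assoc, hr, Category.assoc,
      eHom_whisker_exchange, ← Category.assoc, hl, hz₃]
  · rw [Functor.map_comp, eHomWhiskerRight_comp, ← Category.assoc, hm, Category.assoc, hl, hz₁]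

/-- The previous lifting property for the monomorphisms `∅ ⟶ K i`; families of maps from `∅` are
represented by the terminal object. -/
lemma RepresentsFamilies.hasLiftingProperty {ι : Type*} {K : ι → SSet.{v}}
    {F : ι → EnrichedFunctor SSet.{v} C D} {E E' : D} {Q Q' : C}
    {w : ∀ i, K i ⟶ sHom ((F i).obj Q) E} {w' : ∀ i, K i ⟶ sHom ((F i).obj Q') E'}
    (hw : RepresentsFamilies K F E Q w) (hw' : RepresentsFamilies K F E' Q' w')
    (hD : IsSimplicialModelCategory D) (hF : ∀ i, PreservesCofibrations (underlying (F i)))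
    (p : E ⟶ E') [Fibration p] {A B : C} (f : A ⟶ B) [Cofibration f]
    (h : WeakEquivalence f ∨ WeakEquivalence p) (q : Q ⟶ Q')
    (hq : ∀ i, w' i ≫ eHomWhiskerRight SSet.{v} ((underlying (F i)).map q) E' =
      w i ≫ eHomWhiskerLeft SSet.{v} _ p) :
    HasLiftingProperty f q := by
  let w₀ (E₀ : D) (i : ι) : ⊥_ SSet.{v} ⟶ sHom ((F i).obj (⊤_ C)) E₀ := initial.to _
  have h₀ : RepresentsFamilies (fun _ ↦ ⊥_ SSet.{v}) F E (⊤_ C) (w₀ E) :=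
    fun X ↦ ⟨fun _ _ _ ↦ terminal.hom_ext _ _, fun k ↦ ⟨terminal.from X,
      funext fun _ ↦ initial.hom_ext _ _⟩⟩
  refine ⟨fun {a b} sq ↦ ?_⟩
  obtain ⟨l, h₁, h₂, -⟩ := h₀.exists_lift (w' := w₀ E') hw hw' hD hF (fun i ↦ initial.to (K i))
    p f (Or.inr h) (terminal.from Q) (terminal.from Q') (𝟙 _) q (fun _ ↦ initial.hom_ext _ _)
    (fun _ ↦ initial.hom_ext _ _) (fun _ ↦ initial.hom_ext _ _) hq a b (terminal.from B)
    sq.w (terminal.hom_ext _ _) (terminal.hom_ext _ _)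
  exact ⟨⟨⟨l, h₁, h₂⟩⟩⟩

end Powers

/-! ### Cofree sections on fibrations -/

section CofreeFibrations

open Limits

variable {I : Type u'} [Category.{v} I] {M : SimplicialQuillenPresheaf.{v, u} I}
  {J : Type v} [Category.{v} J] [SimplicialCategory J] {φ : FunctorToOrdinary J I}

lemma CofreeData.cogen_comp_whiskerRight_of_fac {k : J} {E D : M.fiber (φ.obj k)}
    {d : CofreeData M φ k E} {d' : CofreeData M φ k D} {p : E ⟶ D}
    {T : d.toSection ⟶ d'.toSection}
    (hT : SimplicialSection.Hom.app T k ≫ d'.counit = d.counit ≫ p) {j : J}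
    (α : φ.obj j ⟶ φ.obj k) :
    d'.cogen α ≫ eHomWhiskerRight SSet.{v} ((underlying (M.push α)).map
      (SimplicialSection.Hom.app T j)) D =
    d.cogen α ≫ eHomWhiskerLeft SSet.{v} _ p := by
  refine (d'.cogen_comp_whiskerRight T α).trans ?_
  rw [hT]
  ext n x
  change (d.act α).app n x ⊚ deg n (d.counit ≫ p) = (d.cogen α).app n x ⊚ deg n p
  rw [cogen_eq_act, deg_comp, scomp_assoc]

variable [∀ i, Limits.HasProducts.{v} (M.fiber i)]

lemma cofree_map_app_counit {k : J} {E D : M.fiber (φ.obj k)} (p : E ⟶ D) :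
    SimplicialSection.Hom.app ((cofree M φ k).map p) k ≫ (cofreeData M φ k D).counit =
      (cofreeData M φ k E).counit ≫ p := by
  have h := (evAdjCofree M φ k).counit.naturality p
  rw [evAdjCofree_counit_app, evAdjCofree_counit_app] at h
  exact h

lemma cogen_comp_cofree_map {k : J} {E D : M.fiber (φ.obj k)} (p : E ⟶ D) {j : J}
    (α : φ.obj j ⟶ φ.obj k) :
    (cofreeData M φ k D).cogen α ≫ eHomWhiskerRight SSet.{v} ((underlying (M.push α)).map
      (SimplicialSection.Hom.app ((cofree M φ k).map p) j)) D =
    (cofreeData M φ k E).cogen α ≫ eHomWhiskerLeft SSet.{v} _ p := by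
  exact CofreeData.cogen_comp_whiskerRight_of_fac (cofree_map_app_counit p) α

/-- Cotensors by simplicial sets, the right adjoints `α^*` and products all preserve fibrations and
trivial fibrations, hence so do the cofree functors levelwise. -/
lemma hasLiftingProperty_cofree_map_app {k j : J} {E D : M.fiber (φ.obj k)} (p : E ⟶ D)
    [Fibration p] {A B : M.fiber (φ.obj j)} (i : A ⟶ B) [Cofibration i]
    (h : WeakEquivalence i ∨ WeakEquivalence p) :
    HasLiftingProperty i (SimplicialSection.Hom.app ((cofree M φ k).map p) j) :=
  ((cofreeData M φ k E).isPower j).representsFamilies.hasLiftingProperty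
    ((cofreeData M φ k D).isPower j).representsFamilies (M.isSimplicialModelCategory _)
    (fun α ↦ M.push_preservesCofibrations α) p i h _ (fun α ↦ cogen_comp_cofree_map p α)

end CofreeFibrations

/-! ### The projective model structure -/

section ProjectiveModelStructure

open Limits MorphismProperty

variable {I : Type u'} [Category.{v} I] {M : SimplicialQuillenPresheaf.{v, u} I}
  {J : Type v} [Category.{v} J] [SimplicialCategory J] {φ : FunctorToOrdinary J I}

/-- Lifting `T` at level `k` against a fibration `p` is lifting `T` against the cofree section on
`p`, which is a levelwise fibration. This yields the acyclicity needed for the model structure. -/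
lemma levelwise_trivialCofibrations_of_llp [∀ i, HasProducts.{v} (M.fiber i)]
    {s t : SimplicialSection M φ} {T : s ⟶ t}
    (hT : (levelwise M φ (fun j ↦ fibrations (M.fiber (φ.obj j)))).llp T) (k : J) :
    trivialCofibrations (M.fiber (φ.obj k)) (SimplicialSection.Hom.app T k) := by
  rw [← fibrations_llp]
  intro E D p hp
  refine ((evAdjCofree M φ k).hasLiftingProperty_iff T p).2 (hT _ fun j ↦ ?_)
  change fibrations (M.fiber (φ.obj j)) _
  rw [← trivialCofibrations_rlp]
  intro A B i hi
  have : Fibration p := ⟨hp⟩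
  have : Cofibration i := ⟨hi.1⟩
  exact hasLiftingProperty_cofree_map_app p i (Or.inl ⟨hi.2⟩)

variable (M φ) in
/-- The projective model structure on sections. -/
@[reducible]
def projectiveModelCategory (hM : ∀ i, IsCombinatorial (M.fiber i)) :
    ModelCategory (SimplicialSection M φ) := by
  let _ : CategoryWithFibrations (SimplicialSection M φ) :=
    ⟨levelwise M φ (fun j ↦ fibrations (M.fiber (φ.obj j)))⟩
  let _ : CategoryWithWeakEquivalences (SimplicialSection M φ) :=
    ⟨levelwise M φ (fun j ↦ weakEquivalences (M.fiber (φ.obj j)))⟩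
  let _ : CategoryWithCofibrations (SimplicialSection M φ) :=
    ⟨(levelwise M φ (fun j ↦ trivialFibrations (M.fiber (φ.obj j)))).llp⟩
  have hp (i : I) : HasProducts.{v} (M.fiber i) := fun _ ↦
    have := hasLimits_of_isLocallyPresentable _ (hM i).isLocallyPresentable
    inferInstance
  have : (weakEquivalences (SimplicialSection M φ)).HasTwoOutOfThreeProperty :=
    inferInstanceAs (levelwise M φ _).HasTwoOutOfThreeProperty
  have : (fibrations (SimplicialSection M φ)).IsStableUnderRetracts :=
    inferInstanceAs (levelwise M φ _).IsStableUnderRetracts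
  have : (cofibrations (SimplicialSection M φ)).IsStableUnderRetracts :=
    inferInstanceAs (levelwise M φ _).llp.IsStableUnderRetracts
  have ht : trivialFibrations (SimplicialSection M φ) =
      levelwise M φ (fun j ↦ trivialFibrations (M.fiber (φ.obj j))) := by
    ext s t T
    exact forall_and.symm
  have : IsWeakFactorizationSystem (cofibrations (SimplicialSection M φ))
      (trivialFibrations (SimplicialSection M φ)) := by
    choose W hW hW' using fun i ↦ (hM i).exists_generatingCofibrations
    have := hasFactorization_levelwise (M := M) (φ := φ) (fun i ↦ (hM i).isLocallyPresentable)
      (fun j ↦ W (φ.obj j)) (fun j ↦ hW _)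
    simp only [← hW'] at this
    rw [ht]
    have : HasFactorization (cofibrations (SimplicialSection M φ))
      (levelwise M φ (fun j ↦ trivialFibrations (M.fiber (φ.obj j)))) := this
    exact .mk' _ _ fun i p hi hp ↦ hi _ hp
  have hf : HasFactorization (fibrations (SimplicialSection M φ)).llp
      (fibrations (SimplicialSection M φ)) := by
    choose W hW hW' using fun i ↦ (hM i).exists_generatingTrivialCofibrations
    have := hasFactorization_levelwise (M := M) (φ := φ) (fun i ↦ (hM i).isLocallyPresentable)
      (fun j ↦ W (φ.obj j)) (fun j ↦ hW _)
    simp only [← hW'] at this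
    exact this
  have hc : trivialCofibrations (SimplicialSection M φ) =
      (fibrations (SimplicialSection M φ)).llp := by
    ext s t T
    constructor
    -- Retract argument: the second factor of `T` is a trivial fibration by two-out-of-three, so `T`
    -- is a retract of the first one.
    · intro hT
      have h := factorizationData (fibrations (SimplicialSection M φ)).llp
        (fibrations (SimplicialSection M φ)) T
      have hp : trivialFibrations (SimplicialSection M φ) h.p := by
        have hi : weakEquivalences (SimplicialSection M φ) h.i :=
          fun k ↦ (levelwise_trivialCofibrations_of_llp h.hi k).2
        refine ⟨h.hp, (weakEquivalences (SimplicialSection M φ)).of_precomp h.i h.p hi ?_⟩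
        rw [h.fac]
        exact hT.2
      have : HasLiftingProperty T h.p := hT.1 _ (ht ▸ hp)
      exact of_retract (RetractArrow.ofLeftLiftingProperty h.fac) h.hi
    · intro hT
      exact ⟨fun _ _ p hp ↦ hT _ fun j ↦ (hp j).1,
        fun k ↦ (levelwise_trivialCofibrations_of_llp hT k).2⟩
  have : IsWeakFactorizationSystem (trivialCofibrations (SimplicialSection M φ))
      (fibrations (SimplicialSection M φ)) := by
    rw [hc]
    exact .mk' _ _ fun i p hi hp ↦ hi _ hp
  exact ModelCategory.mk' _

variable (M φ) in
lemma isProjective_projectiveModelCategory (hM : ∀ i, IsCombinatorial (M.fiber i)) :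
    SimplicialSection.IsProjective (projectiveModelCategory M φ hM) := by
  let _ := projectiveModelCategory M φ hM
  refine ⟨fun T ↦ ?_, fun T ↦ ?_, fun T ↦ ?_⟩
  · rw [weakEquivalence_iff]
    exact forall_congr' fun j ↦ (weakEquivalence_iff _).symm
  · rw [fibration_iff]
    exact forall_congr' fun j ↦ (fibration_iff _).symm
  · rw [cofibration_iff]
    exact ⟨fun h _ _ T' h₁ h₂ ↦ h T' fun j ↦ ⟨(h₁ j).mem, (h₂ j).mem⟩,
      fun h _ _ T' hT' ↦ h T' (fun j ↦ ⟨(hT' j).1⟩) (fun j ↦ ⟨(hT' j).2⟩)⟩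

end ProjectiveModelStructure

/-! ### The left adjoint of restriction and the Quillen adjunction -/

section LeftAdjoint

open Limits

/-- The left adjoint sends a family to the coproduct of the images under the individual left
adjoints. -/
lemma isRightAdjoint_pi' {S : Type*} [Category.{v} S] [HasCoproducts.{v} S] {J : Type v}
    {C : J → Type u} [∀ j, Category.{v} (C j)] (G : ∀ j, S ⥤ C j) (hG : ∀ j, (G j).IsRightAdjoint) :
    (Functor.pi' G).IsRightAdjoint := by
  let adj (j : J) := Adjunction.ofIsRightAdjoint (G j)
  refine (Adjunction.adjunctionOfEquivLeft
    (F_obj := fun X ↦ ∐ fun j ↦ (G j).leftAdjoint.obj (X j))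
    (G := Functor.pi' G) (fun X s ↦
      { toFun f j := (adj j).homEquiv _ _ (Sigma.ι (fun j ↦ (G j).leftAdjoint.obj (X j)) j ≫ f)
        invFun g := Sigma.desc fun j ↦ ((adj j).homEquiv _ _).symm (g j)
        left_inv f := by
          refine Sigma.hom_ext _ _ fun j ↦ ?_
          simp
        right_inv g := by
          funext j
          exact (congrArg _ (Sigma.ι_desc _ _)).trans (Equiv.apply_symm_apply _ _) }) ?_).isRightAdjoint
  intro X s s' f g
  funext j
  exact (congrArg ((adj j).homEquiv _ _) (Category.assoc _ _ _).symm).trans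
    ((adj j).homEquiv_naturality_right _ _)

lemma preservesColimit_pi' {S : Type*} [Category* S] {𝒦 : Type*} [Category* 𝒦] {J : Type*}
    {C : J → Type u} [∀ j, Category.{v} (C j)] (G : ∀ j, S ⥤ C j) (F : 𝒦 ⥤ S)
    [∀ j, PreservesColimit F (G j)] : PreservesColimit F (Functor.pi' G) where
  preserves {c} hc := by
    let e (t : Cocone (F ⋙ Functor.pi' G)) (j : J) : Cocone (F ⋙ G j) :=
      { pt := t.pt j
        ι := { app k := t.ι.app k j
               naturality k k' a := congrFun (t.ι.naturality a) j } }
    let hc' (j : J) := isColimitOfPreserves (G j) hc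
    exact ⟨{
      desc t j := (hc' j).desc (e t j)
      fac t k := funext fun j ↦ (hc' j).fac (e t j) k
      uniq t m hm := funext fun j ↦ (hc' j).uniq (e t j) _ fun k ↦ congrFun (hm k) j }⟩

variable {I : Type u'} [Category.{v} I] {M : SimplicialQuillenPresheaf.{v, u} I}
  {J : Type v} [Category.{v} J] [SimplicialCategory J]

variable (M) in
/-- The functor which forgets the action of mapping spaces on a section. -/
abbrev forgetSection (φ : FunctorToOrdinary J I) :
    SimplicialSection M φ ⥤ ∀ j, M.fiber (φ.obj j) :=
  Functor.pi' (fun j ↦ SimplicialSection.ev M φ j)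

lemma reflectsIsomorphisms_forgetSection (φ : FunctorToOrdinary J I) :
    (forgetSection M φ).ReflectsIsomorphisms where
  reflects {s t} T hT := by
    have h (j : J) : IsIso (SimplicialSection.Hom.app T j) :=
      inferInstanceAs (IsIso ((Pi.eval _ j).map ((forgetSection M φ).map T)))
    let T' : t ⟶ s := .mk (fun j ↦ inv (SimplicialSection.Hom.app T j)) (fun {j k} α ↦ by
      have h₁ := congrArg (· ≫ eHomWhiskerLeft SSet.{v} _ (inv (SimplicialSection.Hom.app T k)) ≫
        eHomWhiskerRight SSet.{v}
          ((underlying (M.push α)).map (inv (SimplicialSection.Hom.app T j))) _)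
        (SimplicialSection.Hom.naturality T α)
      beta_reduce at h₁
      rw [Category.assoc, ← eHomWhiskerLeft_comp_assoc, IsIso.hom_inv_id, eHomWhiskerLeft_id,
        Category.id_comp, Category.assoc, ← eHom_whisker_exchange_assoc, ← eHomWhiskerRight_comp,
        ← Functor.map_comp, IsIso.inv_hom_id, CategoryTheory.Functor.map_id, eHomWhiskerRight_id,
        Category.comp_id] at h₁
      exact h₁.symm)
    exact ⟨T', by ext j; exact IsIso.hom_inv_id (SimplicialSection.Hom.app T j),
      by ext j; exact IsIso.inv_hom_id (SimplicialSection.Hom.app T j)⟩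

variable {J' : Type v} [Category.{v} J'] [SimplicialCategory J']

/-- Adjoint triangle theorem: followed by the forgetful functor, restriction becomes the family of
evaluations at the `ψ(j)`, which is a right adjoint. The forgetful functor is monadic by the
reflexive form of Beck's theorem, as it is a conservative right adjoint and colimits of sections are
levelwise. -/
lemma isRightAdjoint_restriction (hM : ∀ i, IsCombinatorial (M.fiber i))
    (φ' : FunctorToOrdinary J' I) (ψ : EnrichedFunctor SSet.{v} J J') :
    (SimplicialSection.restriction M φ' ψ).IsRightAdjoint := by
  have (i : I) : HasColimitsOfSize.{v, v} (M.fiber i) :=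
    hasColimits_of_isLocallyPresentable _ (hM i).isLocallyPresentable
  have (i : I) : HasLimitsOfSize.{v, v} (M.fiber i) :=
    hasLimits_of_isLocallyPresentable _ (hM i).isLocallyPresentable
  have : (forgetSection M (φ'.precomp ψ)).IsRightAdjoint :=
    isRightAdjoint_pi' _ fun j ↦ isRightAdjoint_ev j
  have : (SimplicialSection.restriction M φ' ψ ⋙
      forgetSection M (φ'.precomp ψ)).IsRightAdjoint :=
    isRightAdjoint_pi' (fun j ↦ SimplicialSection.ev M φ' (ψ.obj j)) fun j ↦ isRightAdjoint_ev _
  have : HasReflexiveCoequalizers (SimplicialSection M φ') := ⟨fun _ _ _ _ _ ↦ inferInstance⟩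
  have : HasReflexiveCoequalizers (SimplicialSection M (φ'.precomp ψ)) :=
    ⟨fun _ _ _ _ _ ↦ inferInstance⟩
  have := reflectsIsomorphisms_forgetSection (M := M) (φ'.precomp ψ)
  have : Monad.PreservesColimitOfIsReflexivePair (forgetSection M (φ'.precomp ψ)) :=
    ⟨fun _ _ _ _ _ ↦ preservesColimit_pi' _ _⟩
  have : MonadicRightAdjoint (forgetSection M (φ'.precomp ψ)) :=
    Monad.monadicOfHasPreservesReflexiveCoequalizersOfReflectsIsomorphisms
      (Adjunction.ofIsRightAdjoint _)
  exact isRightAdjoint_triangle_lift_monadic (forgetSection M (φ'.precomp ψ))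

/-- Restriction preserves levelwise fibrations and levelwise weak equivalences; the statement about
the left adjoint follows by transposing liftings. -/
lemma isQuillenAdjunction_restriction (φ' : FunctorToOrdinary J' I)
    (ψ : EnrichedFunctor SSet.{v} J J')
    {P : ModelCategory (SimplicialSection M (φ'.precomp ψ))}
    {P' : ModelCategory (SimplicialSection M φ')}
    (hP : SimplicialSection.IsProjective P) (hP' : SimplicialSection.IsProjective P')
    {L : SimplicialSection M (φ'.precomp ψ) ⥤ SimplicialSection M φ'}
    (adj : L ⊣ SimplicialSection.restriction M φ' ψ) : IsQuillenAdjunction adj := by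
  have h₁ {s t : SimplicialSection M φ'} (T : s ⟶ t) (hT : Fibration T) :
      Fibration ((SimplicialSection.restriction M φ' ψ).map T) :=
    (hP.fibration_iff _).2 fun j ↦ (hP'.fibration_iff _).1 hT (ψ.obj j)
  have h₂ {s t : SimplicialSection M φ'} (T : s ⟶ t) (hT : WeakEquivalence T) :
      WeakEquivalence ((SimplicialSection.restriction M φ' ψ).map T) :=
    (hP.weakEquivalence_iff _).2 fun j ↦ (hP'.weakEquivalence_iff _).1 hT (ψ.obj j)
  have h₃ {X Y : SimplicialSection M (φ'.precomp ψ)} (f : X ⟶ Y) (hf : Cofibration f) :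
      Cofibration (L.map f) := by
    rw [cofibration_iff, ← trivialFibrations_llp]
    intro s t T hT
    have := h₁ T ⟨hT.1⟩
    have := h₂ T ⟨hT.2⟩
    exact (adj.hasLiftingProperty_iff _ _).2 inferInstance
  refine ⟨h₃, fun f hf hf' ↦ ⟨h₃ f hf, ?_⟩⟩
  suffices trivialCofibrations _ (L.map f) from ⟨this.2⟩
  rw [← fibrations_llp]
  intro s t T hT
  have := h₁ T ⟨hT⟩
  exact (adj.hasLiftingProperty_iff _ _).2 inferInstance

end LeftAdjoint

/-! ### Weak homotopy equivalences and mapping cylinders -/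

section WeakHomotopyEquivalences

open Limits SSet Opposite

/-- A retract of a bijection is a bijection. -/
lemma mapπ₀_bijective_of_comp_eq {X Y X' Y' : SSet.{v}} {f : X ⟶ Y} {g : X' ⟶ Y'}
    (i : X ⟶ X') (i' : Y ⟶ Y') (r : X' ⟶ X) (r' : Y' ⟶ Y) (hi : i ≫ r = 𝟙 X) (hi' : i' ≫ r' = 𝟙 Y)
    (h : i ≫ g = f ≫ i') (h' : r ≫ f = g ≫ r')
    (hg : Function.Bijective (mapπ₀ g)) : Function.Bijective (mapπ₀ f) := by
  constructor
  · intro x y hxy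
    have hi (x) : mapπ₀ r (mapπ₀ i x) = x := by
      rw [← mapπ₀_comp_apply, hi, mapπ₀_id_apply]
    rw [← hi x, ← hi y]
    refine congrArg _ (hg.1 ?_)
    rw [← mapπ₀_comp_apply, ← mapπ₀_comp_apply, h, mapπ₀_comp_apply, mapπ₀_comp_apply, hxy]
  · intro y
    obtain ⟨x, hx⟩ := hg.2 (mapπ₀ i' y)
    refine ⟨mapπ₀ r x, ?_⟩
    rw [← mapπ₀_comp_apply, h', mapπ₀_comp_apply, hx, ← mapπ₀_comp_apply, hi', mapπ₀_id_apply]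

lemma pre_app_comp {X Y W : SSet.{v}} (f : X ⟶ Y) (g : Y ⟶ W) (Z : SSet.{v}) :
    (MonoidalClosed.pre (f ≫ g)).app Z =
      (MonoidalClosed.pre g).app Z ≫ (MonoidalClosed.pre f).app Z := by
  rw [MonoidalClosed.pre_map]
  rfl

namespace IsWeakHomotopyEquivalence

lemma id (X : SSet.{v}) : IsWeakHomotopyEquivalence (𝟙 X) := fun Z _ ↦ by
  rw [MonoidalClosed.pre_id]
  exact ⟨fun x y h ↦ by simpa using h, fun x ↦ ⟨x, by simp⟩⟩

/-- A retract of a weak homotopy equivalence is a weak homotopy equivalence. -/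
lemma of_retract {X Y X' Y' : SSet.{v}} {f : X ⟶ Y} {g : X' ⟶ Y'}
    (hg : IsWeakHomotopyEquivalence g)
    (i : X ⟶ X') (i' : Y ⟶ Y') (r : X' ⟶ X) (r' : Y' ⟶ Y) (hi : i ≫ r = 𝟙 X) (hi' : i' ≫ r' = 𝟙 Y)
    (h : i ≫ g = f ≫ i') (h' : r ≫ f = g ≫ r') : IsWeakHomotopyEquivalence f := fun Z _ ↦ by
  refine mapπ₀_bijective_of_comp_eq ((MonoidalClosed.pre r').app Z) ((MonoidalClosed.pre r).app Z)
    ((MonoidalClosed.pre i').app Z) ((MonoidalClosed.pre i).app Z) ?_ ?_ ?_ ?_ (hg Z) <;>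
  simp only [← pre_app_comp, hi, hi', h, h', MonoidalClosed.pre_id] <;> rfl

variable {X Y W : SSet.{v}} {f : X ⟶ Y} {g : Y ⟶ W}

lemma bijective_comp_iff {Z : SSet.{v}} :
    Function.Bijective (mapπ₀ ((MonoidalClosed.pre (f ≫ g)).app Z)) ↔ Function.Bijective
      (mapπ₀ ((MonoidalClosed.pre f).app Z) ∘ mapπ₀ ((MonoidalClosed.pre g).app Z)) := by
  rw [pre_app_comp]
  refine iff_of_eq (congrArg _ (funext fun x ↦ ?_))
  exact mapπ₀_comp_apply _ _ _

lemma of_precomp (hf : IsWeakHomotopyEquivalence f) (hfg : IsWeakHomotopyEquivalence (f ≫ g)) :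
    IsWeakHomotopyEquivalence g := fun Z _ ↦
  (Function.Bijective.of_comp_iff' (hf Z) _).1 (bijective_comp_iff.1 (hfg Z))

lemma of_postcomp (hg : IsWeakHomotopyEquivalence g) (hfg : IsWeakHomotopyEquivalence (f ≫ g)) :
    IsWeakHomotopyEquivalence f := fun Z _ ↦
  (Function.Bijective.of_comp_iff _ (hg Z)).1 (bijective_comp_iff.1 (hfg Z))

end IsWeakHomotopyEquivalence

/-- The map from the boundary of the interval given by two vertices. -/
def boundaryOneDesc {E : SSet.{v}} (x y : E _⦋0⦌) : (∂Δ[1] : SSet.{v}) ⟶ E where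
  app m := ↾fun s ↦ if stdSimplex.asOrderHom s.1 0 = 0 then (SSet.const (X := ∂Δ[1]) x).app m s
    else (SSet.const (X := ∂Δ[1]) y).app m s
  naturality m m' θ := by
    ext ⟨s, hs⟩
    have h : stdSimplex.asOrderHom (Δ[1].map θ s) 0 = stdSimplex.asOrderHom s 0 := by
      change stdSimplex.asOrderHom s (θ.unop.toOrderHom 0) = _
      by_contra h
      exact hs fun y ↦ by
        by_cases hy : y = stdSimplex.asOrderHom s 0
        · exact ⟨_, hy.symm⟩
        · exact ⟨θ.unop.toOrderHom 0, by omega⟩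
    have h' (z : E _⦋0⦌) := NatTrans.naturality_apply (SSet.const (X := ∂Δ[1]) z) θ ⟨s, hs⟩
    by_cases hs' : stdSimplex.asOrderHom s 0 = 0
    · exact ((if_pos (h.trans hs')).trans (h' x)).trans
        (congrArg (E.map θ) (if_pos hs')).symm
    · exact ((if_neg (fun H ↦ hs' (h.symm.trans H))).trans (h' y)).trans
        (congrArg (E.map θ) (if_neg hs')).symm

lemma boundaryOneDesc_app_of_eq_zero {E : SSet.{v}} (x y : E _⦋0⦌) {m : SimplexCategoryᵒᵖ}
    (s : (∂Δ[1] : SSet.{v}).obj m) (hs : stdSimplex.asOrderHom s.1 0 = 0) :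
    (boundaryOneDesc x y).app m s = (SSet.const (X := ∂Δ[1]) x).app m s := if_pos hs

lemma boundaryOneDesc_app_of_ne_zero {E : SSet.{v}} (x y : E _⦋0⦌) {m : SimplexCategoryᵒᵖ}
    (s : (∂Δ[1] : SSet.{v}).obj m) (hs : stdSimplex.asOrderHom s.1 0 ≠ 0) :
    (boundaryOneDesc x y).app m s = (SSet.const (X := ∂Δ[1]) y).app m s := if_neg hs

lemma const_app_zero {X E : SSet.{v}} (x : E _⦋0⦌) (s : X _⦋0⦌) : (SSet.const x).app _ s = x := by
  have : SimplexCategory.const ⦋0⦌ ⦋0⦌ 0 = 𝟙 _ := Subsingleton.elim _ _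
  simp [this]

lemma boundary_ι_one_comp_boundaryOneDesc {E : SSet.{v}} (x y : E _⦋0⦌) :
    boundary.ι 1 ≫ boundaryOneDesc x y = yonedaEquiv.symm x := by
  apply yonedaEquiv.injective
  rw [Equiv.apply_symm_apply]
  refine (boundaryOneDesc_app_of_eq_zero x y
    ((boundary.ι 1).app _ (yonedaEquiv (𝟙 Δ[0]))) ?_).trans (const_app_zero _ _)
  rfl

lemma boundary_ι_zero_comp_boundaryOneDesc {E : SSet.{v}} (x y : E _⦋0⦌) :
    boundary.ι 0 ≫ boundaryOneDesc x y = yonedaEquiv.symm y := by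
  apply yonedaEquiv.injective
  rw [Equiv.apply_symm_apply]
  refine (boundaryOneDesc_app_of_ne_zero x y
    ((boundary.ι 0).app _ (yonedaEquiv (𝟙 Δ[0]))) ?_).trans (const_app_zero _ _)
  exact one_ne_zero (α := Fin 2)

lemma boundaryOneDesc_comp {E F : SSet.{v}} (x y : E _⦋0⦌) (p : E ⟶ F)
    (h : p.app _ x = p.app _ y) : boundaryOneDesc x y ≫ p = SSet.const (p.app _ y) := by
  ext m s
  have h₁ (z : E _⦋0⦌) : p.app m ((SSet.const (X := ∂Δ[1]) z).app m s) =
    (SSet.const (X := ∂Δ[1]) (p.app _ z)).app m s :=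
    ConcreteCategory.congr_hom (NatTrans.congr_app (SSet.const_comp (X := ∂Δ[1]) z p) m) s
  change p.app m ((boundaryOneDesc x y).app m s) = _
  by_cases hs : stdSimplex.asOrderHom s.1 0 = 0
  · rw [boundaryOneDesc_app_of_eq_zero _ _ _ hs, h₁, h]
    rfl
  · rw [boundaryOneDesc_app_of_ne_zero _ _ _ hs, h₁]
    rfl

open modelCategoryQuillen in
-- By adjunction this is the lifting of the pushout-product of `i` and `m`, which is anodyne,
-- against `Z ⟶ *`.
lemma hasLiftingProperty_pre {A B S T : SSet.{v}} {i : A ⟶ B} (hi : anodyneExtensions i)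
    (m : S ⟶ T) [Mono m] (Z : SSet.{v}) [KanComplex Z] :
    HasLiftingProperty m ((MonoidalClosed.pre i).app Z) := by
  let sq₁₂ := Functor.PushoutObjObj.ofHasPushout (curriedTensor SSet.{v}) i m
  let sq₁₃ := Functor.PullbackObjObj.ofIsTerminal
    MonoidalClosed.internalHom i (terminal.from Z) terminalIsTerminal
  refine (MonoidalClosed.internalHomAdjunction₂.hasLiftingProperty_iff sq₁₂ sq₁₃).1 ?_
  exact anodyneExtensions_pushoutObjObjι' sq₁₂ hi _
    ((HomotopicalAlgebra.fibration_iff _).1 ((isFibrant_iff Z).1 inferInstance))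

/-- Lifting against `∅ ⟶ F` gives a section of `p`. Lifting against `∂Δ[1] ⟶ Δ[1]` joins `x` by an
edge to the value of the section at `p(x)`. -/
lemma mapπ₀_bijective_of_rlp {E F : SSet.{v}} (p : E ⟶ F)
    (hp : ∀ {S T : SSet.{v}} (m : S ⟶ T) [Mono m], HasLiftingProperty m p) :
    Function.Bijective (mapπ₀ p) := by
  have := hp (initial.to F)
  have sq : CommSq (initial.to E) (initial.to F) p (𝟙 F) := ⟨initial.hom_ext _ _⟩
  have hs (y : π₀ F) : mapπ₀ p (mapπ₀ sq.lift y) = y := by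
    rw [← mapπ₀_comp_apply, sq.fac_right, mapπ₀_id_apply]
  have hs' (x : E _⦋0⦌) : p.app _ (sq.lift.app _ (p.app _ x)) = p.app _ x :=
    ConcreteCategory.congr_hom (NatTrans.congr_app sq.fac_right _) _
  have hp' (x : π₀ E) : mapπ₀ sq.lift (mapπ₀ p x) = x := by
    induction x with | mk x
    have := hp (∂Δ[1] : (Δ[1] : SSet.{v}).Subcomplex).ι
    have sq' : CommSq (boundaryOneDesc (sq.lift.app _ (p.app _ x)) x)
      (∂Δ[1] : (Δ[1] : SSet.{v}).Subcomplex).ι p (SSet.const (p.app _ x)) :=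
      ⟨boundaryOneDesc_comp _ _ _ (hs' x)⟩
    refine π₀.sound (Edge.mk (yonedaEquiv sq'.lift) ?_ ?_)
    · rw [← stdSimplex.yonedaEquiv_δ_comp, ← boundary.ι_ι, Category.assoc, sq'.fac_left,
        boundary_ι_one_comp_boundaryOneDesc, Equiv.apply_symm_apply]
    · rw [← stdSimplex.yonedaEquiv_δ_comp, ← boundary.ι_ι, Category.assoc, sq'.fac_left,
        boundary_ι_zero_comp_boundaryOneDesc, Equiv.apply_symm_apply]
  exact ⟨Function.LeftInverse.injective hp', Function.RightInverse.surjective hs⟩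

lemma isWeakHomotopyEquivalence_of_anodyne {A B : SSet.{v}} {i : A ⟶ B}
    (hi : anodyneExtensions i) : IsWeakHomotopyEquivalence i := fun Z _ ↦
  mapπ₀_bijective_of_rlp _ fun m _ ↦ hasLiftingProperty_pre hi m Z

/-- The inclusion of a vertex in the interval. -/
abbrev vertexι (i : Fin 2) : (Δ[0] : SSet.{v}) ⟶ Δ[1] := SSet.const (stdSimplex.obj₀Equiv.symm i)

lemma vertexι_eq_δ (i j : Fin 2) (hij : i ≠ j) : vertexι.{v} i = stdSimplex.δ j := by
  apply yonedaEquiv.injective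
  apply stdSimplex.obj₀Equiv.injective
  fin_cases i <;> fin_cases j
  · exact (hij rfl).elim
  · rfl
  · rfl
  · exact (hij rfl).elim

instance (i : Fin 2) : Mono (vertexι.{v} i) := by
  obtain ⟨j, hij⟩ := exists_ne i
  rw [vertexι_eq_δ i j hij.symm]
  infer_instance

open modelCategoryQuillen in
-- Vertex inclusions are the horn inclusions of dimension one, where the compatibility of faces is
-- vacuous.
lemma anodyneExtensions_vertexι (i : Fin 2) : anodyneExtensions (vertexι.{v} i) := by
  intro E F p hp
  have : Fibration p := ⟨hp⟩
  refine ⟨fun {a b} sq ↦ ?_⟩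
  obtain ⟨j, hij⟩ := exists_ne i
  have hk (k : Fin 2) (hk : k ≠ i) : stdSimplex.δ k = vertexι.{v} i :=
    (vertexι_eq_δ i k hk.symm).symm
  obtain ⟨l, h₁, h₂⟩ := horn.IsCompatible.exists_lift (n := 0) (i := i) (f := fun _ _ ↦ a) trivial
    p b (fun k h ↦ by rw [hk k h]; exact sq.w)
  exact ⟨⟨⟨l, by rw [← hk j hij]; exact h₁ j hij, h₂⟩⟩⟩

lemma isWeakHomotopyEquivalence_vertexι (i : Fin 2) : IsWeakHomotopyEquivalence (vertexι.{v} i) :=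
  isWeakHomotopyEquivalence_of_anodyne (anodyneExtensions_vertexι i)

lemma anodyneExtensions_ι₀ (K : SSet.{v}) : anodyneExtensions (ι₀ (X := K)) := by
  let e : K ≅ K ⊗ Δ[0] :=
    { hom := CartesianMonoidalCategory.lift (𝟙 K) (SSet.const (stdSimplex.obj₀Equiv.symm 0))
      inv := SemiCartesianMonoidalCategory.fst K Δ[0]
      inv_hom_id := by
        ext n ⟨x, y⟩
        rfl }
  have := e.isIso_hom
  have h : ι₀ (X := K) = e.hom ≫ K ◁ vertexι 0 := rfl
  rw [h]
  exact (MorphismProperty.cancel_left_of_respectsIso anodyneExtensions e.hom (K ◁ vertexι 0)).2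
    ((anodyneExtensions_vertexι 0).whiskerLeft K)

/-- The mapping cylinder of a map of simplicial sets. -/
def mappingCylinder {K L : SSet.{v}} (f : K ⟶ L) : SSet.{v} := pushout (ι₀ (X := K)) f

namespace mappingCylinder

variable {K L : SSet.{v}} (f : K ⟶ L)

/-- The map from the cylinder on the source to the mapping cylinder. -/
def inl : K ⊗ Δ[1] ⟶ mappingCylinder f := pushout.inl _ _

/-- The inclusion of the target in the mapping cylinder. -/
def inr : L ⟶ mappingCylinder f := pushout.inr _ _

lemma isPushout : IsPushout ι₀ f (inl f) (inr f) := IsPushout.of_hasPushout _ _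

/-- The inclusion of the source in the mapping cylinder. -/
def ι : K ⟶ mappingCylinder f := ι₁ ≫ inl f

variable {f} in
-- The projection of the cylinder to `L` is a retraction of `inr f`, which is anodyne as a pushout
-- of `ι₀`; its composite with `ι f` is `f`. Apply two-out-of-three twice.
lemma isWeakHomotopyEquivalence_ι (hf : IsWeakHomotopyEquivalence f) :
    IsWeakHomotopyEquivalence (ι f) := by
  let r : mappingCylinder f ⟶ L :=
    (isPushout f).desc (SemiCartesianMonoidalCategory.fst K Δ[1] ≫ f) (𝟙 L) (by
      rw [Category.comp_id]; rfl)
  have h₁ : inr f ≫ r = 𝟙 L := (isPushout f).inr_desc _ _ _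
  have h₂ : ι f ≫ r = f := by
    rw [ι, Category.assoc, (isPushout f).inl_desc]
    rfl
  have h₃ : IsWeakHomotopyEquivalence (inr f) := by
    refine isWeakHomotopyEquivalence_of_anodyne ?_
    exact MorphismProperty.of_isPushout (P := anodyneExtensions) (isPushout f).flip
      (anodyneExtensions_ι₀ K)
  refine (h₃.of_precomp (g := r) ?_).of_postcomp ?_
  · rw [h₁]
    exact .id L
  · rwa [h₂]

instance : Mono (ι f) := by
  rw [NatTrans.mono_iff_mono_app]
  intro m
  rw [CategoryTheory.mono_iff_injective]
  have h := (isPushout f).map ((CategoryTheory.evaluation _ _).obj m)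
  -- In each degree, a partial inverse of `ι f` on the pushout: the end `0`, where `L` is glued,
  -- goes to `none`, and all other simplices remember their component in `K`.
  let g₁ : (K ⊗ Δ[1]).obj m ⟶ Option (K.obj m) :=
    ↾fun x ↦ if x.2 = stdSimplex.const 1 0 m then none else some x.1
  let g₂ : L.obj m ⟶ Option (K.obj m) := ↾fun _ ↦ none
  have hg : ((CategoryTheory.evaluation _ _).obj m).map (ι₀ (X := K)) ≫ g₁ =
      ((CategoryTheory.evaluation _ _).obj m).map f ≫ g₂ := by
    exact ConcreteCategory.hom_ext _ _ fun x ↦ if_pos rfl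
  have hx (x : K.obj m) : h.desc g₁ g₂ hg ((ι f).app m x) = some x := by
    refine (ConcreteCategory.congr_hom (h.inl_desc g₁ g₂ hg) ((ι₁ (X := K)).app m x)).trans ?_
    refine if_neg fun H ↦ ?_
    exact one_ne_zero (α := Fin 2) (DFunLike.congr_fun (congrArg stdSimplex.asOrderHom H) 0)
  intro x y hxy
  have := (hx x).symm.trans ((congrArg _ hxy).trans (hx y))
  simpa using this

end mappingCylinder

end WeakHomotopyEquivalences

/-! ### Weak homotopy equivalences on unions of components -/

section Components

open Limits SSet Opposite

/-- The discrete simplicial set with two vertices. -/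
def discreteBool : SSet.{v} := (Functor.const _).obj (ULift.{v} Bool)

/-- All simplices of `Δ[n]` come from the fundamental one, and simplicial operators act on
`discreteBool` as the identity. -/
lemma discreteBool_app_eq {n : ℕ} (f : (Δ[n] : SSet.{v}) ⟶ discreteBool) {m m' : SimplexCategoryᵒᵖ}
    (x : (Δ[n] : SSet.{v}).obj m) (x' : (Δ[n] : SSet.{v}).obj m') :
    (f.app m x : ULift.{v} Bool) = f.app m' x' := by
  have key {m : SimplexCategoryᵒᵖ} (x : (Δ[n] : SSet.{v}).obj m) :
      (f.app m x : ULift.{v} Bool) = yonedaEquiv f := by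
    have hx : x = (Δ[n] : SSet.{v}).map (stdSimplex.objEquiv x).op (yonedaEquiv (𝟙 _)) :=
      stdSimplex.objEquiv.injective (Category.comp_id _).symm
    exact (congrArg (f.app m) hx).trans (NatTrans.naturality_apply f _ _)
  exact (key x).trans (key x').symm

instance : KanComplex discreteBool.{v} := by
  rw [KanComplex.iff]
  intro n i f hf
  obtain ⟨j₀, hj₀⟩ := exists_ne i
  have ext {n : ℕ} (g g' : (Δ[n] : SSet.{v}) ⟶ discreteBool) {m : SimplexCategoryᵒᵖ}
      (x x' : (Δ[n] : SSet.{v}).obj m) (h : g.app m x = g'.app m x') : g = g' := by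
    ext m' y
    exact (discreteBool_app_eq g y x).trans (h.trans (discreteBool_app_eq g' x' y))
  refine ⟨SSet.const (yonedaEquiv (f j₀ hj₀) : ULift.{v} Bool), fun j hj ↦ ?_⟩
  -- A horn of dimension one has a single face; in higher dimensions any two faces meet, so all of
  -- them carry the same constant.
  cases n with
  | zero =>
    obtain rfl : j = j₀ := by omega
    exact ext _ _ (yonedaEquiv (𝟙 _)) (yonedaEquiv (𝟙 _)) rfl
  | succ n =>
    have hlt (j k : Fin (n + 3)) (hj : j ≠ i) (hk : k ≠ i) (hjk : j < k) : f j hj = f k hk := by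
      have h : stdSimplex.δ _ ≫ f j hj = stdSimplex.δ _ ≫ f k hk := hf j k hj hk hjk
      have h' := congrArg (fun g ↦ yonedaEquiv g) h
      exact ext _ _ _ _ h'
    have heq : f j hj = f j₀ hj₀ := by
      rcases lt_trichotomy j j₀ with h | rfl | h
      · exact hlt _ _ _ _ h
      · rfl
      · exact (hlt _ _ _ _ h).symm
    rw [heq]
    exact ext _ _ (yonedaEquiv (𝟙 _)) (yonedaEquiv (𝟙 _)) rfl

lemma discreteBool_eq_of_π₀_mk_eq {x y : discreteBool.{v} _⦋0⦌} (h : π₀.mk x = π₀.mk y) :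
    x = y := by
  have := congrArg (π₀.lift (fun x : discreteBool.{v} _⦋0⦌ ↦ x)
    (fun x y e ↦ e.src_eq.symm.trans e.tgt_eq)) h
  exact this

/-- The vertex of the mapping space given by a map. -/
def ihomVertex {X Z : SSet.{v}} (g : X ⟶ Z) : 𝟙_ SSet.{v} ⟶ (ihom X).obj Z :=
  MonoidalClosed.curry ((ρ_ X).hom ≫ g)

lemma ihomVertex_comp_pre {X Y Z : SSet.{v}} (f : X ⟶ Y) (g : Y ⟶ Z) :
    ihomVertex g ≫ (MonoidalClosed.pre f).app Z = ihomVertex (f ≫ g) := by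
  rw [ihomVertex, ihomVertex, MonoidalClosed.curry_pre_app]
  simp

/-- A map to a discrete simplicial set is constant if it is so after composition with a weak
homotopy equivalence. -/
lemma IsWeakHomotopyEquivalence.app_eq_of_comp_eq {X Y : SSet.{v}} {f : X ⟶ Y}
    (hf : IsWeakHomotopyEquivalence f) (c : Y ⟶ discreteBool) (c₀ : ULift.{v} Bool) 
    (hc : ∀ (n : SimplexCategoryᵒᵖ) (x : X.obj n), c.app n (f.app n x) = c₀)
    (y : Y _⦋0⦌) : c.app _ y = c₀ := by
  let c' : Y ⟶ discreteBool := SSet.const c₀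
  have h : f ≫ c = f ≫ c' := by ext n x; exact hc n x
  have hcc : π₀.mk ((ihomVertex c).app (op ⦋0⦌) PUnit.unit) =
      π₀.mk ((ihomVertex c').app (op ⦋0⦌) PUnit.unit) := by
    refine (hf discreteBool).1 ?_
    have h₁ := congrArg (fun φ ↦ π₀.mk (φ.app (op ⦋0⦌) PUnit.unit)) (ihomVertex_comp_pre f c)
    have h₂ := congrArg (fun φ ↦ π₀.mk (φ.app (op ⦋0⦌) PUnit.unit)) (ihomVertex_comp_pre f c')
    rw [← h] at h₂
    exact h₁.trans h₂.symm
  -- Evaluation at `y` turns the equality of components of `c` and of the constant map into an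
  -- equality of values.
  let e : (ihom Y).obj discreteBool ⟶ discreteBool :=
    CartesianMonoidalCategory.lift (SSet.const y) (𝟙 _) ≫ (ihom.ev Y).app _
  have he (g : Y ⟶ discreteBool) :
      e.app _ ((ihomVertex g).app (op ⦋0⦌) PUnit.unit) = g.app _ y := by
    have : ihomVertex g ≫ e = CartesianMonoidalCategory.lift (SSet.const y) (𝟙 _) ≫
        Y ◁ ihomVertex g ≫ (ihom.ev Y).app _ := by rfl
    rw [ihomVertex, ← MonoidalClosed.uncurry_eq, MonoidalClosed.uncurry_curry] at this
    refine (ConcreteCategory.congr_hom (NatTrans.congr_app this (op ⦋0⦌)) PUnit.unit).trans ?_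
    exact congrArg (g.app _) (const_app_zero (X := 𝟙_ _) y PUnit.unit)
  refine (he c).symm.trans (Eq.trans (discreteBool_eq_of_π₀_mk_eq ?_) (he c'))
  exact congrArg (mapπ₀ e) hcc

/-- A subcomplex whose complement is a subcomplex. -/
def IsClopen {X : SSet.{v}} (A : X.Subcomplex) : Prop :=
  ∀ {n m : SimplexCategoryᵒᵖ} (θ : n ⟶ m) (x : X.obj n), X.map θ x ∈ A.obj m → x ∈ A.obj n

open Classical in
/-- The retraction onto a nonempty clopen subcomplex. -/
def IsClopen.retraction {X : SSet.{v}} {A : X.Subcomplex} (hA : IsClopen A)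
    (a : (A : SSet.{v}) _⦋0⦌) : X ⟶ A where
  app n := ↾fun x ↦ if hx : x ∈ A.obj n then ⟨x, hx⟩ else (SSet.const (X := X) a).app n x
  naturality n m θ := by
    refine ConcreteCategory.hom_ext _ _ fun x ↦ ?_
    by_cases hx : x ∈ A.obj n
    · refine (dif_pos (A.map θ hx)).trans (Eq.symm ?_)
      exact congrArg ((A : SSet.{v}).map θ) (dif_pos hx)
    · refine (dif_neg (fun h ↦ hx (hA θ x h))).trans (Eq.symm ?_)
      exact (congrArg ((A : SSet.{v}).map θ) (dif_neg hx)).trans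
        (NatTrans.naturality_apply (SSet.const (X := X) a) θ x).symm

lemma IsClopen.retraction_app_of_mem {X : SSet.{v}} {A : X.Subcomplex} (hA : IsClopen A)
    (a : (A : SSet.{v}) _⦋0⦌) {n} {x : X.obj n} (hx : x ∈ A.obj n) :
    (hA.retraction a).app n x = ⟨x, hx⟩ := dif_pos hx

lemma IsClopen.retraction_app_of_notMem {X : SSet.{v}} {A : X.Subcomplex} (hA : IsClopen A)
    (a : (A : SSet.{v}) _⦋0⦌) {n} {x : X.obj n} (hx : x ∉ A.obj n) :
    (hA.retraction a).app n x = (SSet.const (X := X) a).app n x := dif_neg hx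

lemma IsClopen.ι_retraction {X : SSet.{v}} {A : X.Subcomplex} (hA : IsClopen A)
    (a : (A : SSet.{v}) _⦋0⦌) : A.ι ≫ hA.retraction a = 𝟙 _ := by
  refine NatTrans.ext (funext fun n ↦ ConcreteCategory.hom_ext _ _ fun x ↦ ?_)
  exact hA.retraction_app_of_mem a x.2

open Classical in
/-- The restriction of a weak homotopy equivalence to the preimage of a clopen subcomplex. -/
lemma IsWeakHomotopyEquivalence.of_isClopen {X Y : SSet.{v}} {f : X ⟶ Y}
    (hf : IsWeakHomotopyEquivalence f) {A : X.Subcomplex} {B : Y.Subcomplex}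
    (hA : IsClopen A) (hB : IsClopen B)
    (hAB : ∀ {n} (x : X.obj n), f.app n x ∈ B.obj n → x ∈ A.obj n)
    (g : (A : SSet.{v}) ⟶ B) (hg : g ≫ B.ι = A.ι ≫ f) : IsWeakHomotopyEquivalence g := by
  have hg₁ {n} (x : X.obj n) (hx : x ∈ A.obj n) : (g.app n ⟨x, hx⟩).1 = f.app n x := by
    have := ConcreteCategory.congr_hom (NatTrans.congr_app hg n) ⟨x, hx⟩
    exact this
  have hAB' {n} (x : X.obj n) (hx : x ∈ A.obj n) : f.app n x ∈ B.obj n := by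
    have := (g.app n ⟨x, hx⟩).2
    rwa [hg₁] at this
  have hg' {n} (x : X.obj n) (hx : x ∈ A.obj n) (h) : g.app n ⟨x, hx⟩ = ⟨f.app n x, h⟩ :=
    Subtype.ext (hg₁ x hx)
  by_cases h : Nonempty ((A : SSet.{v}) _⦋0⦌)
  · obtain ⟨a⟩ := h
    -- Sending the complements of `A` and `B` to the vertices `a` and `g(a)` exhibits `g` as a
    -- retract of `f`; the hypothesis `hAB` makes the retractions compatible.
    refine hf.of_retract A.ι B.ι (hA.retraction a) (hB.retraction (g.app _ a)) (hA.ι_retraction a)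
      (hB.ι_retraction _) hg.symm ?_
    refine NatTrans.ext (funext fun n ↦ ConcreteCategory.hom_ext _ _ fun x ↦ ?_)
    change g.app n ((hA.retraction a).app n x) = (hB.retraction (g.app _ a)).app n (f.app n x)
    by_cases hx : x ∈ A.obj n
    · rw [hA.retraction_app_of_mem a hx, hB.retraction_app_of_mem _ (hAB' x hx)]
      exact hg' _ _ _
    · rw [hA.retraction_app_of_notMem a hx, hB.retraction_app_of_notMem _ (fun h ↦ hx (hAB x h))]
      exact ConcreteCategory.congr_hom (NatTrans.congr_app (SSet.const_comp (X := X) a g) n) x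
  -- When `A` is empty there is no vertex to retract to, and `B` must be shown empty: its
  -- characteristic map `c` is constant after composition with `f`, hence constant on vertices.
  · let c : Y ⟶ discreteBool :=
      { app n := ↾fun y ↦ ULift.up (decide (y ∈ B.obj n))
        naturality n m θ := by
          refine ConcreteCategory.hom_ext _ _ fun y ↦ ?_
          exact congrArg ULift.up (decide_eq_decide.2 ⟨hB θ y, fun h ↦ B.map θ h⟩) }
    have hA' {n} (x : X.obj n) : x ∉ A.obj n := fun hx ↦
      h ⟨(A : SSet.{v}).map (SimplexCategory.const ⦋0⦌ n.unop 0).op ⟨x, hx⟩⟩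
    have hB' (y : Y _⦋0⦌) : y ∉ B.obj _ := by
      have := hf.app_eq_of_comp_eq c ⟨false⟩ (fun n x ↦ congrArg ULift.up
        (decide_eq_false fun h ↦ hA' x (hAB x h))) y
      exact of_decide_eq_false (congrArg ULift.down this)
    have hB'' {n} (y : Y.obj n) : y ∉ B.obj n := fun hy ↦
      hB' _ (B.map (SimplexCategory.const ⦋0⦌ n.unop 0).op hy)
    let r : (B : SSet.{v}) ⟶ A :=
      { app n := ↾fun y ↦ (hB'' y.1 y.2).elim
        naturality n m θ := ConcreteCategory.hom_ext _ _ fun y ↦ (hB'' y.1 y.2).elim }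
    have h₁ : g ≫ r = 𝟙 _ := NatTrans.ext (funext fun n ↦ ConcreteCategory.hom_ext _ _ fun x ↦
      (hA' x.1 x.2).elim)
    have h₂ : r ≫ g = 𝟙 _ := NatTrans.ext (funext fun n ↦ ConcreteCategory.hom_ext _ _ fun x ↦
      (hB'' x.1 x.2).elim)
    exact (IsWeakHomotopyEquivalence.id _).of_retract (𝟙 _) r (𝟙 _) g (Category.id_comp _) h₂
      (by rw [h₁]; rfl) rfl

variable {I : Type u'} [Category.{v} I] {J : Type u} [Category.{v} J] [SimplicialCategory J]
  {J' : Type u} [Category.{v} J'] [SimplicialCategory J'] (φ : FunctorToOrdinary J I)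

lemma FunctorToOrdinary.isClopen_mapOver {j k : J} (α : φ.obj j ⟶ φ.obj k) :
    IsClopen (φ.mapOver α) := fun θ x hx ↦ (φ.map_simplicial θ x).symm.trans hx

/-- The mapping spaces of `I` are discrete, so the subcomplexes over `α` are clopen and correspond
under `ψ`. -/
lemma FunctorToOrdinary.isWeakHomotopyEquivalence_precompOver (φ' : FunctorToOrdinary J' I)
    {ψ : EnrichedFunctor SSet.{v} J J'} {j k : J} (h : IsWeakHomotopyEquivalence (ψ.map j k))
    (α : φ'.obj (ψ.obj j) ⟶ φ'.obj (ψ.obj k)) :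
    IsWeakHomotopyEquivalence (φ'.precompOver ψ α) :=
  h.of_isClopen (FunctorToOrdinary.isClopen_mapOver (φ'.precomp ψ) α) (φ'.isClopen_mapOver α)
    (fun _ hx ↦ hx) _ rfl

end Components

/-! ### Homotopies in simplicial categories -/

section Homotopies

open Limits SSet Opposite

variable {C : Type u} [Category.{v} C] [SimplicialCategory C]
  {D : Type u'} [Category.{v} D] [SimplicialCategory D]

lemma yonedaEquiv_const {Y : SSet.{v}} (y : Y _⦋0⦌) :
    SSet.yonedaEquiv (SSet.const (X := Δ[0]) y) = y :=
  const_app_zero y (SSet.yonedaEquiv (𝟙 Δ[0]))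

namespace WeaklyHomotopic

lemma refl {X Y : C} (f : X ⟶ Y) : WeaklyHomotopic f f := rfl

lemma symm {X Y : C} {f g : X ⟶ Y} (h : WeaklyHomotopic f g) : WeaklyHomotopic g f := Eq.symm h

lemma trans {X Y : C} {f g k : X ⟶ Y} (h : WeaklyHomotopic f g) (h' : WeaklyHomotopic g k) :
    WeaklyHomotopic f k := Eq.trans h h'

lemma comp_left {X Y Z : C} (k : X ⟶ Y) {f g : Y ⟶ Z} (h : WeaklyHomotopic f g) :
    WeaklyHomotopic (k ≫ f) (k ≫ g) := by
  have key (f : Y ⟶ Z) : mapπ₀ (eHomWhiskerRight SSet.{v} k Z) (π₀.mk (homEquiv' Y Z f)) =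
      π₀.mk (homEquiv' X Z (k ≫ f)) := congrArg π₀.mk (deg_comp (op ⦋0⦌) k f).symm
  exact (key f).symm.trans ((congrArg _ h).trans (key g))

lemma map (F : EnrichedFunctor SSet.{v} C D) {X Y : C} {f g : X ⟶ Y} (h : WeaklyHomotopic f g) :
    WeaklyHomotopic ((underlying F).map f) ((underlying F).map g) := by
  have key (f : X ⟶ Y) : mapπ₀ (F.map X Y) (π₀.mk (homEquiv' X Y f)) =
      π₀.mk (homEquiv' _ _ ((underlying F).map f)) :=
    congrArg π₀.mk (enrichedFunctor_map_deg F f)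
  exact (key f).symm.trans ((congrArg _ h).trans (key g))

end WeaklyHomotopic

/-- The source (`i = 0`) and the target (`i = 1`) of a homotopy. -/
def endpoint {X Y : C} (h : (Δ[1] : SSet.{v}) ⟶ sHom X Y) (i : Fin 2) : X ⟶ Y :=
  (homEquiv' X Y).symm (h.app (op ⦋0⦌) (stdSimplex.obj₀Equiv.symm i))

lemma deg_zero_endpoint {X Y : C} (h : (Δ[1] : SSet.{v}) ⟶ sHom X Y) (i : Fin 2) :
    deg (op ⦋0⦌) (endpoint h i) = h.app (op ⦋0⦌) (stdSimplex.obj₀Equiv.symm i) :=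
  (homEquiv' X Y).apply_symm_apply _

lemma deg_endpoint {X Y : C} (h : (Δ[1] : SSet.{v}) ⟶ sHom X Y) (i : Fin 2)
    (n : SimplexCategoryᵒᵖ) : deg n (endpoint h i) = h.app n (stdSimplex.const 1 i n) := by
  rw [← map_deg (SimplexCategory.const n.unop ⦋0⦌ 0).op, deg_zero_endpoint,
    ← NatTrans.naturality_apply]
  rfl

lemma vertexι_comp {X Y : C} (h : (Δ[1] : SSet.{v}) ⟶ sHom X Y) (i : Fin 2) :
    vertexι i ≫ h = SSet.const (deg (op ⦋0⦌) (endpoint h i)) := by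
  rw [deg_zero_endpoint]
  exact SSet.const_comp _ _

lemma endpoint_eq_of_vertexι_comp {X Y : C} {h : (Δ[1] : SSet.{v}) ⟶ sHom X Y} {i : Fin 2}
    {f : X ⟶ Y} (hf : vertexι i ≫ h = SSet.const (deg (op ⦋0⦌) f)) : endpoint h i = f := by
  refine deg_zero_injective ?_
  rw [vertexι_comp] at hf
  rw [← yonedaEquiv_const (deg _ (endpoint h i)), hf, yonedaEquiv_const]

lemma endpoint_comp_eHomWhiskerLeft {X Y Z : C} (h : (Δ[1] : SSet.{v}) ⟶ sHom X Y) (g : Y ⟶ Z)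
    (i : Fin 2) : endpoint (h ≫ eHomWhiskerLeft SSet.{v} X g) i = endpoint h i ≫ g := by
  refine deg_zero_injective ?_
  rw [deg_zero_endpoint, deg_comp, deg_zero_endpoint]
  rfl

lemma endpoint_comp_eHomWhiskerRight {X Y Z : C} (g : X ⟶ Y) (h : (Δ[1] : SSet.{v}) ⟶ sHom Y Z)
    (i : Fin 2) : endpoint (h ≫ eHomWhiskerRight SSet.{v} g Z) i = g ≫ endpoint h i := by
  refine deg_zero_injective ?_
  rw [deg_zero_endpoint, deg_comp, deg_zero_endpoint]
  rfl

lemma const_comp_eHomWhiskerLeft {K : SSet.{v}} {X Y Z : C} (f : X ⟶ Y) (g : Y ⟶ Z) :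
    SSet.const (X := K) (deg (op ⦋0⦌) f) ≫ eHomWhiskerLeft SSet.{v} X g =
      SSet.const (deg (op ⦋0⦌) (f ≫ g)) := by
  rw [SSet.const_comp, deg_comp]
  rfl

lemma weaklyHomotopic_endpoint {X Y : C} (h : (Δ[1] : SSet.{v}) ⟶ sHom X Y) :
    WeaklyHomotopic (endpoint h 0) (endpoint h 1) := by
  refine π₀.sound (Edge.mk (yonedaEquiv h) ?_ ?_)
  · rw [← stdSimplex.yonedaEquiv_δ_comp, ← vertexι_eq_δ 0 1 zero_ne_one, vertexι_comp,
      yonedaEquiv_const]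
    rfl
  · rw [← stdSimplex.yonedaEquiv_δ_comp, ← vertexι_eq_δ 1 0 one_ne_zero, vertexι_comp,
      yonedaEquiv_const]
    rfl

/-- A property of morphisms which is invariant under homotopies is invariant under the relation
of lying in the same component. -/
lemma WeaklyHomotopic.iff_of_endpoint {X Y : C} {f g : X ⟶ Y} (hfg : WeaklyHomotopic f g)
    (P : (X ⟶ Y) → Prop)
    (hP : ∀ h : (Δ[1] : SSet.{v}) ⟶ sHom X Y, P (endpoint h 0) ↔ P (endpoint h 1)) : P f ↔ P g := by
  -- Invariance under edges lets `P` descend to a proposition-valued function on `π₀`, which handles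
  -- arbitrary zigzags at once.
  have := congrArg (π₀.lift (fun x ↦ P ((homEquiv' X Y).symm x)) (fun x₀ x₁ e ↦ propext (by
    have h := hP (yonedaEquiv.symm e.edge)
    have h₀ : endpoint (yonedaEquiv.symm e.edge) 0 = (homEquiv' X Y).symm x₀ := by
      refine endpoint_eq_of_vertexι_comp ?_
      rw [vertexι_eq_δ 0 1 zero_ne_one]
      apply SSet.yonedaEquiv.injective
      rw [stdSimplex.yonedaEquiv_δ_comp, Equiv.apply_symm_apply, e.src_eq, deg_zero_eq_homEquiv',
        Equiv.apply_symm_apply, yonedaEquiv_const]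
    have h₁ : endpoint (yonedaEquiv.symm e.edge) 1 = (homEquiv' X Y).symm x₁ := by
      refine endpoint_eq_of_vertexι_comp ?_
      rw [vertexι_eq_δ 1 0 one_ne_zero]
      apply SSet.yonedaEquiv.injective
      rw [stdSimplex.yonedaEquiv_δ_comp, Equiv.apply_symm_apply, e.tgt_eq, deg_zero_eq_homEquiv',
        Equiv.apply_symm_apply, yonedaEquiv_const]
    rwa [h₀, h₁] at h))) hfg
  rw [π₀.lift_mk, π₀.lift_mk, Equiv.symm_apply_apply, Equiv.symm_apply_apply] at this
  exact iff_of_eq this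

end Homotopies

/-! ### Homotopies in simplicial model categories -/

section CylinderObjects

open Limits SSet Opposite

variable {C : Type u} [Category.{v} C] [SimplicialCategory C]

/-- The end inclusions of the cylinder `Δ[1] ⊗ X`. -/
def SimplicialTensor.cylι (T : SimplicialTensor C) (X : C) (i : Fin 2) :
    X ⟶ (T.tensor.obj Δ[1]).obj X := endpoint (T.unit Δ[1] X) i

lemma SimplicialTensor.cylι_comp (T : SimplicialTensor C) {X Y : C}
    (f : (T.tensor.obj Δ[1]).obj X ⟶ Y) (i : Fin 2) :
    T.cylι X i ≫ f = endpoint (T.homEquiv _ _ _ f) i :=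
  (endpoint_comp_eHomWhiskerLeft _ _ _).symm

lemma SimplicialTensor.endpoint_eq (T : SimplicialTensor C) {X Y : C}
    (h : Δ[1] ⟶ sHom X Y) (i : Fin 2) :
    endpoint h i = T.cylι X i ≫ (T.homEquiv _ _ _).symm h := by
  rw [T.cylι_comp, Equiv.apply_symm_apply]

lemma IsCotensored.fromHom_initial_ext (hC : IsCotensored C) {A : C} (hA : IsInitial A)
    {L : SSet.{v}} {Y : C} (g g' : L ⟶ sHom A Y) : g = g' := by
  obtain ⟨P, ε, -, hε⟩ := hC.exists_cotensor L Y
  obtain ⟨f, rfl⟩ := (hε A).2 g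
  obtain ⟨f', rfl⟩ := (hε A).2 g'
  rw [hA.hom_ext f f']

variable [ModelCategory C]

namespace IsSimplicialModelCategory

/-- Homotopies from a cofibrant object lift along fibrations. -/
lemma exists_homotopy_lift (hC : IsSimplicialModelCategory C)
    {X E D : C} [IsCofibrant X] (p : E ⟶ D) [Fibration p] (i : Fin 2)
    (h : (Δ[1] : SSet.{v}) ⟶ sHom X D) (f : X ⟶ E) (hf : f ≫ p = endpoint h i) :
    ∃ h' : (Δ[1] : SSet.{v}) ⟶ sHom X E, endpoint h' i = f ∧
      h' ≫ eHomWhiskerLeft SSet.{v} X p = h := by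
  obtain ⟨z, hz₁, -, hz₂⟩ := hC.exists_sHom_lift (vertexι i) (initial.to X) p
    (.inl (isWeakHomotopyEquivalence_vertexι i)) (SSet.const (deg (op ⦋0⦌) f))
    (SSet.const (deg (op ⦋0⦌) (initial.to E))) h
    (hC.1.fromHom_initial_ext initialIsInitial _ _)
    (by rw [const_comp_eHomWhiskerLeft, vertexι_comp, hf])
    (hC.1.fromHom_initial_ext initialIsInitial _ _)
  exact ⟨z, endpoint_eq_of_vertexι_comp hz₁, hz₂⟩

/-- A lifting problem of an end inclusion against a fibration is a homotopy lifting problem. -/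
lemma trivialCofibrations_cylι (hC : IsSimplicialModelCategory C)
    (T : SimplicialTensor C) (X : C) [IsCofibrant X] (i : Fin 2) :
    trivialCofibrations C (T.cylι X i) := by
  rw [← fibrations_llp]
  intro E D p hp
  have : Fibration p := ⟨hp⟩
  refine ⟨fun {a c} sq ↦ ?_⟩
  obtain ⟨z, hz₁, hz₂⟩ := hC.exists_homotopy_lift p i (T.homEquiv _ _ _ c) a
    (by rw [sq.w, T.cylι_comp])
  refine ⟨⟨⟨(T.homEquiv _ _ _).symm z, ?_, ?_⟩⟩⟩
  · rw [← T.endpoint_eq, hz₁]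
  · apply (T.homEquiv _ _ _).injective
    rw [T.homEquiv_comp, Equiv.apply_symm_apply, hz₂]

/-- After precomposition with a cofibrant replacement, both ends of a homotopy are composites of one
map from the cylinder with end inclusions, and the latter are weak equivalences. -/
lemma weakEquivalence_iff_of_weaklyHomotopic (hC : IsSimplicialModelCategory C)
    {X Y : C} {f g : X ⟶ Y} (h : WeaklyHomotopic f g) :
    WeakEquivalence f ↔ WeakEquivalence g := by
  obtain ⟨-, T, -⟩ := id hC
  obtain ⟨X', q, hX', hq⟩ : ∃ (X' : C) (q : X' ⟶ X), IsCofibrant X' ∧ WeakEquivalence q := by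
    let d := MorphismProperty.factorizationData (cofibrations C) (trivialFibrations C) (initial.to X)
    refine ⟨d.Z, d.p, (isCofibrant_iff_of_isInitial d.i initialIsInitial).2 ⟨d.hi⟩, ?_⟩
    exact ⟨d.hp.2⟩
  refine h.iff_of_endpoint (fun f ↦ WeakEquivalence f) fun h ↦ ?_
  rw [← weakEquivalence_precomp_iff q, ← weakEquivalence_precomp_iff q (endpoint h 1),
    ← endpoint_comp_eHomWhiskerRight, ← endpoint_comp_eHomWhiskerRight, T.endpoint_eq,
    T.endpoint_eq]
  have h₀ : WeakEquivalence (T.cylι X' 0) := ⟨(hC.trivialCofibrations_cylι T X' 0).2⟩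
  have h₁ : WeakEquivalence (T.cylι X' 1) := ⟨(hC.trivialCofibrations_cylι T X' 1).2⟩
  rw [weakEquivalence_precomp_iff, weakEquivalence_precomp_iff]

/-- The homotopy lifting property, applied in either direction along each edge of a zigzag. -/
lemma exists_section_of_weaklyHomotopic (hC : IsSimplicialModelCategory C)
    {X E D : C} [IsCofibrant X] (p : E ⟶ D) [Fibration p]
    {f : X ⟶ E} {g : X ⟶ D} (h : WeaklyHomotopic (f ≫ p) g) :
    ∃ f' : X ⟶ E, f' ≫ p = g ∧ WeaklyHomotopic f f' := by
  refine (h.iff_of_endpoint (fun g ↦ ∃ f' : X ⟶ E, f' ≫ p = g ∧ WeaklyHomotopic f f') ?_).1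
    ⟨f, rfl, .refl f⟩
  intro h
  constructor
  · rintro ⟨f', hf', hff'⟩
    obtain ⟨hh, rfl, rfl⟩ := hC.exists_homotopy_lift p 0 h f' hf'
    exact ⟨endpoint hh 1, (endpoint_comp_eHomWhiskerLeft _ _ _).symm,
      hff'.trans (weaklyHomotopic_endpoint hh)⟩
  · rintro ⟨f', hf', hff'⟩
    obtain ⟨hh, rfl, rfl⟩ := hC.exists_homotopy_lift p 1 h f' hf'
    exact ⟨endpoint hh 0, (endpoint_comp_eHomWhiskerLeft _ _ _).symm,
      hff'.trans (weaklyHomotopic_endpoint hh).symm⟩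

/-- A form of the two-out-of-six property. -/
lemma weakEquivalence_of_two_out_of_six (hC : IsSimplicialModelCategory C)
    {U V X Y : C}
    [IsCofibrant V] (u : U ⟶ V) (v : V ⟶ X) (w : X ⟶ Y) (huv : WeakEquivalence (u ≫ v))
    (θ : V ⟶ Y) [IsIso θ] (h : WeaklyHomotopic (v ≫ w) θ) : WeakEquivalence w := by
  let d := MorphismProperty.factorizationData (trivialCofibrations C) (fibrations C) w
  have : Fibration d.p := ⟨d.hp⟩
  have : WeakEquivalence d.i := ⟨d.hi.2⟩
  -- With the fibration `d.p` in place of `w`, the homotopy `v ≫ w ∼ θ` becomes the equality `v' ≫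
  -- d.p = θ`.
  obtain ⟨v', hv', hvv'⟩ := hC.exists_section_of_weaklyHomotopic d.p (f := v ≫ d.i) (g := θ)
    (by rwa [Category.assoc, d.fac])
  have h₁ : WeakEquivalence (u ≫ v') := by
    refine (hC.weakEquivalence_iff_of_weaklyHomotopic (hvv'.comp_left u)).1 ?_
    rw [← Category.assoc]
    infer_instance
  -- This idempotent fixes the weak equivalence `u ≫ v'`, so it is a weak equivalence; `d.p` is a
  -- retract of it.
  have h₂ : WeakEquivalence (d.p ≫ inv θ ≫ v') := by
    rw [← weakEquivalence_precomp_iff (u ≫ v')]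
    have h₃ : (u ≫ v') ≫ d.p ≫ inv θ ≫ v' = u ≫ v' := by
      rw [Category.assoc, ← Category.assoc v', hv', IsIso.hom_inv_id_assoc]
    rwa [h₃]
  have h₃ : WeakEquivalence d.p := by
    refine ⟨MorphismProperty.of_retract (P := weakEquivalences C) (f := d.p)
      (g := d.p ≫ inv θ ≫ v')
      ⟨Arrow.homMk (𝟙 _) (inv θ ≫ v') ?_, Arrow.homMk (𝟙 _) d.p ?_, ?_⟩ h₂.1⟩
    · exact Category.id_comp _
    · simp [hv']
    · ext
      · exact Category.id_comp _
      · simp [hv']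
  rw [← d.fac]
  infer_instance

end IsSimplicialModelCategory

end CylinderObjects

/-! ### Left Quillen functors and cofibrant objects -/

section LeftQuillen

open Limits

variable {C : Type u} [Category.{v} C] [ModelCategory C] {D : Type u'} [Category.{v} D]
  [ModelCategory D] {F : C ⥤ D}

lemma PreservesCofibrations.isCofibrant_obj (hF : PreservesCofibrations F) [F.IsLeftAdjoint]
    (X : C) [IsCofibrant X] : IsCofibrant (F.obj X) :=
  (isCofibrant_iff_of_isInitial (F.map (initial.to X)) (initialIsInitial.isInitialObj F _)).2
    (hF.cofibration _ inferInstance)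

/-- Ken Brown's lemma. -/
lemma PreservesCofibrations.weakEquivalence_map (hF : PreservesCofibrations F) {X Y : C}
    [IsCofibrant X] [IsCofibrant Y] (f : X ⟶ Y) [WeakEquivalence f] :
    WeakEquivalence (F.map f) := by
  let h : CofibrantBrownFactorization f := Classical.arbitrary _
  have : Cofibration h.i := ⟨h.hi⟩
  have h₁ := (hF.trivialCofibration h.i inferInstance inferInstance).2
  have h₂ := (hF.trivialCofibration h.s inferInstance inferInstance).2
  have h₃ : WeakEquivalence (F.map h.p) := by
    have : WeakEquivalence (F.map h.s ≫ F.map h.p) := by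
      rw [← F.map_comp, h.s_p, F.map_id]
      infer_instance
    exact weakEquivalence_of_precomp (F.map h.s) _
  rw [← h.fac, F.map_comp]
  infer_instance

end LeftQuillen

/-! ### Homotopy invertible morphisms act by weak equivalences -/

section ActionOfMorphisms

open Limits Opposite SSet

variable {I : Type u'} [Category.{v} I] {M : SimplicialQuillenPresheaf.{v, u} I}
  {J : Type v} [Category.{v} J] [SimplicialCategory J] {φ : FunctorToOrdinary J I}

namespace SimplicialSection

variable (s : SimplicialSection M φ)

/-- The map `α_! s(j) ⟶ s(k)` given by a morphism `f : j ⟶ k` over `α`. -/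
def act {j k : J} (f : j ⟶ k) {α : φ.obj j ⟶ φ.obj k} (hf : φ.map (deg (op ⦋0⦌) f) = α) :
    (underlying (M.push α)).obj (s.obj j) ⟶ s.obj k :=
  (homEquiv' _ _).symm ((s.map α).app (op ⦋0⦌) ⟨deg _ f, hf⟩)

lemma deg_act {j k : J} (f : j ⟶ k) {α : φ.obj j ⟶ φ.obj k} (hf : φ.map (deg (op ⦋0⦌) f) = α) :
    deg (op ⦋0⦌) (s.act f hf) = (s.map α).app (op ⦋0⦌) ⟨deg _ f, hf⟩ :=
  (homEquiv' _ _).apply_symm_apply _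

lemma act_comp {j k l : J} (f : j ⟶ k) (g : k ⟶ l) {α : φ.obj j ⟶ φ.obj k} {β : φ.obj k ⟶ φ.obj l}
    (hf : φ.map (deg (op ⦋0⦌) f) = α) (hg : φ.map (deg (op ⦋0⦌) g) = β)
    (hfg : φ.map (deg (op ⦋0⦌) (f ≫ g)) = α ≫ β) :
    s.act (f ≫ g) hfg = (M.pushComp α β (s.obj j)).hom ≫
      (underlying (M.push β)).map (s.act f hf) ≫ s.act g hg := by
  apply deg_zero_injective
  refine Eq.trans (s.deg_act _ hfg) (Eq.trans ?_ (s.map_mul ⟨_, hf⟩ ⟨_, hg⟩) |>.trans ?_)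
  · exact congrArg ((s.map (α ≫ β)).app _) (Subtype.ext (deg_comp _ _ _))
  · rw [deg_comp, deg_comp, ← enrichedFunctor_map_deg, deg_act, deg_act]

lemma isIso_act_id {j : J} {α : φ.obj j ⟶ φ.obj j} (h : φ.map (deg (op ⦋0⦌) (𝟙 j)) = α) :
    IsIso (s.act (𝟙 j) h) := by
  have h₁ : φ.map (deg (op ⦋0⦌) (𝟙 j)) = 𝟙 (φ.obj j) := by
    rw [← φ.map_id j (op ⦋0⦌), eId_app]
  obtain rfl : α = 𝟙 _ := h.symm.trans h₁
  have : s.act (𝟙 j) h = (M.pushId (φ.obj j) (s.obj j)).hom := by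
    apply deg_zero_injective
    rw [deg_act, ← map_one]
    exact congrArg ((s.map (𝟙 _)).app _) (Subtype.ext (eId_app j _ PUnit.unit).symm)
  rw [this]
  infer_instance

/-- The functor to `I` is constant along a homotopy, which therefore stays in `Map^α` and can be
transported by the section. -/
lemma weaklyHomotopic_act {j k : J} {f g : j ⟶ k} (h : WeaklyHomotopic f g)
    {α : φ.obj j ⟶ φ.obj k} (hf : φ.map (deg (op ⦋0⦌) f) = α) :
    ∃ hg : φ.map (deg (op ⦋0⦌) g) = α, WeaklyHomotopic (s.act f hf) (s.act g hg) := by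
  refine (h.iff_of_endpoint (fun g ↦ ∃ hg : φ.map (deg (op ⦋0⦌) g) = α,
    WeaklyHomotopic (s.act f hf) (s.act g hg)) fun h ↦ ?_).1 ⟨hf, .refl _⟩
  have hmap {n} (x : (Δ[1] : SSet.{v}).obj n) :
      φ.map (h.app n x) = φ.map (h.app (op ⦋1⦌) (SSet.yonedaEquiv (𝟙 Δ[1]))) := by
    have hx : x = (Δ[1] : SSet.{v}).map (stdSimplex.objEquiv x).op (SSet.yonedaEquiv (𝟙 _)) :=
      stdSimplex.objEquiv.injective (Category.comp_id _).symm
    rw [hx, NatTrans.naturality_apply, φ.map_simplicial]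
  have hend (i : Fin 2) : φ.map (deg (op ⦋0⦌) (endpoint h i)) =
      φ.map (h.app (op ⦋1⦌) (SSet.yonedaEquiv (𝟙 Δ[1]))) := by
    rw [deg_zero_endpoint, hmap]
  by_cases hα : φ.map (h.app (op ⦋1⦌) (SSet.yonedaEquiv (𝟙 Δ[1]))) = α
  · let h' : Δ[1] ⟶ (φ.mapOver α : SSet.{v}) := SSet.Subcomplex.lift h (by
      rintro n _ ⟨x, rfl⟩
      exact (hmap x).trans hα)
    have hend' (i : Fin 2) : endpoint (h' ≫ s.map α) i =
        s.act (endpoint h i) ((hend i).trans hα) := by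
      apply deg_zero_injective
      rw [deg_zero_endpoint, deg_act]
      exact congrArg ((s.map α).app _) (Subtype.ext (deg_zero_endpoint h i).symm)
    have h₁ := weaklyHomotopic_endpoint (h' ≫ s.map α)
    rw [hend', hend'] at h₁
    exact ⟨fun ⟨_, h₀⟩ ↦ ⟨_, h₀.trans h₁⟩, fun ⟨_, h₀⟩ ↦ ⟨_, h₀.trans h₁.symm⟩⟩
  · exact ⟨fun ⟨h₀, _⟩ ↦ (hα ((hend 0).symm.trans h₀)).elim,
      fun ⟨h₀, _⟩ ↦ (hα ((hend 1).symm.trans h₀)).elim⟩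

lemma naturality_act {s t : SimplicialSection M φ} (T : s ⟶ t) {j k : J} (f : j ⟶ k)
    {α : φ.obj j ⟶ φ.obj k} (hf : φ.map (deg (op ⦋0⦌) f) = α) :
    s.act f hf ≫ Hom.app T k = (underlying (M.push α)).map (Hom.app T j) ≫ t.act f hf := by
  apply deg_zero_injective
  rw [deg_comp, deg_comp, deg_act, deg_act]
  exact naturality_app T α _

instance {i j : I} (α : i ⟶ j) : (underlying (M.push α)).IsLeftAdjoint :=
  (M.adj α).toAdjunction.isLeftAdjoint

/-- Up to the isomorphism `(α ≫ β)_! ≅ β_! α_!`, the composite action is the action of `f ≫ g`,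
hence homotopic to the invertible action of the identity. -/
lemma exists_weaklyHomotopic_isIso {j k : J} {f : j ⟶ k} {g : k ⟶ j}
    (h : WeaklyHomotopic (f ≫ g) (𝟙 j)) {α : φ.obj j ⟶ φ.obj k} {β : φ.obj k ⟶ φ.obj j}
    (hf : φ.map (deg (op ⦋0⦌) f) = α) (hg : φ.map (deg (op ⦋0⦌) g) = β) :
    ∃ (θ : (underlying (M.push β)).obj ((underlying (M.push α)).obj (s.obj j)) ⟶ s.obj j),
      IsIso θ ∧ WeaklyHomotopic ((underlying (M.push β)).map (s.act f hf) ≫ s.act g hg) θ := by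
  have hfg : φ.map (deg (op ⦋0⦌) (f ≫ g)) = α ≫ β := by
    rw [← hf, ← hg, deg_comp]
    exact φ.map_comp _ _
  obtain ⟨h₁, h₂⟩ := s.weaklyHomotopic_act h hfg
  have := s.isIso_act_id h₁
  refine ⟨(M.pushComp α β (s.obj j)).inv ≫ s.act (𝟙 j) h₁, inferInstance, ?_⟩
  have h₃ := h₂.comp_left (M.pushComp α β (s.obj j)).inv
  rwa [s.act_comp f g hf hg hfg, Iso.inv_hom_id_assoc] at h₃

/-- Two-out-of-six for `α_! β_! α_! s(j) ⟶ α_! β_! s(k) ⟶ α_! s(j) ⟶ s(k)`, given by the actions of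
`f`, `g` and `f`: consecutive composites are homotopic to isomorphisms. -/
lemma weakEquivalence_act (hs : ∀ j, IsCofibrant (s.obj j)) {j k : J} {f : j ⟶ k}
    (h : IsHomotopyInvertible f) {α : φ.obj j ⟶ φ.obj k} (hf : φ.map (deg (op ⦋0⦌) f) = α) :
    WeakEquivalence (s.act f hf) := by
  obtain ⟨g, h₁, h₂⟩ := h
  obtain ⟨θ₁, hθ₁, hθ₁'⟩ := s.exists_weaklyHomotopic_isIso h₁ hf rfl
  obtain ⟨θ₂, hθ₂, hθ₂'⟩ := s.exists_weaklyHomotopic_isIso h₂ rfl hf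
  have hα := M.push_preservesCofibrations α
  have hβ := M.push_preservesCofibrations (φ.map (deg (op ⦋0⦌) g))
  have := hβ.isCofibrant_obj (s.obj k)
  have := hα.isCofibrant_obj ((underlying (M.push (φ.map (deg (op ⦋0⦌) g)))).obj (s.obj k))
  refine (M.isSimplicialModelCategory _).weakEquivalence_of_two_out_of_six
    ((underlying (M.push α)).map ((underlying (M.push _)).map (s.act f hf)))
    ((underlying (M.push α)).map (s.act g rfl)) (s.act f hf) ?_ θ₂ hθ₂'
  rw [← Functor.map_comp]
  refine ((M.isSimplicialModelCategory _).weakEquivalence_iff_of_weaklyHomotopic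
    (hθ₁'.map (M.push α))).2 ?_
  have : IsIso ((underlying (M.push α)).map θ₁) := Functor.map_isIso _ _
  infer_instance

end SimplicialSection

variable [∀ i, HasProducts.{v} (M.fiber i)]

/-- The cofree section on a trivial fibration is a levelwise trivial fibration; transpose liftings
along evaluation. -/
lemma SimplicialSection.IsProjective.cofibration_app {P : ModelCategory (SimplicialSection M φ)}
    (hP : IsProjective P) {s t : SimplicialSection M φ} (T : s ⟶ t) [Cofibration T] (k : J) :
    Cofibration (Hom.app T k) := by
  rw [HomotopicalAlgebra.cofibration_iff, ← trivialFibrations_llp]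
  intro E D p hp
  have : Fibration p := ⟨hp.1⟩
  have h (j : J) : trivialFibrations _ (Hom.app ((cofree M φ k).map p) j) := by
    rw [← cofibrations_rlp]
    intro A B i hi
    have : Cofibration i := ⟨hi⟩
    exact hasLiftingProperty_cofree_map_app p i (Or.inr ⟨hp.2⟩)
  exact ((evAdjCofree M φ k).hasLiftingProperty_iff T p).2 ((hP.cofibration_iff T).1 inferInstance _
    (fun j ↦ ⟨(h j).1⟩) (fun j ↦ ⟨(h j).2⟩))

lemma SimplicialSection.IsProjective.isCofibrant_obj {P : ModelCategory (SimplicialSection M φ)}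
    (hP : IsProjective P) (s : SimplicialSection M φ) [IsCofibrant s] (k : J) :
    IsCofibrant (s.obj k) :=
  (isCofibrant_iff_of_isInitial (Hom.app (initial.to s) k)
    (initialIsInitial.isInitialObj (ev M φ k) _)).2 (hP.cofibration_app _ k)

/-- Replace `T` by a map of cofibrant sections. In the naturality square of the action of `f`, both
actions are weak equivalences, and Ken Brown's lemma takes care of the image of the map at `j` under
`α_!`. -/
lemma SimplicialSection.IsProjective.weakEquivalence_app_of_isHomotopyInvertible
    {P : ModelCategory (SimplicialSection M φ)} (hP : IsProjective P)
    {s t : SimplicialSection M φ} (T : s ⟶ t) {j k : J} {f : j ⟶ k} (hf : IsHomotopyInvertible f)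
    (hT : WeakEquivalence (Hom.app T j)) : WeakEquivalence (Hom.app T k) := by
  let d := MorphismProperty.factorizationData (cofibrations _) (trivialFibrations _) (initial.to s)
  let d' := MorphismProperty.factorizationData (cofibrations _) (trivialFibrations _) (d.p ≫ T)
  have : Cofibration d.i := ⟨d.hi⟩
  have : Cofibration d'.i := ⟨d'.hi⟩
  have : IsCofibrant d.Z := (isCofibrant_iff_of_isInitial d.i initialIsInitial).2 inferInstance
  have : IsCofibrant d'.Z := isCofibrant_of_cofibration d'.i
  have hp := (hP.weakEquivalence_iff d.p).1 ⟨d.hp.2⟩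
  have hp' := (hP.weakEquivalence_iff d'.p).1 ⟨d'.hp.2⟩
  have h₁ (l : J) : WeakEquivalence (Hom.app d'.i l) ↔ WeakEquivalence (Hom.app T l) := by
    have := hp l
    have := hp' l
    have h : Hom.app d'.i l ≫ Hom.app d'.p l = Hom.app d.p l ≫ Hom.app T l :=
      congrArg (fun S ↦ Hom.app S l) d'.fac
    rw [← weakEquivalence_postcomp_iff (Hom.app d'.i l) (Hom.app d'.p l), h,
      weakEquivalence_precomp_iff]
  rw [← h₁] at hT ⊢
  have hZ := hP.isCofibrant_obj d.Z
  have hZ' := hP.isCofibrant_obj d'.Z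
  have h₂ := naturality_act d'.i f rfl
  have := (M.push_preservesCofibrations (φ.map (deg (op ⦋0⦌) f))).weakEquivalence_map
    (Hom.app d'.i j)
  have h₃ := weakEquivalence_act d.Z hZ hf rfl
  have h₄ := weakEquivalence_act d'.Z hZ' hf rfl
  rw [← weakEquivalence_precomp_iff (act d.Z f rfl), h₂]
  infer_instance

end ActionOfMorphisms

/-! ### Families of maps from mapping cylinders -/

section MappingCylinderFamilies

open Limits SSet Opposite

variable {C : Type u} [Category.{v} C] [SimplicialCategory C]
  {D : Type u'} [Category.{v} D] [SimplicialCategory D]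

lemma tensorHom_sHomComp_eHomWhiskerRight {N N' : SSet.{v}} {X Y Z W : C} (g : N ⟶ sHom X Y)
    (h : N' ⟶ sHom Y Z) (x : W ⟶ X) :
    ((g ⊗ₘ h) ≫ sHomComp X Y Z) ≫ eHomWhiskerRight SSet.{v} x Z =
      ((g ≫ eHomWhiskerRight SSet.{v} x Y) ⊗ₘ h) ≫ sHomComp W Y Z := by
  ext n ⟨s, t⟩
  exact (scomp_assoc _ _ _).symm

lemma tensorHom_sHomComp_eHomWhiskerLeft {N N' : SSet.{v}} {X Y Z W : C} (g : N ⟶ sHom X Y)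
    (h : N' ⟶ sHom Y Z) (z : Z ⟶ W) :
    ((g ⊗ₘ h) ≫ sHomComp X Y Z) ≫ eHomWhiskerLeft SSet.{v} X z =
      (g ⊗ₘ (h ≫ eHomWhiskerLeft SSet.{v} Y z)) ≫ sHomComp X Y W := by
  ext n ⟨s, t⟩
  exact scomp_assoc _ _ _

lemma tensorHom_eHomWhiskerRight_sHomComp {N N' : SSet.{v}} {X Y Y' Z : C} (g : N ⟶ sHom X Y)
    (y : Y ⟶ Y') (h : N' ⟶ sHom Y' Z) :
    (g ⊗ₘ (h ≫ eHomWhiskerRight SSet.{v} y Z)) ≫ sHomComp X Y Z =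
      ((g ≫ eHomWhiskerLeft SSet.{v} X y) ⊗ₘ h) ≫ sHomComp X Y' Z := by
  ext n ⟨s, t⟩
  exact (scomp_assoc _ _ _).symm

lemma ι₀_comp_tensorHom_sHomComp {N : SSet.{v}} {X Y Z : C} (g : N ⟶ sHom X Y)
    (h : Δ[1] ⟶ sHom Y Z) :
    ι₀ ≫ (g ⊗ₘ h) ≫ sHomComp X Y Z = g ≫ eHomWhiskerLeft SSet.{v} X (endpoint h 0) := by
  ext n x
  exact congrArg (g.app n x ⊚ ·) (deg_endpoint h 0 n).symm

lemma ι₁_comp_tensorHom_sHomComp {N : SSet.{v}} {X Y Z : C} (g : N ⟶ sHom X Y)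
    (h : Δ[1] ⟶ sHom Y Z) :
    ι₁ ≫ (g ⊗ₘ h) ≫ sHomComp X Y Z = g ≫ eHomWhiskerLeft SSet.{v} X (endpoint h 1) := by
  ext n x
  exact congrArg (g.app n x ⊚ ·) (deg_endpoint h 1 n).symm

lemma comp_endpoint_eq {E E₁ E' E₁' : C} {h : Δ[1] ⟶ sHom E₁ E} {h' : Δ[1] ⟶ sHom E₁' E'} {p : E ⟶ E'}
    {p₁ : E₁ ⟶ E₁'}
    (hp : h' ≫ eHomWhiskerRight SSet.{v} p₁ E' = h ≫ eHomWhiskerLeft SSet.{v} E₁ p)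
    (i : Fin 2) : p₁ ≫ endpoint h' i = endpoint h i ≫ p := by
  rw [← endpoint_comp_eHomWhiskerRight, hp, endpoint_comp_eHomWhiskerLeft]

/-- A pullback square of objects which represent families of maps from the targets of `f i`,
from its sources, and from the cylinders on its sources, respectively. -/
structure CylinderSquare {ι : Type*} {K L : ι → SSet.{v}} (f : ∀ i, K i ⟶ L i)
    (F : ι → EnrichedFunctor SSet.{v} C D) {E E₁ : D} (ε : Δ[1] ⟶ sHom E₁ E) where
  {target source path pt : C}
  wTarget (i : ι) : L i ⟶ sHom ((F i).obj target) E
  wSource (i : ι) : K i ⟶ sHom ((F i).obj source) E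
  wPath (i : ι) : K i ⟶ sHom ((F i).obj path) E₁
  target_represents : RepresentsFamilies L F E target wTarget
  source_represents : RepresentsFamilies K F E source wSource
  path_represents : RepresentsFamilies K F E₁ path wPath
  isPower (X : D) (N : SSet.{v}) :
    Function.Bijective (fun g : N ⟶ sHom X E₁ ↦ (g ⊗ₘ ε) ≫ sHomComp X E₁ E)
  restr : target ⟶ source
  start : path ⟶ source
  fst : pt ⟶ target
  snd : pt ⟶ path
  isPullback : IsPullback fst snd restr start
  wSource_restr (i : ι) :
    wSource i ≫ eHomWhiskerRight SSet.{v} ((underlying (F i)).map restr) E = f i ≫ wTarget i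
  wSource_start (i : ι) :
    wSource i ≫ eHomWhiskerRight SSet.{v} ((underlying (F i)).map start) E =
      wPath i ≫ eHomWhiskerLeft SSet.{v} _ (endpoint ε 0)

namespace CylinderSquare

variable {ι : Type*} {K L : ι → SSet.{v}} {f : ∀ i, K i ⟶ L i}
  {F : ι → EnrichedFunctor SSet.{v} C D} {E E₁ : D} {ε : Δ[1] ⟶ sHom E₁ E}
  (S : CylinderSquare f F ε)

lemma ι₀_comp (i : ι) {X : C} (x : X ⟶ S.target) (y : X ⟶ S.path) (h : x ≫ S.restr = y ≫ S.start) :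
    ι₀ ≫ (((S.wPath i ≫ eHomWhiskerRight SSet.{v} ((underlying (F i)).map y) E₁) ⊗ₘ ε) ≫
      sHomComp _ _ _) =
    f i ≫ S.wTarget i ≫ eHomWhiskerRight SSet.{v} ((underlying (F i)).map x) E := by
  rw [ι₀_comp_tensorHom_sHomComp, Category.assoc, ← eHom_whisker_exchange, ← Category.assoc,
    ← S.wSource_start, Category.assoc, ← eHomWhiskerRight_comp, ← Functor.map_comp, ← h,
    Functor.map_comp, eHomWhiskerRight_comp, ← Category.assoc, S.wSource_restr, Category.assoc]

/-- The universal family of maps from the mapping cylinders. -/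
def w (i : ι) : mappingCylinder (f i) ⟶ sHom ((F i).obj S.pt) E :=
  (mappingCylinder.isPushout (f i)).desc _ _ (S.ι₀_comp i S.fst S.snd S.isPullback.w)

lemma inl_w (i : ι) : mappingCylinder.inl (f i) ≫ S.w i =
    ((S.wPath i ≫ eHomWhiskerRight SSet.{v} ((underlying (F i)).map S.snd) E₁) ⊗ₘ ε) ≫
      sHomComp _ _ _ :=
  (mappingCylinder.isPushout (f i)).inl_desc _ _ _

lemma inr_w (i : ι) : mappingCylinder.inr (f i) ≫ S.w i =
    S.wTarget i ≫ eHomWhiskerRight SSet.{v} ((underlying (F i)).map S.fst) E :=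
  (mappingCylinder.isPushout (f i)).inr_desc _ _ _

lemma inl_w_comp (i : ι) {X : C} (l : X ⟶ S.pt) : mappingCylinder.inl (f i) ≫ S.w i ≫
      eHomWhiskerRight SSet.{v} ((underlying (F i)).map l) E =
    ((S.wPath i ≫ eHomWhiskerRight SSet.{v} ((underlying (F i)).map (l ≫ S.snd)) E₁) ⊗ₘ ε) ≫
      sHomComp _ _ _ := by
  rw [← Category.assoc, inl_w, tensorHom_sHomComp_eHomWhiskerRight, Category.assoc,
    ← eHomWhiskerRight_comp, ← Functor.map_comp]

lemma inr_w_comp (i : ι) {X : C} (l : X ⟶ S.pt) : mappingCylinder.inr (f i) ≫ S.w i ≫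
      eHomWhiskerRight SSet.{v} ((underlying (F i)).map l) E =
    S.wTarget i ≫ eHomWhiskerRight SSet.{v} ((underlying (F i)).map (l ≫ S.fst)) E := by
  rw [← Category.assoc, inr_w, Category.assoc, ← eHomWhiskerRight_comp, ← Functor.map_comp]

/-- A map from a mapping cylinder is a map from the target with a homotopy starting at its
restriction to the source. As `E₁` is the cotensor of `E` by `Δ[1]`, homotopies of families with
values in `E` are families with values in `E₁`. -/
lemma representsFamilies : RepresentsFamilies (fun i ↦ mappingCylinder (f i)) F E S.pt S.w := by
  refine fun X ↦ ⟨fun l l' h ↦ S.isPullback.hom_ext ?_ ?_, fun z ↦ ?_⟩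
  · refine S.target_represents.hom_ext fun i ↦ ?_
    rw [← inr_w_comp, ← inr_w_comp]
    exact congrArg (mappingCylinder.inr (f i) ≫ ·) (congrFun h i)
  · refine S.path_represents.hom_ext fun i ↦ (S.isPower _ _).1 ?_
    refine (S.inl_w_comp i l).symm.trans (Eq.trans ?_ (S.inl_w_comp i l'))
    exact congrArg (mappingCylinder.inl (f i) ≫ ·) (congrFun h i)
  · obtain ⟨x, hx⟩ := S.target_represents.exists_hom (fun i ↦ mappingCylinder.inr (f i) ≫ z i)
    choose g hg using fun i ↦ (S.isPower _ _).2 (mappingCylinder.inl (f i) ≫ z i)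
    obtain ⟨y, hy⟩ := S.path_represents.exists_hom g
    beta_reduce at hg
    have h : x ≫ S.restr = y ≫ S.start := S.source_represents.hom_ext fun i ↦ by
      rw [Functor.map_comp, Functor.map_comp, eHomWhiskerRight_comp, eHomWhiskerRight_comp,
        ← Category.assoc, ← Category.assoc, S.wSource_restr, S.wSource_start, Category.assoc, hx,
        Category.assoc, eHom_whisker_exchange, ← Category.assoc (S.wPath i), hy,
        ← ι₀_comp_tensorHom_sHomComp, hg, ← Category.assoc, ← Category.assoc,
        (mappingCylinder.isPushout (f i)).w]
    refine ⟨S.isPullback.lift x y h, funext fun i ↦ ?_⟩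
    apply (mappingCylinder.isPushout (f i)).hom_ext
    · rw [inl_w_comp, IsPullback.lift_snd, hy, hg]
    · rw [inr_w_comp, IsPullback.lift_fst, hx]

/-- The end point of the homotopy is the restriction along the monomorphism `mappingCylinder.ι`. -/
lemma wSource_finish (finish : S.path ⟶ S.source) (i : ι)
    (h : S.wSource i ≫ eHomWhiskerRight SSet.{v} ((underlying (F i)).map finish) E =
      S.wPath i ≫ eHomWhiskerLeft SSet.{v} _ (endpoint ε 1)) :
    S.wSource i ≫ eHomWhiskerRight SSet.{v} ((underlying (F i)).map (S.snd ≫ finish)) E =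
      mappingCylinder.ι (f i) ≫ S.w i := by
  rw [mappingCylinder.ι, Category.assoc, inl_w, ι₁_comp_tensorHom_sHomComp, Category.assoc,
    ← eHom_whisker_exchange, ← Category.assoc, ← h, Category.assoc, ← eHomWhiskerRight_comp,
    ← Functor.map_comp]

lemma w_naturality {E' E₁' : D} {ε' : Δ[1] ⟶ sHom E₁' E'} (S' : CylinderSquare f F ε')
    {p : E ⟶ E'} {p₁ : E₁ ⟶ E₁'}
    (hp : ε' ≫ eHomWhiskerRight SSet.{v} p₁ E' = ε ≫ eHomWhiskerLeft SSet.{v} E₁ p)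
    {rt : S.target ⟶ S'.target} {rp : S.path ⟶ S'.path} {r : S.pt ⟶ S'.pt} (i : ι)
    (hrt : S'.wTarget i ≫ eHomWhiskerRight SSet.{v} ((underlying (F i)).map rt) E' =
      S.wTarget i ≫ eHomWhiskerLeft SSet.{v} _ p)
    (hrp : S'.wPath i ≫ eHomWhiskerRight SSet.{v} ((underlying (F i)).map rp) E₁' =
      S.wPath i ≫ eHomWhiskerLeft SSet.{v} _ p₁)
    (h₁ : r ≫ S'.fst = S.fst ≫ rt) (h₂ : r ≫ S'.snd = S.snd ≫ rp) :
    S'.w i ≫ eHomWhiskerRight SSet.{v} ((underlying (F i)).map r) E' =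
      S.w i ≫ eHomWhiskerLeft SSet.{v} _ p := by
  apply (mappingCylinder.isPushout (f i)).hom_ext
  · rw [inl_w_comp, h₂, Functor.map_comp, eHomWhiskerRight_comp, ← Category.assoc (S'.wPath i), hrp,
      ← Category.assoc, inl_w, tensorHom_sHomComp_eHomWhiskerLeft, ← hp,
      tensorHom_eHomWhiskerRight_sHomComp, Category.assoc, Category.assoc, eHom_whisker_exchange]
  · rw [inr_w_comp, h₁, Functor.map_comp, eHomWhiskerRight_comp, ← Category.assoc, hrt,
      ← Category.assoc, inr_w, Category.assoc, Category.assoc, eHom_whisker_exchange]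

/-- The corner map between cylinder squares lifts against cofibrations. -/
lemma exists_lift [ModelCategory C] [ModelCategory D] {E' E₁' : D} {ε' : Δ[1] ⟶ sHom E₁' E'}
    (S' : CylinderSquare f F ε')
    (hD : IsSimplicialModelCategory D) (hF : ∀ i, PreservesCofibrations (underlying (F i)))
    (hf : ∀ i, IsWeakHomotopyEquivalence (f i))
    (p : E ⟶ E') [Fibration p] (p₁ : E₁ ⟶ E₁')
    (hp : ε' ≫ eHomWhiskerRight SSet.{v} p₁ E' = ε ≫ eHomWhiskerLeft SSet.{v} E₁ p)
    {rt : S.target ⟶ S'.target} {rp : S.path ⟶ S'.path} {r : S.pt ⟶ S'.pt}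
    {rs : S.source ⟶ S'.source} {finish : S.path ⟶ S.source} {finish' : S'.path ⟶ S'.source}
    (hrt : ∀ i, S'.wTarget i ≫ eHomWhiskerRight SSet.{v} ((underlying (F i)).map rt) E' =
      S.wTarget i ≫ eHomWhiskerLeft SSet.{v} _ p)
    (hrp : ∀ i, S'.wPath i ≫ eHomWhiskerRight SSet.{v} ((underlying (F i)).map rp) E₁' =
      S.wPath i ≫ eHomWhiskerLeft SSet.{v} _ p₁)
    (hrs : ∀ i, S'.wSource i ≫ eHomWhiskerRight SSet.{v} ((underlying (F i)).map rs) E' =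
      S.wSource i ≫ eHomWhiskerLeft SSet.{v} _ p)
    (hfin : ∀ i, S.wSource i ≫ eHomWhiskerRight SSet.{v} ((underlying (F i)).map finish) E =
      S.wPath i ≫ eHomWhiskerLeft SSet.{v} _ (endpoint ε 1))
    (hfin' : ∀ i, S'.wSource i ≫ eHomWhiskerRight SSet.{v} ((underlying (F i)).map finish') E' =
      S'.wPath i ≫ eHomWhiskerLeft SSet.{v} _ (endpoint ε' 1))
    (h₁ : r ≫ S'.fst = S.fst ≫ rt) (h₂ : r ≫ S'.snd = S.snd ≫ rp)
    {A B : C} (g : A ⟶ B) [Cofibration g] (a : A ⟶ S.pt) (b : B ⟶ S'.pt) (c : B ⟶ S.source)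
    (hab : a ≫ r = g ≫ b) (hac : a ≫ S.snd ≫ finish = g ≫ c)
    (hbc : b ≫ S'.snd ≫ finish' = c ≫ rs) :
    ∃ l : B ⟶ S.pt, g ≫ l = a ∧ l ≫ r = b ∧ l ≫ S.snd ≫ finish = c :=
  S.source_represents.exists_lift S.representsFamilies S'.representsFamilies hD hF
    (fun i ↦ mappingCylinder.ι (f i)) p g
    (.inl fun i ↦ mappingCylinder.isWeakHomotopyEquivalence_ι (hf i)) _ _ rs r
    (fun i ↦ S.wSource_finish finish i (hfin i)) (fun i ↦ S'.wSource_finish finish' i (hfin' i)) hrs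
    (fun i ↦ S.w_naturality S' hp i (hrt i) (hrp i) h₁ h₂) a b c hab hac hbc

end CylinderSquare

end MappingCylinderFamilies

/-! ### Comparison of cofree sections over `J` and `J'` -/

section Comparison

open Limits SSet Opposite

variable {I : Type u'} [Category.{v} I] {M : SimplicialQuillenPresheaf.{v, u} I}
  {J : Type v} [Category.{v} J] [SimplicialCategory J]
  {J' : Type v} [Category.{v} J'] [SimplicialCategory J']
  {φ' : FunctorToOrdinary J' I} {ψ : EnrichedFunctor SSet.{v} J J'}

open SimplicialSection

lemma CofreeData.cogen_comp_whiskerRight_of_restriction {k : J} {E : M.fiber (φ'.obj (ψ.obj k))}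
    {d : CofreeData M (φ'.precomp ψ) k E} {d' : CofreeData M φ' (ψ.obj k) E}
    {T : d'.toSection.restrict ψ ⟶ d.toSection} (hT : Hom.app T k ≫ d.counit = d'.counit) {j : J}
    (α : φ'.obj (ψ.obj j) ⟶ φ'.obj (ψ.obj k)) :
    d.cogen (j := j) α ≫ eHomWhiskerRight SSet.{v} ((underlying (M.push α)).map (Hom.app T j)) E =
      φ'.precompOver ψ α ≫ d'.cogen α := by
  refine (d.cogen_comp_whiskerRight T α).trans ?_
  rw [hT]
  ext n x
  exact (d'.cogen_eq_act _).symm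

variable [∀ i, HasProducts.{v} (M.fiber i)]

variable (ψ) in
/-- The comparison map from the restriction of a cofree section to a cofree section. -/
def comparison (k : J) (E : M.fiber (φ'.obj (ψ.obj k))) :
    (restriction M φ' ψ).obj ((cofree M φ' (ψ.obj k)).obj E) ⟶
      (cofree M (φ'.precomp ψ) k).obj E :=
  (evAdjCofree M (φ'.precomp ψ) k).homEquiv
    ((restriction M φ' ψ).obj ((cofree M φ' (ψ.obj k)).obj E)) E
    (cofreeData M φ' (ψ.obj k) E).counit

lemma homEquiv_symm_comparison (k : J) (E : M.fiber (φ'.obj (ψ.obj k))) :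
    ((evAdjCofree M (φ'.precomp ψ) k).homEquiv _ _).symm (comparison ψ k E) =
      (cofreeData M φ' (ψ.obj k) E).counit :=
  Equiv.symm_apply_apply _ _

lemma comparison_naturality {k : J} {E D : M.fiber (φ'.obj (ψ.obj k))} (p : E ⟶ D) :
    comparison ψ k E ≫ (cofree M (φ'.precomp ψ) k).map p =
      (restriction M φ' ψ).map ((cofree M φ' (ψ.obj k)).map p) ≫ comparison ψ k D := by
  apply ((evAdjCofree M (φ'.precomp ψ) k).homEquiv _ _).symm.injective
  rw [Adjunction.homEquiv_naturality_right_symm, Adjunction.homEquiv_naturality_left_symm,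
    homEquiv_symm_comparison, homEquiv_symm_comparison]
  exact (cofree_map_app_counit p).symm

/-- At level `j`, comparison is restriction of families along `Map^α(j, k) ⟶ Map^α(ψ j, ψ k)`. -/
lemma cogen_comp_comparison {k : J} (E : M.fiber (φ'.obj (ψ.obj k))) {j : J}
    (α : φ'.obj (ψ.obj j) ⟶ φ'.obj (ψ.obj k)) :
    (cofreeData M (φ'.precomp ψ) k E).cogen (j := j) α ≫ eHomWhiskerRight SSet.{v}
      ((underlying (M.push α)).map (Hom.app (comparison ψ k E) j)) E =
    φ'.precompOver ψ α ≫ (cofreeData M φ' (ψ.obj k) E).cogen α :=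
  CofreeData.cogen_comp_whiskerRight_of_restriction
    ((app_counit_of_cofree_hom k (comparison ψ k E)).trans (homEquiv_symm_comparison k E)) α

/-- Under the adjunctions, composing with the comparison map is precomposing with the unit of `ψ_! ⊣
ψ^*` at level `k`. -/
lemma homEquiv_symm_comp_comparison {L : SimplicialSection M (φ'.precomp ψ) ⥤ SimplicialSection M φ'}
    (adj : L ⊣ restriction M φ' ψ) {X : SimplicialSection M (φ'.precomp ψ)} {k : J}
    {E : M.fiber (φ'.obj (ψ.obj k))}
    (T : X ⟶ (restriction M φ' ψ).obj ((cofree M φ' (ψ.obj k)).obj E)) :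
    ((evAdjCofree M (φ'.precomp ψ) k).homEquiv _ _).symm (T ≫ comparison ψ k E) =
      Hom.app (adj.unit.app X) k ≫
        ((evAdjCofree M φ' (ψ.obj k)).homEquiv _ _).symm ((adj.homEquiv _ _).symm T) := by
  rw [Adjunction.homEquiv_naturality_left_symm, homEquiv_symm_comparison,
    ← app_counit_of_cofree_hom]
  refine Eq.trans ?_ (Category.assoc _ _ _)
  refine congrArg (· ≫ (cofreeData M φ' (ψ.obj k) E).counit) ?_
  have h := ((adj.homEquiv _ _).apply_symm_apply T).symm.trans (Adjunction.homEquiv_unit _ _ _ _)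
  exact congrArg (fun S ↦ Hom.app S k) h

/-- The section of pairs of a point over `J'` and a path over `J` starting at its restriction. -/
def pathSection (k : J) {E E₁ : M.fiber (φ'.obj (ψ.obj k))} (ε : Δ[1] ⟶ sHom E₁ E) :
    SimplicialSection M (φ'.precomp ψ) :=
  pullback (comparison ψ k E) ((cofree M (φ'.precomp ψ) k).map (endpoint ε 0))

namespace pathSection

section

variable {k : J} {E E₁ : M.fiber (φ'.obj (ψ.obj k))} (ε : Δ[1] ⟶ sHom E₁ E)

/-- The first projection. -/
def fst : pathSection (ψ := ψ) k ε ⟶ (restriction M φ' ψ).obj ((cofree M φ' (ψ.obj k)).obj E) :=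
  pullback.fst _ _

/-- The second projection. -/
def snd : pathSection (ψ := ψ) k ε ⟶ (cofree M (φ'.precomp ψ) k).obj E₁ := pullback.snd _ _

lemma isPullback : IsPullback (fst (ψ := ψ) ε) (snd ε) (comparison ψ k E)
    ((cofree M (φ'.precomp ψ) k).map (endpoint ε 0)) := IsPullback.of_hasPullback _ _

/-- The end point of the path. -/
def finish : pathSection (ψ := ψ) k ε ⟶ (cofree M (φ'.precomp ψ) k).obj E :=
  snd ε ≫ (cofree M (φ'.precomp ψ) k).map (endpoint ε 1)

variable [∀ i, HasCoproducts.{v} (M.fiber i)]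

/-- The cylinder square given by the values of `pathSection`. -/
def cylinderSquare (hε : ∀ (X : M.fiber (φ'.obj (ψ.obj k))) (N : SSet.{v}),
      Function.Bijective (fun g : N ⟶ sHom X E₁ ↦ (g ⊗ₘ ε) ≫ sHomComp X E₁ E)) (j : J) :
    CylinderSquare (fun α : φ'.obj (ψ.obj j) ⟶ φ'.obj (ψ.obj k) ↦ φ'.precompOver ψ α)
      (fun α ↦ M.push α) ε where
  wTarget α := (cofreeData M φ' (ψ.obj k) E).cogen α
  wSource α := (cofreeData M (φ'.precomp ψ) k E).cogen (j := j) α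
  wPath α := (cofreeData M (φ'.precomp ψ) k E₁).cogen (j := j) α
  target_represents := ((cofreeData M φ' (ψ.obj k) E).isPower (ψ.obj j)).representsFamilies
  source_represents := ((cofreeData M (φ'.precomp ψ) k E).isPower j).representsFamilies
  path_represents := ((cofreeData M (φ'.precomp ψ) k E₁).isPower j).representsFamilies
  isPower := hε
  restr := Hom.app (comparison ψ k E) j
  start := Hom.app ((cofree M (φ'.precomp ψ) k).map (endpoint ε 0)) j
  fst := Hom.app (fst ε) j
  snd := Hom.app (snd ε) j
  isPullback := by
    have := isRightAdjoint_ev (M := M) (φ := φ'.precomp ψ) j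
    exact (isPullback ε).map (ev M (φ'.precomp ψ) j)
  wSource_restr α := cogen_comp_comparison E α
  wSource_start α := cogen_comp_cofree_map (φ := φ'.precomp ψ) (endpoint ε 0) α

end

variable {k : J} {E E₁ D D₁ : M.fiber (φ'.obj (ψ.obj k))} {ε : Δ[1] ⟶ sHom E₁ E}
  {δ : Δ[1] ⟶ sHom D₁ D} {p : E ⟶ D} {p₁ : E₁ ⟶ D₁}

/-- The functoriality of `pathSection`. -/
def map (h : δ ≫ eHomWhiskerRight SSet.{v} p₁ D = ε ≫ eHomWhiskerLeft SSet.{v} E₁ p) :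
    pathSection (ψ := ψ) k ε ⟶ pathSection k δ :=
  pullback.map _ _ _ _ ((restriction M φ' ψ).map ((cofree M φ' (ψ.obj k)).map p))
    ((cofree M (φ'.precomp ψ) k).map p₁) ((cofree M (φ'.precomp ψ) k).map p)
    (comparison_naturality p) (by
      rw [← Functor.map_comp, ← Functor.map_comp, comp_endpoint_eq h])

variable (h : δ ≫ eHomWhiskerRight SSet.{v} p₁ D = ε ≫ eHomWhiskerLeft SSet.{v} E₁ p)

lemma map_fst : map (ψ := ψ) h ≫ fst δ =
    fst ε ≫ (restriction M φ' ψ).map ((cofree M φ' (ψ.obj k)).map p) := pullback.lift_fst _ _ _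

lemma map_snd : map (ψ := ψ) h ≫ snd δ = snd ε ≫ (cofree M (φ'.precomp ψ) k).map p₁ :=
  pullback.lift_snd _ _ _

lemma map_finish : map (ψ := ψ) h ≫ finish δ = finish ε ≫ (cofree M (φ'.precomp ψ) k).map p := by
  rw [finish, ← Category.assoc, map_snd, finish, Category.assoc, Category.assoc, ← Functor.map_comp,
    ← Functor.map_comp, comp_endpoint_eq h]

variable (ψ) in
/-- The corner map of `pathSection`. -/
def corner : pathSection (ψ := ψ) k ε ⟶
    pullback (finish (ψ := ψ) δ) ((cofree M (φ'.precomp ψ) k).map p) :=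
  pullback.lift (map h) (finish ε) (map_finish h)

lemma corner_fst : corner ψ h ≫ pullback.fst _ _ = map h := pullback.lift_fst _ _ _

lemma corner_snd : corner ψ h ≫ pullback.snd _ _ = finish ε := pullback.lift_snd _ _ _

variable [∀ i, HasCoproducts.{v} (M.fiber i)]

/-- At level `j` the corner map is that of cotensors, for the fibration `p` and the inclusions of
`Map^α(j, k)` in the mapping cylinders. These are monomorphisms and weak homotopy equivalences, so
the corner map lifts against all cofibrations. -/
lemma hasLiftingProperty_corner
    (hε : ∀ (X : M.fiber (φ'.obj (ψ.obj k))) (N : SSet.{v}),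
      Function.Bijective (fun g : N ⟶ sHom X E₁ ↦ (g ⊗ₘ ε) ≫ sHomComp X E₁ E))
    (hδ : ∀ (X : M.fiber (φ'.obj (ψ.obj k))) (N : SSet.{v}),
      Function.Bijective (fun g : N ⟶ sHom X D₁ ↦ (g ⊗ₘ δ) ≫ sHomComp X D₁ D))
    (hψ : ∀ j, IsWeakHomotopyEquivalence (ψ.map j k)) [Fibration p] (j : J)
    {A B : M.fiber (φ'.obj (ψ.obj j))} (g : A ⟶ B) [Cofibration g] :
    HasLiftingProperty g (Hom.app (corner ψ h) j) := by
  refine ⟨fun {a b} sq ↦ ?_⟩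
  have := isRightAdjoint_ev (M := M) (φ := φ'.precomp ψ) j
  have hpb := (IsPullback.of_hasPullback (finish (ψ := ψ) δ)
    ((cofree M (φ'.precomp ψ) k).map p)).map (ev M (φ'.precomp ψ) j)
  let q₁ := Hom.app (pullback.fst (finish (ψ := ψ) δ) ((cofree M (φ'.precomp ψ) k).map p)) j
  let q₂ := Hom.app (pullback.snd (finish (ψ := ψ) δ) ((cofree M (φ'.precomp ψ) k).map p)) j
  have h₁ : Hom.app (corner ψ h) j ≫ q₁ = Hom.app (map h) j :=
    congrArg (fun S ↦ Hom.app S j) (corner_fst h)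
  have h₂ : Hom.app (corner ψ h) j ≫ q₂ = Hom.app (finish ε) j :=
    congrArg (fun S ↦ Hom.app S j) (corner_snd h)
  have hab : a ≫ Hom.app (map h) j = g ≫ b ≫ q₁ := by
    rw [← h₁, ← Category.assoc, sq.w, Category.assoc]
  have hac : a ≫ Hom.app (finish ε) j = g ≫ b ≫ q₂ := by
    rw [← h₂, ← Category.assoc, sq.w, Category.assoc]
  have hbc : (b ≫ q₁) ≫ Hom.app (finish δ) j =
      (b ≫ q₂) ≫ Hom.app ((cofree M (φ'.precomp ψ) k).map p) j :=
    (Category.assoc _ _ _).trans ((congrArg (b ≫ ·) hpb.w).trans (Category.assoc _ _ _).symm)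
  obtain ⟨l, hl₁, hl₂, hl₃⟩ := (cylinderSquare (ψ := ψ) ε hε j).exists_lift (cylinderSquare δ hδ j)
    (M.isSimplicialModelCategory _) (fun α ↦ M.push_preservesCofibrations α)
    (fun α ↦ φ'.isWeakHomotopyEquivalence_precompOver (hψ j) α) p p₁ h
    (rt := Hom.app ((cofree M φ' (ψ.obj k)).map p) (ψ.obj j))
    (rp := Hom.app ((cofree M (φ'.precomp ψ) k).map p₁) j)
    (r := Hom.app (map h) j)
    (rs := Hom.app ((cofree M (φ'.precomp ψ) k).map p) j)
    (finish := Hom.app ((cofree M (φ'.precomp ψ) k).map (endpoint ε 1)) j)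
    (finish' := Hom.app ((cofree M (φ'.precomp ψ) k).map (endpoint δ 1)) j)
    (fun α ↦ cogen_comp_cofree_map p α)
    (fun α ↦ cogen_comp_cofree_map (φ := φ'.precomp ψ) p₁ α)
    (fun α ↦ cogen_comp_cofree_map (φ := φ'.precomp ψ) p α)
    (fun α ↦ cogen_comp_cofree_map (φ := φ'.precomp ψ) _ α)
    (fun α ↦ cogen_comp_cofree_map (φ := φ'.precomp ψ) _ α)
    (congrArg (fun S ↦ Hom.app S j) (map_fst h)) (congrArg (fun S ↦ Hom.app S j) (map_snd h))
    g a (b ≫ q₁) (b ≫ q₂)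
    hab hac hbc
  refine ⟨⟨⟨l, hl₁, hpb.hom_ext ?_ ?_⟩⟩⟩
  · exact (Category.assoc _ _ _).trans ((congrArg (l ≫ ·) h₁).trans hl₂)
  · exact (Category.assoc _ _ _).trans ((congrArg (l ≫ ·) h₂).trans hl₃)

lemma exists_lift {P : ModelCategory (SimplicialSection M (φ'.precomp ψ))} (hP : IsProjective P)
    (hε : ∀ (X : M.fiber (φ'.obj (ψ.obj k))) (N : SSet.{v}),
      Function.Bijective (fun g : N ⟶ sHom X E₁ ↦ (g ⊗ₘ ε) ≫ sHomComp X E₁ E))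
    (hδ : ∀ (X : M.fiber (φ'.obj (ψ.obj k))) (N : SSet.{v}),
      Function.Bijective (fun g : N ⟶ sHom X D₁ ↦ (g ⊗ₘ δ) ≫ sHomComp X D₁ D))
    (hψ : ∀ j, IsWeakHomotopyEquivalence (ψ.map j k)) [Fibration p]
    {X : SimplicialSection M (φ'.precomp ψ)} [IsCofibrant X] (y : X ⟶ pathSection k δ)
    (x : X ⟶ (cofree M (φ'.precomp ψ) k).obj E)
    (hxy : y ≫ finish δ = x ≫ (cofree M (φ'.precomp ψ) k).map p) :
    ∃ z : X ⟶ pathSection k ε, z ≫ map h = y ∧ z ≫ finish ε = x := by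
  have hc (j : J) : trivialFibrations (M.fiber (φ'.obj (ψ.obj j))) (Hom.app (corner ψ h) j) := by
    rw [← cofibrations_rlp]
    intro A B g hg
    have : Cofibration g := ⟨hg⟩
    exact hasLiftingProperty_corner h hε hδ hψ j g
  have := (hP.cofibration_iff (initial.to X)).1 inferInstance (corner ψ h)
    (fun j ↦ ⟨(hc j).1⟩) (fun j ↦ ⟨(hc j).2⟩)
  have sq : CommSq (initial.to _) (initial.to X) (corner ψ h) (pullback.lift y x hxy) :=
    ⟨initial.hom_ext _ _⟩
  refine ⟨sq.lift, ?_, ?_⟩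
  · rw [← corner_fst h, ← Category.assoc, sq.fac_right, pullback.lift_fst]
  · rw [← corner_snd h, ← Category.assoc, sq.fac_right, pullback.lift_snd]

end pathSection

end Comparison

/-! ### The unit and the Quillen equivalence -/

section QuillenEquivalence

open Limits SSet Opposite

variable {I : Type u'} [Category.{v} I] {M : SimplicialQuillenPresheaf.{v, u} I}
  {J : Type v} [Category.{v} J] [SimplicialCategory J]
  {J' : Type v} [Category.{v} J'] [SimplicialCategory J']
  {φ' : FunctorToOrdinary J' I} {ψ : EnrichedFunctor SSet.{v} J J'}

open SimplicialSection

variable [∀ i, HasProducts.{v} (M.fiber i)] [∀ i, HasCoproducts.{v} (M.fiber i)]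

/-- The unit at `k` behaves up to homotopy as a trivial cofibration: `x` extends along it,
compatibly with an extension and a homotopy already given after `p`. The data over `D` form a map
from `X` to a path section, which is lifted along the corner map. -/
lemma exists_extension_along_unit {P : ModelCategory (SimplicialSection M (φ'.precomp ψ))}
    (hP : IsProjective P)
    {L : SimplicialSection M (φ'.precomp ψ) ⥤ SimplicialSection M φ'}
    (adj : L ⊣ restriction M φ' ψ) (X : SimplicialSection M (φ'.precomp ψ)) [IsCofibrant X]
    {k : J} (hψ : ∀ j, IsWeakHomotopyEquivalence (ψ.map j k))
    {E D : M.fiber (φ'.obj (ψ.obj k))} (p : E ⟶ D) [Fibration p]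
    (x : X.obj k ⟶ E) (y : (L.obj X).obj (ψ.obj k) ⟶ D) (h : (Δ[1] : SSet.{v}) ⟶ sHom (X.obj k) D)
    (h₀ : endpoint h 0 = Hom.app (adj.unit.app X) k ≫ y) (h₁ : endpoint h 1 = x ≫ p) :
    ∃ (f : (L.obj X).obj (ψ.obj k) ⟶ E) (h' : (Δ[1] : SSet.{v}) ⟶ sHom (X.obj k) E),
      endpoint h' 0 = Hom.app (adj.unit.app X) k ≫ f ∧ endpoint h' 1 = x ∧ f ≫ p = y ∧
      h' ≫ eHomWhiskerLeft SSet.{v} _ p = h := by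
  have hC := (M.isSimplicialModelCategory (φ'.obj (ψ.obj k))).1
  obtain ⟨E₁, ε, hε, hε'⟩ := hC.exists_cotensor Δ[1] E
  obtain ⟨D₁, δ, hδ, hδ'⟩ := hC.exists_cotensor Δ[1] D
  -- The path objects `E₁ = E ^ Δ[1]` and `D₁ = D ^ Δ[1]` receive `p` as `p₁` and the homotopy `h`
  -- as the morphism `g`.
  obtain ⟨p₁, hp⟩ := (hδ' E₁).2 (ε ≫ eHomWhiskerLeft SSet.{v} E₁ p)
  obtain ⟨g, hg⟩ := (hδ' (X.obj k)).2 h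
  beta_reduce at hp hg
  let e {Y : SimplicialSection M (φ'.precomp ψ)} {F : M.fiber (φ'.obj (ψ.obj k))} :
    (Y ⟶ (cofree M (φ'.precomp ψ) k).obj F) ≃ (Y.obj k ⟶ F) :=
    ((evAdjCofree M (φ'.precomp ψ) k).homEquiv Y F).symm
  let e' {F : M.fiber (φ'.obj (ψ.obj k))} :
    (X ⟶ (restriction M φ' ψ).obj ((cofree M φ' (ψ.obj k)).obj F)) ≃
      ((L.obj X).obj (ψ.obj k) ⟶ F) :=
    (adj.homEquiv _ _).symm.trans ((evAdjCofree M φ' (ψ.obj k)).homEquiv _ _).symm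
  have he {Y : SimplicialSection M (φ'.precomp ψ)} {F F' : M.fiber (φ'.obj (ψ.obj k))}
      (T : Y ⟶ (cofree M (φ'.precomp ψ) k).obj F) (q : F ⟶ F') :
      e (T ≫ (cofree M (φ'.precomp ψ) k).map q) = e T ≫ q :=
    Adjunction.homEquiv_naturality_right_symm _ _ _
  have he' {F F' : M.fiber (φ'.obj (ψ.obj k))}
      (T : X ⟶ (restriction M φ' ψ).obj ((cofree M φ' (ψ.obj k)).obj F)) (q : F ⟶ F') :
      e' (T ≫ (restriction M φ' ψ).map ((cofree M φ' (ψ.obj k)).map q)) = e' T ≫ q := by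
    refine (congrArg ((evAdjCofree M φ' (ψ.obj k)).homEquiv _ _).symm
      (Adjunction.homEquiv_naturality_right_symm adj _ _)).trans ?_
    exact Adjunction.homEquiv_naturality_right_symm _ _ _
  have hee' {F : M.fiber (φ'.obj (ψ.obj k))}
      (T : X ⟶ (restriction M φ' ψ).obj ((cofree M φ' (ψ.obj k)).obj F)) :
      e (T ≫ comparison ψ k F) = Hom.app (adj.unit.app X) k ≫ e' T :=
    homEquiv_symm_comp_comparison adj T
  have hw : e'.symm y ≫ comparison ψ k D =
      e.symm g ≫ (cofree M (φ'.precomp ψ) k).map (endpoint δ 0) := by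
    apply e.injective
    rw [hee', he, Equiv.apply_symm_apply, Equiv.apply_symm_apply, ← h₀, ← hg,
      endpoint_comp_eHomWhiskerRight]
  obtain ⟨z, hz₁, hz₂⟩ := pathSection.exists_lift hp hP hε hδ hψ
    ((pathSection.isPullback δ).lift (e'.symm y) (e.symm g) hw) (e.symm x) (by
      rw [pathSection.finish, ← Category.assoc, IsPullback.lift_snd]
      apply e.injective
      rw [he, he, Equiv.apply_symm_apply, Equiv.apply_symm_apply, ← h₁, ← hg,
        endpoint_comp_eHomWhiskerRight])
  refine ⟨e' (z ≫ pathSection.fst ε),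
    ε ≫ eHomWhiskerRight SSet.{v} (e (z ≫ pathSection.snd ε)) E, ?_, ?_, ?_, ?_⟩
  · rw [endpoint_comp_eHomWhiskerRight, ← he, ← hee', Category.assoc, Category.assoc,
      (pathSection.isPullback ε).w]
  · rw [endpoint_comp_eHomWhiskerRight, ← he, Category.assoc]
    exact (congrArg e hz₂).trans (Equiv.apply_symm_apply _ _)
  · rw [← he', Category.assoc, ← pathSection.map_fst hp, ← Category.assoc, hz₁,
      IsPullback.lift_fst, Equiv.apply_symm_apply]
  · rw [Category.assoc, ← eHom_whisker_exchange, ← Category.assoc, ← hp, Category.assoc,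
      ← eHomWhiskerRight_comp, ← he, Category.assoc, ← pathSection.map_snd hp,
      ← Category.assoc z, hz₁, IsPullback.lift_snd, Equiv.apply_symm_apply, hg]

/-- The unit of the adjunction is a weak equivalence at cofibrant sections. -/
lemma weakEquivalence_unit_app {P : ModelCategory (SimplicialSection M (φ'.precomp ψ))}
    (hP : IsProjective P)
    {L : SimplicialSection M (φ'.precomp ψ) ⥤ SimplicialSection M φ'}
    (adj : L ⊣ restriction M φ' ψ) (X : SimplicialSection M (φ'.precomp ψ)) [IsCofibrant X]
    {k : J} (hψ : ∀ j, IsWeakHomotopyEquivalence (ψ.map j k)) :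
    WeakEquivalence (Hom.app (adj.unit.app X) k) := by
  have hC := M.isSimplicialModelCategory (φ'.obj (ψ.obj k))
  obtain ⟨-, T, -⟩ := id hC
  have hX : IsCofibrant (C := M.fiber (φ'.obj (ψ.obj k))) (X.obj k) := hP.isCofibrant_obj X k
  let η : X.obj k ⟶ (L.obj X).obj (ψ.obj k) := Hom.app (adj.unit.app X) k
  have hι (i : Fin 2) := hC.trivialCofibrations_cylι T (X.obj k) i
  have hpo := IsPushout.of_hasPushout η (T.cylι (X.obj k) 0)
  have h₁ : trivialCofibrations _ (pushout.inl η (T.cylι (X.obj k) 0)) := by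
    have h := hι 0
    rw [← fibrations_llp] at h ⊢
    exact MorphismProperty.of_isPushout hpo h
  -- The pushout is the mapping cylinder of `η`, and the map is the inclusion of its free end. A map
  -- from the cylinder is a map from the target of `η` with a homotopy, so liftings against
  -- fibrations are the extensions just constructed.
  have h₂ : trivialCofibrations _ (T.cylι (X.obj k) 1 ≫ pushout.inr η (T.cylι (X.obj k) 0)) := by
    rw [← fibrations_llp]
    intro E D p hp
    have : Fibration p := ⟨hp⟩
    refine ⟨fun {x y} sq ↦ ?_⟩
    obtain ⟨f, h', hf₁, hf₂, hf₃, hf₄⟩ := exists_extension_along_unit hP adj X hψ p x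
      (pushout.inl _ _ ≫ y) (T.homEquiv _ _ _ (pushout.inr _ _ ≫ y))
      (by rw [← T.cylι_comp, ← Category.assoc, ← hpo.w, Category.assoc]; rfl)
      (by rw [← T.cylι_comp, ← Category.assoc, ← sq.w])
    refine ⟨⟨⟨hpo.desc f ((T.homEquiv _ _ _).symm h') ?_, ?_, hpo.hom_ext ?_ ?_⟩⟩⟩
    · rw [← T.endpoint_eq, hf₁]
      rfl
    · rw [Category.assoc, IsPushout.inr_desc, ← T.endpoint_eq, hf₂]
    · rw [← Category.assoc, IsPushout.inl_desc, hf₃]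
    · rw [← Category.assoc, IsPushout.inr_desc]
      apply (T.homEquiv _ _ _).injective
      rw [T.homEquiv_comp, Equiv.apply_symm_apply, hf₄]
  have w₀ : WeakEquivalence (T.cylι (X.obj k) 0) := ⟨(hι 0).2⟩
  have w₁ : WeakEquivalence (T.cylι (X.obj k) 1) := ⟨(hι 1).2⟩
  have w₂ : WeakEquivalence (pushout.inl η (T.cylι (X.obj k) 0)) := ⟨h₁.2⟩
  have w₃ : WeakEquivalence (pushout.inr η (T.cylι (X.obj k) 0)) :=
    (weakEquivalence_precomp_iff (T.cylι (X.obj k) 1) _).1 ⟨h₂.2⟩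
  refine (weakEquivalence_postcomp_iff η (pushout.inl η (T.cylι (X.obj k) 0))).1 ?_
  rw [hpo.w]
  infer_instance

/-- Restriction along a Dwyer-Kan equivalence is the right adjoint of a Quillen equivalence. -/
lemma isQuillenEquivalence_restriction {P : ModelCategory (SimplicialSection M (φ'.precomp ψ))}
    {P' : ModelCategory (SimplicialSection M φ')} (hP : IsProjective P) (hP' : IsProjective P')
    {L : SimplicialSection M (φ'.precomp ψ) ⥤ SimplicialSection M φ'}
    (adj : L ⊣ restriction M φ' ψ) (hψ : IsDwyerKanEquivalence ψ) :
    IsQuillenEquivalence adj where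
  isQuillenAdjunction := isQuillenAdjunction_restriction φ' ψ hP hP' adj
  weakEquivalence_iff X Y f _ _ := by
    rw [hP'.weakEquivalence_iff, hP.weakEquivalence_iff]
    -- The transpose of `f` is the unit followed by the restriction of `f`, and the unit is a weak
    -- equivalence at `j`.
    have h₁ (j : J) : WeakEquivalence (Hom.app (adj.homEquiv X Y f) j) ↔
        WeakEquivalence (Hom.app f (ψ.obj j)) := by
      have := weakEquivalence_unit_app hP adj X (k := j) fun j ↦ hψ.map_weakEquivalence j _
      rw [Adjunction.homEquiv_unit]
      exact weakEquivalence_precomp_iff (Hom.app (adj.unit.app X) j) (Hom.app f (ψ.obj j))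
    refine ⟨fun h j ↦ (h₁ j).2 (h _), fun h j' ↦ ?_⟩
    -- Essential surjectivity extends the weak equivalence from the objects `ψ(j)` to all objects of
    -- `J'`.
    obtain ⟨j, g, hg⟩ := hψ.exists_obj j'
    exact hP'.weakEquivalence_app_of_isHomotopyInvertible f hg ((h₁ j).1 (h j))

end QuillenEquivalence

end

end SimplicialSections

theorem propositionp {I : Type u'} [Category.{v} I]
    (M : SimplicialSections.SimplicialQuillenPresheaf.{v, u} I)
    (hM : ∀ i : I, SimplicialSections.IsCombinatorial (M.fiber i))
    {J : Type v} [Category.{v} J] [SimplicialCategory J]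
    {J' : Type v} [Category.{v} J'] [SimplicialCategory J']
    (φ' : SimplicialSections.FunctorToOrdinary J' I) (ψ : EnrichedFunctor SSet.{v} J J') :
    ∃ (P : ModelCategory (SimplicialSections.SimplicialSection M (φ'.precomp ψ)))
      (P' : ModelCategory (SimplicialSections.SimplicialSection M φ')),
      SimplicialSections.SimplicialSection.IsProjective P ∧
      SimplicialSections.SimplicialSection.IsProjective P' ∧
      (SimplicialSections.SimplicialSection.restriction M φ' ψ).IsRightAdjoint ∧
      ∀ (L : SimplicialSections.SimplicialSection M (φ'.precomp ψ) ⥤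
          SimplicialSections.SimplicialSection M φ')
        (adj : L ⊣ SimplicialSections.SimplicialSection.restriction M φ' ψ),
        SimplicialSections.IsQuillenAdjunction adj ∧
        (SimplicialSections.IsDwyerKanEquivalence ψ →
          SimplicialSections.IsQuillenEquivalence adj) := by
  have hP := SimplicialSections.isProjective_projectiveModelCategory M (φ'.precomp ψ) hM
  have hP' := SimplicialSections.isProjective_projectiveModelCategory M φ' hM
  refine ⟨SimplicialSections.projectiveModelCategory M (φ'.precomp ψ) hM,
    SimplicialSections.projectiveModelCategory M φ' hM, hP, hP',
    SimplicialSections.isRightAdjoint_restriction hM φ' ψ, fun L adj ↦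
    ⟨SimplicialSections.isQuillenAdjunction_restriction φ' ψ hP hP' adj, fun hψ ↦ ?_⟩⟩
  have hp (i : I) := SimplicialSections.hasLimits_of_isLocallyPresentable _
    (hM i).isLocallyPresentable
  have hc (i : I) := SimplicialSections.hasColimits_of_isLocallyPresentable _
    (hM i).isLocallyPresentable
  have (i : I) : Limits.HasProducts.{v} (M.fiber i) := fun _ ↦ inferInstance
  have (i : I) : Limits.HasCoproducts.{v} (M.fiber i) := fun _ ↦ inferInstance
  exact SimplicialSections.isQuillenEquivalence_restriction hP hP' adj hψ
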